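/- Let $M$ be a smooth 2-manifold, $\hat x: M\to\mathbb S^3\subset\mathbb R^4$ a smooth immersion with smooth unit normal field $\mathbf n: M\to\mathbb R^4$ (tangent to $\mathbb S^3$) and with no umbilical point. Let $g_0$ be the round metric, $\lambda$ a smooth positive function on $\mathbb S^3$, $\hat\lambda=\lambda\circ\hat x$, and let $(u^1,u^2)$ be an isothermal coordinate on an open subset of $M$. In $(\mathbb S^3,\lambda^2g_0)$ let $I_\lambda=E_\lambda|du|^2$ be the first fundamental form of $\hat x$, $II_\lambda$ the second fundamental form with respect to the unit normal $\mathbf n_\lambda=\hat\lambda^{-1}\mathbf n$ (for $\lambda=1$, $II=-\langle d\hat x,d\mathbf n\rangle$), $H_\lambda=\frac12\mathrm{Tr}_{I_\lambda}II_\lambda$, $\overset{\circ}{II}_\lambda$ the traceless part of $II_\lambda$, and $$\mathcal H_\lambda=\Delta_\lambda H_\lambda+|\overset{\circ}{II}_\lambda|^2H_\lambda+(\overset{\circ}{II}_\lambda)^{ij}(R^\lambda)_{i3j3}-(R^\lambda)_{3i,}{}^{i},$$ where $R^\lambda$ denotes the Riemann and Ricci curvature of $\lambda^2g_0$ (with signs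 such that $R_{ijij}>0$ and $R_{ii}>0$ for the round metric), the index $3$ stands for $\mathbf n_\lambda$, and $\Delta_\lambda$, norms and the divergence of the 1-form $(R^\lambda)_{3i}du^i$ are taken with respect to $I_\lambda$. On $\mathbb R^{1,4}=\mathbb R\times\mathbb R^4$ let $\langle(t,x),(s,y)\rangle=-ts+x\cdot y$. Put $y_\lambda=\hat\lambda(1,\hat x)$, let $\xi=H(1,\hat x)+(0,\mathbf n)$ be the conformal Gauss map ($H$ the mean curvature for $g_0$), with $\langle d\xi,d\xi\rangle=m|du|^2$, and let $y^*_\lambda$ be the vector field with $$\langle y^*_\lambda,y_\lambda\rangle=-1,\quad \langle y^*_\lambda,y^*_\lambda\rangle=\langle y^*_\lambda,\xi\rangle=\langle y^*_\lambda,\xi_{u^1}\rangle=\langle y^*_\lambda,\xi_{u^2}\rangle=0.$$ Let $\omega^\lambda=\langle dy_\lambda,y^*_\lambda\rangle$, $(\Omega_\lambda)_{ij}=-\langle\xi_{u^i},(y_\lambda)_{u^j}\rangle$, $(\Omega^*_\lambda)_{ij}=-\langle\xi_{u^i},(y^*_\lambda)_{u^j}\rangle$. Let $\tilde x=\alpha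 y_\lambda+\alpha\rho\, y^*_\lambda$ be the associate surface in the coordinates $(\alpha,\rho,u^1,u^2)$ with $\alpha>0$ and $\rho$ near $0$, with first fundamental form $I^{\tilde x}=\langle d\tilde x,d\tilde x\rangle$, second fundamental form $II^{\tilde x}=-\langle d\tilde x,d\xi\rangle$, mean curvature $\tilde H=\mathrm{Tr}\big((I^{\tilde x})^{-1}II^{\tilde x}\big)$, and let $\tilde\Delta$ be the Laplace–Beltrami operator of $I^{\tilde x}$. Then $y^*_\lambda$ exists and is unique at every point, $I^{\tilde x}$ is nondegenerate at $\rho=0$, and for all $\alpha>0$ $$\tilde\Delta\tilde\Delta\tilde H\big|_{\rho=0}=8\alpha^{-5}\,\mathcal I_\lambda,$$ $$\mathcal I_\lambda=\Delta_\lambda\mathcal H_\lambda+9|\omega^\lambda|^2\mathcal H_\lambda-3\,\mathrm{Div}(\omega^\lambda)\mathcal H_\lambda-6\,\omega^\lambda(\nabla\mathcal H_\lambda)-\frac{3\,\mathrm{Tr}(\Omega_\lambda\Omega^*_\lambda)}{2m^2}|\Omega_\lambda|^2\mathcal H_\lambda,$$ where $\mathrm{Tr}(\Omega_\lambda\Omega^*_\lambda)$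 is the trace of the product of the coordinate matrices and the norms, $\mathrm{Div}$ and $\nabla$ refer to $I_\lambda$. Moreover $\mathcal I_\lambda$ is a conformal invariant of order $5$ of $\hat x$: (i) its value at a point of $M$ does not depend on the isothermal coordinate; (ii) if $\varphi$ is a conformal transformation of $\mathbb S^3$ induced by a linear Lorentz transformation of $\mathbb R^{1,4}$ that preserves the positive light cone, and $\varphi$ is an isometry from $\lambda^2g_0$ to $\mu^2g_0$, then $\mathcal I_\mu$ of $\varphi\circ\hat x$ with normal $d\varphi(\mathbf n)/|d\varphi(\mathbf n)|$ equals $\mathcal I_\lambda$ of $\hat x$ with normal $\mathbf n$; (iii) $\mathcal I_{\mu\lambda}=(\mu\circ\hat x)^{-5}\,\mathcal I_\lambda$ for all smooth positive $\lambda,\mu$ on $\mathbb S^3$. -/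

import Mathlib

open scoped Manifold ContDiff

noncomputable section

namespace AssocSurface

/-- Coordinate space `ℝ^d`. -/
abbrev Coord (d : ℕ) : Type := EuclideanSpace ℝ (Fin d)

/-- The Euclidean space `ℝ⁴` that contains the unit sphere `𝕊³`. -/
abbrev E4 : Type := EuclideanSpace ℝ (Fin 4)

/-- Minkowski spacetime `ℝ^{1,4}`, the vectors `(t, x)`. -/
abbrev Mink : Type := ℝ × E4

/-- The Lorentz product `⟨(t, x), (s, y)⟩ = - s t + x · y`. -/
def lor (v w : Mink) : ℝ := -(v.1 * w.1) + inner ℝ v.2 w.2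

/-- The partial derivative in the `i`-th coordinate. -/
def pd {d : ℕ} {V : Type*} [NormedAddCommGroup V] [NormedSpace ℝ V]
    (i : Fin d) (F : Coord d → V) (c : Coord d) : V :=
  fderiv ℝ F c (EuclideanSpace.single i 1)

/-! ### (Pseudo-)Riemannian metrics in coordinates -/

/-- The Christoffel symbol `Γ^k_{ij}` of the metric `g`. -/
def christoffel {d : ℕ} (g : Coord d → Matrix (Fin d) (Fin d) ℝ)
    (k i j : Fin d) (c : Coord d) : ℝ :=
  (1 / 2) * ∑ l, (g c)⁻¹ k l *
    (pd i (fun b => g b j l) c + pd j (fun b => g b i l) c - pd l (fun b => g b i j) c)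

/-- The curvature `R_{ijkl} = ⟨∇_j ∇_i ∂_k - ∇_i ∇_j ∂_k, ∂_l⟩`; in this convention
`R_{ijij}` is positive on round spheres. -/
def riemann {d : ℕ} (g : Coord d → Matrix (Fin d) (Fin d) ℝ)
    (i j k l : Fin d) (c : Coord d) : ℝ :=
  ∑ q, g c q l *
    (pd j (christoffel g q i k) c - pd i (christoffel g q j k) c
      + ∑ p, (christoffel g p i k c * christoffel g q j p c
          - christoffel g p j k c * christoffel g q i p c))

/-- The Ricci curvature `R_{ij} = g^{kl} R_{ikjl}`. -/
def ricci {d : ℕ} (g : Coord d → Matrix (Fin d) (Fin d) ℝ)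
    (i j : Fin d) (c : Coord d) : ℝ :=
  ∑ k, ∑ l, (g c)⁻¹ k l * riemann g i k j l c

/-- The Laplace-Beltrami operator `|g|^{-1/2} ∂_A (|g|^{1/2} g^{AB} ∂_B F)`. -/
def laplaceBeltrami {d : ℕ} (g : Coord d → Matrix (Fin d) (Fin d) ℝ)
    (F : Coord d → ℝ) (c : Coord d) : ℝ :=
  (Real.sqrt |(g c).det|)⁻¹ *
    ∑ A, ∑ B, pd A (fun b => Real.sqrt |(g b).det| * (g b)⁻¹ A B * pd B F b) c

/-! ### A surface `f` with unit normal `ν` in `(𝕊³, λ² g₀)`, in an isothermal coordinate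

Here `f, ν : ℝ² → ℝ⁴` are a parametrized surface in `𝕊³` and its unit normal for the round
metric, and `lam` is a conformal factor. -/

/-- The parametrization `(u¹, u², s) ↦ cos s f(u) + sin s ν(u)` of `𝕊³` near the surface.
At `s = 0` its `s`-derivative is `ν`. -/
def normalParam (f ν : Coord 2 → E4) (w : Coord 3) : E4 :=
  Real.cos (w 2) • f !₂[w 0, w 1] + Real.sin (w 2) • ν !₂[w 0, w 1]

/-- The metric `λ² g₀` of `𝕊³` in the coordinates given by `normalParam`. -/
def ambientMetric (f ν : Coord 2 → E4) (lam : E4 → ℝ) (w : Coord 3) :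
    Matrix (Fin 3) (Fin 3) ℝ :=
  Matrix.of fun i j => lam (normalParam f ν w) ^ 2 *
    inner ℝ (pd i (normalParam f ν) w) (pd j (normalParam f ν) w)

/-- The point of the surface `s = 0` with coordinate `u`. -/
def onSurface (u : Coord 2) : Coord 3 := !₂[u 0, u 1, 0]

/-- The factor `E_λ` of the first fundamental form `I_λ = E_λ |du|²`. -/
def confE (f : Coord 2 → E4) (lam : E4 → ℝ) (u : Coord 2) : ℝ :=
  lam (f u) ^ 2 * inner ℝ (pd 0 f u) (pd 0 f u)

/-- The second fundamental form `(II_λ)_{ij} = (λ² g₀)(∇^λ_{∂_i} ∂_j, n_λ)` of the surface in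
`(𝕊³, λ² g₀)`, where `n_λ = λ⁻¹ ∂_s` is the unit normal. -/
def secondFF (f ν : Coord 2 → E4) (lam : E4 → ℝ) (i j : Fin 2) (u : Coord 2) : ℝ :=
  lam (f u) * christoffel (ambientMetric f ν lam) 2 i.castSucc j.castSucc (onSurface u)

/-- The mean curvature `H_λ`, half the trace of `II_λ`. -/
def meanCurv (f ν : Coord 2 → E4) (lam : E4 → ℝ) (u : Coord 2) : ℝ :=
  (1 / (2 * confE f lam u)) * (secondFF f ν lam 0 0 u + secondFF f ν lam 1 1 u)

/-- The traceless part of `II_λ`. -/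
def tracelessFF (f ν : Coord 2 → E4) (lam : E4 → ℝ) (i j : Fin 2) (u : Coord 2) : ℝ :=
  secondFF f ν lam i j u - if i = j then meanCurv f ν lam u * confE f lam u else 0

/-- `(R^λ)_{i3j3}`, where the index `3` stands for the unit normal `n_λ = λ⁻¹ ∂_s`. -/
def riemNormal (f ν : Coord 2 → E4) (lam : E4 → ℝ) (i j : Fin 2) (u : Coord 2) : ℝ :=
  riemann (ambientMetric f ν lam) i.castSucc 2 j.castSucc 2 (onSurface u) / lam (f u) ^ 2

/-- `(R^λ)_{3i}`, where the index `3` stands for the unit normal `n_λ = λ⁻¹ ∂_s`. -/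
def ricNormal (f ν : Coord 2 → E4) (lam : E4 → ℝ) (i : Fin 2) (u : Coord 2) : ℝ :=
  ricci (ambientMetric f ν lam) 2 i.castSucc (onSurface u) / lam (f u)

/-- The Laplacian `Δ_λ = E_λ⁻¹ (∂₁² + ∂₂²)` of `I_λ`. -/
def surfLaplace (f : Coord 2 → E4) (lam : E4 → ℝ) (φ : Coord 2 → ℝ) (u : Coord 2) : ℝ :=
  (confE f lam u)⁻¹ * ∑ i, pd i (pd i φ) u

/-- The `I_λ`-divergence `E_λ⁻¹ ∑ ∂_i β_i` of a 1-form. -/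
def surfDiv (f : Coord 2 → E4) (lam : E4 → ℝ) (β : Fin 2 → Coord 2 → ℝ) (u : Coord 2) : ℝ :=
  (confE f lam u)⁻¹ * ∑ i, pd i (β i) u

/-- The `I_λ`-inner product `E_λ⁻¹ ∑ β_i γ_i` of two 1-forms. -/
def formInner (f : Coord 2 → E4) (lam : E4 → ℝ) (β γ : Fin 2 → Coord 2 → ℝ)
    (u : Coord 2) : ℝ :=
  (confE f lam u)⁻¹ * ∑ i, β i u * γ i u

/-- The `I_λ`-inner product `E_λ⁻² ∑ S_{ij} T_{ij}` of two 2-tensors. -/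
def tensorInner (f : Coord 2 → E4) (lam : E4 → ℝ) (S T : Fin 2 → Fin 2 → Coord 2 → ℝ)
    (u : Coord 2) : ℝ :=
  (confE f lam u ^ 2)⁻¹ * ∑ i, ∑ j, S i j u * T i j u

/-- `𝓗_λ = Δ_λ H_λ + |II°_λ|² H_λ + (II°_λ)^{ij} (R^λ)_{i3j3} - (R^λ)_{3i,}^i`. -/
def scriptH (f ν : Coord 2 → E4) (lam : E4 → ℝ) (u : Coord 2) : ℝ :=
  surfLaplace f lam (meanCurv f ν lam) u
    + tensorInner f lam (tracelessFF f ν lam) (tracelessFF f ν lam) u * meanCurv f ν lam u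
    + tensorInner f lam (tracelessFF f ν lam) (riemNormal f ν lam) u
    - surfDiv f lam (ricNormal f ν lam) u

/-! ### The conformal Gauss map and the associate surface -/

/-- `y_λ = λ (1, f)`. -/
def yLam (f : Coord 2 → E4) (lam : E4 → ℝ) (u : Coord 2) : Mink := lam (f u) • (1, f u)

/-- The conformal Gauss map `ξ = H (1, f) + (0, ν)`, with `H` the mean curvature for the round
metric. -/
def gaussMap (f ν : Coord 2 → E4) (u : Coord 2) : Mink :=
  meanCurv f ν (fun _ => 1) u • ((1, f u) : Mink) + (0, ν u)

/-- The equations `⟨y*, y_λ⟩ = -1`, `⟨y*, y*⟩ = ⟨y*, ξ⟩ = ⟨y*, ξ_{u¹}⟩ = ⟨y*, ξ_{u²}⟩ = 0`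
for `y*` at `u`. -/
def IsDualNull (f ν : Coord 2 → E4) (lam : E4 → ℝ) (u : Coord 2) (v : Mink) : Prop :=
  lor v (yLam f lam u) = -1 ∧ lor v v = 0 ∧ lor v (gaussMap f ν u) = 0 ∧
    ∀ i, lor v (pd i (gaussMap f ν) u) = 0

/-- The null vector `y*_λ`, the solution of `IsDualNull`. -/
def yStar (f ν : Coord 2 → E4) (lam : E4 → ℝ) (u : Coord 2) : Mink :=
  Classical.epsilon (IsDualNull f ν lam u)

/-- The factor `m` of the Möbius metric `⟨dξ, dξ⟩ = m |du|²`. -/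
def moebiusFactor (f ν : Coord 2 → E4) (u : Coord 2) : ℝ :=
  lor (pd 0 (gaussMap f ν) u) (pd 0 (gaussMap f ν) u)

/-- `ω^λ = ⟨dy_λ, y*_λ⟩`. -/
def omegaForm (f ν : Coord 2 → E4) (lam : E4 → ℝ) (i : Fin 2) (u : Coord 2) : ℝ :=
  lor (pd i (yLam f lam) u) (yStar f ν lam u)

/-- `(Ω_λ)_{ij} = - ⟨ξ_{u^i}, (y_λ)_{u^j}⟩`. -/
def OmegaT (f ν : Coord 2 → E4) (lam : E4 → ℝ) (i j : Fin 2) (u : Coord 2) : ℝ :=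
  -lor (pd i (gaussMap f ν) u) (pd j (yLam f lam) u)

/-- `(Ω*_λ)_{ij} = - ⟨ξ_{u^i}, (y*_λ)_{u^j}⟩`. -/
def OmegaStar (f ν : Coord 2 → E4) (lam : E4 → ℝ) (i j : Fin 2) (u : Coord 2) : ℝ :=
  -lor (pd i (gaussMap f ν) u) (pd j (yStar f ν lam) u)

/-- The part `(u¹, u²)` of the coordinate `(α, ρ, u¹, u²)`. -/
def baseCoord (c : Coord 4) : Coord 2 := !₂[c 2, c 3]

/-- The associate surface `x̃ = α y_λ + α ρ y*_λ` in the coordinate `(α, ρ, u¹, u²)`. -/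
def assoc (f ν : Coord 2 → E4) (lam : E4 → ℝ) (c : Coord 4) : Mink :=
  c 0 • yLam f lam (baseCoord c) + (c 0 * c 1) • yStar f ν lam (baseCoord c)

/-- The first fundamental form of `x̃`. -/
def assocI (f ν : Coord 2 → E4) (lam : E4 → ℝ) (c : Coord 4) : Matrix (Fin 4) (Fin 4) ℝ :=
  Matrix.of fun A B => lor (pd A (assoc f ν lam) c) (pd B (assoc f ν lam) c)

/-- The second fundamental form `- ⟨dx̃, dξ⟩` of `x̃`, whose unit normal is `ξ`. -/
def assocII (f ν : Coord 2 → E4) (lam : E4 → ℝ) (c : Coord 4) : Matrix (Fin 4) (Fin 4) ℝ :=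
  Matrix.of fun A B =>
    -lor (pd A (assoc f ν lam) c) (pd B (fun b => gaussMap f ν (baseCoord b)) c)

/-- The mean curvature `H̃ = Tr (I⁻¹ II)` of `x̃`. -/
def assocH (f ν : Coord 2 → E4) (lam : E4 → ℝ) (c : Coord 4) : ℝ :=
  ((assocI f ν lam c)⁻¹ * assocII f ν lam c).trace

/-- The Laplacian `Δ̃` of `x̃`. -/
def assocLaplace (f ν : Coord 2 → E4) (lam : E4 → ℝ) (F : Coord 4 → ℝ) : Coord 4 → ℝ :=
  laplaceBeltrami (assocI f ν lam) F

/-- `Δ_λ𝓗_λ + 9|ω^λ|²𝓗_λ - 3 Div(ω^λ)𝓗_λ - 6 ω^λ(∇𝓗_λ) - (3 Tr(Ω_λΩ*_λ)/(2m²)) |Ω_λ|² 𝓗_λ`. -/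
def invariantFive (f ν : Coord 2 → E4) (lam : E4 → ℝ) (u : Coord 2) : ℝ :=
  surfLaplace f lam (scriptH f ν lam) u
    + 9 * formInner f lam (omegaForm f ν lam) (omegaForm f ν lam) u * scriptH f ν lam u
    - 3 * surfDiv f lam (omegaForm f ν lam) u * scriptH f ν lam u
    - 6 * formInner f lam (omegaForm f ν lam) (fun i => pd i (scriptH f ν lam)) u
    - 3 * (Matrix.of (fun i j => OmegaT f ν lam i j u) *
          Matrix.of (fun i j => OmegaStar f ν lam i j u)).trace
        / (2 * moebiusFactor f ν u ^ 2)
      * tensorInner f lam (OmegaT f ν lam) (OmegaT f ν lam) u * scriptH f ν lam u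

/-! ### Immersed surfaces in `𝕊³` -/

/-- `lam` restricts to a smooth positive function on `𝕊³`. -/
def IsConformalFactor (lam : E4 → ℝ) : Prop :=
  ∀ v : E4, ‖v‖ = 1 → ContDiffAt ℝ ∞ lam v ∧ 0 < lam v

section Surface

variable {M : Type*} [TopologicalSpace M] [ChartedSpace (Coord 2) M]

/-- The differential at `p` of a map from the surface to `ℝ⁴`. -/
def dmap (F : M → E4) (p : M) (v : TangentSpace (𝓡 2) p) : E4 :=
  mfderiv (𝓡 2) 𝓘(ℝ, E4) F p v

/-- `x` is a smooth immersion of the surface into `𝕊³` and `n` is a smooth unit normal of it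
in `𝕊³`. -/
structure IsImmersedSurface (x n : M → E4) : Prop where
  smooth : ContMDiff (𝓡 2) 𝓘(ℝ, E4) ∞ x
  unit : ∀ p, ‖x p‖ = 1
  immersion : ∀ p, Function.Injective (dmap x p)
  normal_smooth : ContMDiff (𝓡 2) 𝓘(ℝ, E4) ∞ n
  normal_unit : ∀ p, ‖n p‖ = 1
  normal_point : ∀ p, inner ℝ (n p) (x p) = 0
  normal_tangent : ∀ p v, inner ℝ (n p) (dmap x p v) = 0

/-- `p` is umbilical: `II = - ⟨dx, dn⟩` is a multiple of `I = ⟨dx, dx⟩` at `p`. -/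
def IsUmbilic (x n : M → E4) (p : M) : Prop :=
  ∃ c : ℝ, ∀ v w : TangentSpace (𝓡 2) p,
    -inner ℝ (dmap x p v) (dmap n p w) = c * inner ℝ (dmap x p v) (dmap x p w)

/-- The expression of a map in the coordinate `e`. -/
def inChart (e : OpenPartialHomeomorph M (Coord 2)) (F : M → E4) (u : Coord 2) : E4 :=
  F (e.symm u)

/-- `e` is an isothermal coordinate (of the smooth structure) for `x`. -/
def IsIsothermal (x : M → E4) (e : OpenPartialHomeomorph M (Coord 2)) : Prop :=
  e ∈ IsManifold.maximalAtlas (𝓡 2) ∞ M ∧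
    ∀ u ∈ e.target,
      inner ℝ (pd 0 (inChart e x) u) (pd 1 (inChart e x) u) = 0 ∧
      inner ℝ (pd 0 (inChart e x) u) (pd 0 (inChart e x) u) =
        inner ℝ (pd 1 (inChart e x) u) (pd 1 (inChart e x) u)

/-- `L` is a Lorentz transformation that preserves the positive light cone. -/
def IsLorentz (L : Mink →ₗ[ℝ] Mink) : Prop :=
  (∀ v w, lor (L v) (L w) = lor v w) ∧ ∀ v : E4, ‖v‖ = 1 → 0 < (L (1, v)).1

/-- The conformal transformation `φ` of `𝕊³` that corresponds to `L`, that is,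
`L (1, v) = t (1, φ v)` with `t > 0`. -/
def conformalMap (L : Mink →ₗ[ℝ] Mink) (v : E4) : E4 := ((L (1, v)).1)⁻¹ • (L (1, v)).2

/-- The unit normal `dφ(n) / |dφ(n)|` of the transformed surface `φ ∘ x`. -/
def pushNormal (φ : E4 → E4) (x n : M → E4) (p : M) : E4 :=
  ‖fderiv ℝ φ (x p) (n p)‖⁻¹ • fderiv ℝ φ (x p) (n p)

/-- `I`, a scalar computed from a surface in `(𝕊³, λ² g₀)` in isothermal coordinates, is a
conformal invariant of order `k` of the surface `x` with normal `n`. -/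
structure IsConformalInvariant (k : ℕ)
    (I : (Coord 2 → E4) → (Coord 2 → E4) → (E4 → ℝ) → Coord 2 → ℝ)
    (x n : M → E4) : Prop where
  /-- `I` is a scalar: it does not depend on the isothermal coordinate. -/
  scalar : ∀ lam, IsConformalFactor lam → ∀ e₁ e₂, IsIsothermal x e₁ → IsIsothermal x e₂ →
    ∀ p, p ∈ e₁.source → p ∈ e₂.source →
      I (inChart e₁ x) (inChart e₁ n) lam (e₁ p) = I (inChart e₂ x) (inChart e₂ n) lam (e₂ p)
  /-- `I` is natural: if the transformation `φ` given by `L` is an isometry from `λ² g₀` to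
  `μ² g₀`, that is, `L (λ (1, v)) = μ(φ v) (1, φ v)`, then `φ ∘ x` in `μ² g₀` has the same `I` as
  `x` in `λ² g₀`. -/
  natural : ∀ L, IsLorentz L → ∀ lam mu, IsConformalFactor lam → IsConformalFactor mu →
    (∀ v : E4, ‖v‖ = 1 →
      L (lam v • (1, v)) = mu (conformalMap L v) • ((1, conformalMap L v) : Mink)) →
    ∀ e, IsIsothermal x e → ∀ u ∈ e.target,
      I (inChart e (conformalMap L ∘ x)) (inChart e (pushNormal (conformalMap L) x n)) mu u =
        I (inChart e x) (inChart e n) lam u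
  /-- `I(μ² g) = μ^{-k} I(g)` for all metrics `g = λ² g₀`. -/
  scaling : ∀ lam mu, IsConformalFactor lam → IsConformalFactor mu →
    ∀ e, IsIsothermal x e → ∀ u ∈ e.target,
      I (inChart e x) (inChart e n) (fun v => mu v * lam v) u =
        (mu (inChart e x u) ^ k)⁻¹ * I (inChart e x) (inChart e n) lam u

end Surface

end AssocSurface

end

/-! The computation takes place in ℝ^{1,4}. The map λ(1, ·) places the sphere in the light cone with
induced metric λ²g₀, so Christoffel symbols, curvature and second fundamental form all become
Lorentz products. The normal space of the lifted sphere is spanned by two null vectors, its position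
Y and a dual vector Z, and the Gauss equation then expresses R^λ through the single tensor ⟨Y_ij, Z⟩
(`IsGram.riemann_of_null`). For every λ one has ξ = N_λ + H_λ y_λ, with N_λ the lifted unit normal
(`IsoPatch.gaussMap_eq`). The map ξ is conformal, it is immersed because there are no umbilics, and
its flat Laplacian is −(tr Ω*) y − 2mξ (`laplace_gaussMap`). Substituted into the definition of 𝓗,
this collapses it to −E⁻¹ tr Ω* (`scriptH_eq`).

In the frame y, y*, ξ_1, ξ_2, ξ the metric of the associate surface depends only on α, ρ, ω, m and P
= Ω + ρΩ*. Its volume density is α³Q with Q = −det P / m. Since tr Ω = 0, the mean curvature −tr P /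
(αQ) equals ρE𝓗 / (αQ) (`assocH_eq`). Put q = tr(ΩΩ*)/m, which is ∂Q/∂ρ at ρ = 0, and J s = Σ (∂_i −
3ω_i)² s. Then Δ̃H̃ = (α³Q)⁻¹(2E𝓗 + ρC), where C = J𝓗 − 3q𝓗 at ρ = 0 (`assocLaplace_assocH`,
`fluxDiv_slice`). For a function that equals α⁻³w, with ρ-derivative α⁻³z, at ρ = 0, the Laplacian
there is α⁻⁵E⁻¹(6Ez + 3qw + Jw) (`assocLaplace_slice`). Here w = 2𝓗 and Ez = J𝓗 − 5q𝓗, so the result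
is 8α⁻⁵E⁻¹(J𝓗 − 3q𝓗), and E⁻¹(J𝓗 − 3q𝓗) is 𝓘 (`IsoPatch.invariantFive_eq`).

The invariance is read off from the same formula. Replacing λ by μλ changes ω by −d log μ, 𝓗 by the
factor μ⁻³, E by μ², and leaves q alone; d − 3ω is therefore covariant on densities of weight −3,
and 𝓘 acquires the factor μ⁻⁵. A change of isothermal coordinate is conformal and harmonic, so E, q
and J all scale by the same factor. A Lorentz transformation carries y, ξ, y* to those of the image
surface and preserves all products. In the last two cases ξ is identified through its
characterization by the trace condition (`eq_gaussMap`). -/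

noncomputable section

namespace AssocSurface

/-! ### Partial derivatives -/

section PartialDerivatives

variable {d : ℕ} {V W : Type*} [NormedAddCommGroup V] [NormedSpace ℝ V]
  [NormedAddCommGroup W] [NormedSpace ℝ W]

theorem pd_congr {F G : Coord d → V} {c : Coord d} (i : Fin d) (h : F =ᶠ[nhds c] G) :
    pd i F c = pd i G c := by
  simp only [pd, h.fderiv_eq]

theorem pd_congr_of_isOpen {F G : Coord d → V} {U : Set (Coord d)} (hU : IsOpen U)
    (h : ∀ c ∈ U, F c = G c) (i : Fin d) {c : Coord d} (hc : c ∈ U) : pd i F c = pd i G c :=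
  pd_congr i (Filter.eventuallyEq_of_mem (hU.mem_nhds hc) h)

theorem pd_const (i : Fin d) (v : V) (c : Coord d) : pd i (fun _ => v) c = 0 := by
  simp [pd]

theorem pd_eq_zero {F : Coord d → V} {U : Set (Coord d)} (hU : IsOpen U) {v : V}
    (h : ∀ c ∈ U, F c = v) (i : Fin d) {c : Coord d} (hc : c ∈ U) : pd i F c = 0 := by
  rw [pd_congr_of_isOpen hU h i hc, pd_const]

theorem differentiableAt_of_smooth {F : Coord d → V} {c : Coord d} (hF : ContDiffAt ℝ ∞ F c) :
    DifferentiableAt ℝ F c :=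
  hF.differentiableAt (by simp)

theorem contDiffAt_pd {F : Coord d → V} {c : Coord d} (hF : ContDiffAt ℝ ∞ F c) (i : Fin d) :
    ContDiffAt ℝ ∞ (pd i F) c :=
  (hF.fderiv_right (m := ∞) (by simp)).clm_apply contDiffAt_const

theorem pd_add {F G : Coord d → V} {c : Coord d} (hF : ContDiffAt ℝ ∞ F c)
    (hG : ContDiffAt ℝ ∞ G c) (i : Fin d) :
    pd i (fun b => F b + G b) c = pd i F c + pd i G c := by
  simp only [pd]
  rw [fderiv_fun_add (differentiableAt_of_smooth hF) (differentiableAt_of_smooth hG)]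
  rfl

theorem pd_sub {F G : Coord d → V} {c : Coord d} (hF : ContDiffAt ℝ ∞ F c)
    (hG : ContDiffAt ℝ ∞ G c) (i : Fin d) :
    pd i (fun b => F b - G b) c = pd i F c - pd i G c := by
  simp only [pd]
  rw [fderiv_fun_sub (differentiableAt_of_smooth hF) (differentiableAt_of_smooth hG)]
  rfl

theorem pd_neg (F : Coord d → V) (c : Coord d) (i : Fin d) :
    pd i (fun b => -F b) c = -pd i F c := by
  simp only [pd]
  rw [fderiv_fun_neg]
  rfl

theorem pd_sum {ι : Type*} (s : Finset ι) {F : ι → Coord d → V} {c : Coord d}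
    (hF : ∀ j ∈ s, ContDiffAt ℝ ∞ (F j) c) (i : Fin d) :
    pd i (fun b => ∑ j ∈ s, F j b) c = ∑ j ∈ s, pd i (F j) c := by
  simp only [pd]
  rw [fderiv_fun_sum fun j hj => differentiableAt_of_smooth (hF j hj)]
  simp

theorem pd_smul {a : Coord d → ℝ} {F : Coord d → V} {c : Coord d} (ha : ContDiffAt ℝ ∞ a c)
    (hF : ContDiffAt ℝ ∞ F c) (i : Fin d) :
    pd i (fun b => a b • F b) c = a c • pd i F c + pd i a c • F c := by
  simp only [pd]
  rw [fderiv_fun_smul (differentiableAt_of_smooth ha) (differentiableAt_of_smooth hF)]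
  rfl

theorem pd_mul {a b : Coord d → ℝ} {c : Coord d} (ha : ContDiffAt ℝ ∞ a c)
    (hb : ContDiffAt ℝ ∞ b c) (i : Fin d) :
    pd i (fun x => a x * b x) c = a c * pd i b c + pd i a c * b c :=
  pd_smul ha hb i

theorem pd_const_mul {b : Coord d → ℝ} {c : Coord d} (a : ℝ)
    (hb : ContDiffAt ℝ ∞ b c) (i : Fin d) :
    pd i (fun x => a * b x) c = a * pd i b c := by
  rw [pd_mul contDiffAt_const hb, pd_const]; ring

theorem pd_inv {a : Coord d → ℝ} {c : Coord d} (ha : ContDiffAt ℝ ∞ a c) (h0 : a c ≠ 0)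
    (i : Fin d) : pd i (fun x => (a x)⁻¹) c = -pd i a c / a c ^ 2 := by
  have h := (hasDerivAt_inv h0).comp_hasFDerivAt c (differentiableAt_of_smooth ha).hasFDerivAt
  simp only [pd]
  rw [show (fun x => (a x)⁻¹) = Inv.inv ∘ a from rfl, h.fderiv]
  simp only [smul_apply, smul_eq_mul]
  ring

theorem pd_clm_apply (L : V →L[ℝ] W) {F : Coord d → V} {c : Coord d}
    (hF : ContDiffAt ℝ ∞ F c) (i : Fin d) : pd i (fun b => L (F b)) c = L (pd i F c) := by
  simp only [pd]
  rw [show (fun b => L (F b)) = L ∘ F from rfl,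
    fderiv_comp _ L.differentiableAt (differentiableAt_of_smooth hF), L.fderiv]
  rfl

theorem pd_comm {F : Coord d → V} {c : Coord d} (hF : ContDiffAt ℝ ∞ F c) (i j : Fin d) :
    pd i (pd j F) c = pd j (pd i F) c := by
  have h := (hF.isSymmSndFDerivAt (by
    rw [minSmoothness_of_isRCLikeNormedField]; exact WithTop.coe_le_coe.mpr (le_top : (2 : ℕ∞) ≤ ⊤))).eq (EuclideanSpace.single i 1)
    (EuclideanSpace.single j 1)
  have hd : DifferentiableAt ℝ (fderiv ℝ F) c :=
    (hF.fderiv_right (m := ∞) (by simp)).differentiableAt (by simp)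
  have key : ∀ v w : Coord d, fderiv ℝ (fun b => fderiv ℝ F b v) c w
      = fderiv ℝ (fderiv ℝ F) c w v := by
    intro v w
    rw [fderiv_clm_apply hd (differentiableAt_const _)]
    simp
  change fderiv ℝ (fun b => fderiv ℝ F b _) c _ = fderiv ℝ (fun b => fderiv ℝ F b _) c _
  rw [key, key, h]

theorem fderiv_coord {F : Coord d → V} {c : Coord d} (v : Coord d) :
    fderiv ℝ F c v = ∑ i, v i • pd i F c := by
  conv_lhs => rw [show v = ∑ i, v i • EuclideanSpace.single i (1 : ℝ) by
    ext j; simp [Finset.sum_apply, Pi.single_apply]]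
  simp [pd]

theorem pd_comp {k : ℕ} {F : Coord k → V} {τ : Coord d → Coord k} {c : Coord d}
    (hF : ContDiffAt ℝ ∞ F (τ c)) (hτ : ContDiffAt ℝ ∞ τ c) (i : Fin d) :
    pd i (fun b => F (τ b)) c = ∑ j, pd i (fun b => τ b j) c • pd j F (τ c) := by
  have h1 : pd i (fun b => F (τ b)) c = fderiv ℝ F (τ c) (pd i τ c) := by
    simp only [pd]
    rw [show (fun b => F (τ b)) = F ∘ τ from rfl,
      fderiv_comp _ (differentiableAt_of_smooth hF) (differentiableAt_of_smooth hτ)]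
    rfl
  rw [h1, fderiv_coord]
  refine Finset.sum_congr rfl fun j _ => ?_
  congr 1
  exact (pd_clm_apply (EuclideanSpace.proj j : Coord k →L[ℝ] ℝ) hτ i).symm

theorem pd_coord (i j : Fin d) (c : Coord d) :
    pd i (fun b : Coord d => b j) c = if i = j then 1 else 0 := by
  have := pd_clm_apply (EuclideanSpace.proj j : Coord d →L[ℝ] ℝ) (F := fun b => b) (c := c)
    contDiffAt_id i
  refine this.trans ?_
  simp [pd, eq_comm]

theorem contDiffAt_coord (j : Fin d) (c : Coord d) :
    ContDiffAt ℝ ∞ (fun b : Coord d => b j) c := by fun_prop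

end PartialDerivatives

/-! ### The Lorentz product -/

theorem lor_comm (v w : Mink) : lor v w = lor w v := by
  simp only [lor, real_inner_comm]; ring

theorem lor_add_left (u v w : Mink) : lor (u + v) w = lor u w + lor v w := by
  simp only [lor, Prod.fst_add, Prod.snd_add, inner_add_left]; ring

theorem lor_add_right (u v w : Mink) : lor u (v + w) = lor u v + lor u w := by
  simp only [lor, Prod.fst_add, Prod.snd_add, inner_add_right]; ring

theorem lor_smul_left (a : ℝ) (v w : Mink) : lor (a • v) w = a * lor v w := by
  simp only [lor, Prod.smul_fst, Prod.smul_snd, real_inner_smul_left, smul_eq_mul]; ring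

theorem lor_smul_right (a : ℝ) (v w : Mink) : lor v (a • w) = a * lor v w := by
  simp only [lor, Prod.smul_fst, Prod.smul_snd, real_inner_smul_right, smul_eq_mul]; ring

theorem lor_neg_left (v w : Mink) : lor (-v) w = -lor v w := by
  simp only [lor, Prod.fst_neg, Prod.snd_neg, inner_neg_left]; ring

theorem lor_neg_right (v w : Mink) : lor v (-w) = -lor v w := by
  simp only [lor, Prod.fst_neg, Prod.snd_neg, inner_neg_right]; ring

theorem lor_sub_left (u v w : Mink) : lor (u - v) w = lor u w - lor v w := by
  rw [sub_eq_add_neg, lor_add_left, lor_neg_left, sub_eq_add_neg]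

theorem lor_sub_right (u v w : Mink) : lor u (v - w) = lor u v - lor u w := by
  rw [sub_eq_add_neg, lor_add_right, lor_neg_right, sub_eq_add_neg]

theorem lor_zero_left (v : Mink) : lor 0 v = 0 := by simp [lor]

theorem lor_zero_right (v : Mink) : lor v 0 = 0 := by simp [lor]

theorem lor_sum_left {ι : Type*} (s : Finset ι) (F : ι → Mink) (w : Mink) :
    lor (∑ i ∈ s, F i) w = ∑ i ∈ s, lor (F i) w := by
  classical
  induction s using Finset.induction_on with
  | empty => simp [lor]
  | insert a s ha ih => rw [Finset.sum_insert ha, Finset.sum_insert ha, lor_add_left, ih]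

theorem contDiffAt_lor {d : ℕ} {F G : Coord d → Mink} {c : Coord d}
    (hF : ContDiffAt ℝ ∞ F c) (hG : ContDiffAt ℝ ∞ G c) :
    ContDiffAt ℝ ∞ (fun b => lor (F b) (G b)) c := by
  unfold lor
  exact ((hF.fst.mul hG.fst).neg).add (hF.snd.inner ℝ hG.snd)

theorem pd_lor {d : ℕ} {F G : Coord d → Mink} {c : Coord d}
    (hF : ContDiffAt ℝ ∞ F c) (hG : ContDiffAt ℝ ∞ G c) (i : Fin d) :
    pd i (fun b => lor (F b) (G b)) c = lor (pd i F c) (G c) + lor (F c) (pd i G c) := by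
  have h1 := pd_clm_apply (ContinuousLinearMap.fst ℝ ℝ E4) hF i
  have h2 := pd_clm_apply (ContinuousLinearMap.fst ℝ ℝ E4) hG i
  have h3 := pd_clm_apply (ContinuousLinearMap.snd ℝ ℝ E4) hF i
  have h4 := pd_clm_apply (ContinuousLinearMap.snd ℝ ℝ E4) hG i
  simp only [ContinuousLinearMap.coe_fst', ContinuousLinearMap.coe_snd'] at h1 h2 h3 h4
  have h5 : pd i (fun b => inner ℝ (F b).2 (G b).2) c
      = inner ℝ (F c).2 (pd i G c).2 + inner ℝ (pd i F c).2 (G c).2 := by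
    rw [← h3, ← h4]
    simp only [pd]
    rw [fderiv_inner_apply ℝ (differentiableAt_of_smooth hF.snd)
      (differentiableAt_of_smooth hG.snd)]
  unfold lor
  rw [pd_add (hF.fst.mul hG.fst).neg (hF.snd.inner ℝ hG.snd), pd_neg,
    pd_mul hF.fst hG.fst, h1, h2, h5]
  ring

/-! ### Null frames -/

/-- `y` is null and orthogonal to the orthogonal vectors `a`, `b` of square `E` and to the unit
vector `n`. -/
structure IsNullFrame (y a b n : Mink) (E : ℝ) : Prop where
  yy : lor y y = 0
  ya : lor y a = 0
  yb : lor y b = 0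
  yn : lor y n = 0
  aa : lor a a = E
  bb : lor b b = E
  ab : lor a b = 0
  an : lor a n = 0
  bn : lor b n = 0
  nn : lor n n = 1
  pos : 0 < E
  fst : y.1 ≠ 0

/-- The projection of `(1, 0)` to the complement of `a`, `b`, `n`, divided by `y.1`. -/
def preDual (y a b n : Mink) (E : ℝ) : Mink :=
  (y.1)⁻¹ • (((1, 0) : Mink) - (E⁻¹ * lor (1, 0) a) • a - (E⁻¹ * lor (1, 0) b) • b
    - lor (1, 0) n • n)

/-- The null vector dual to `y` and orthogonal to `a`, `b`, `n`. -/
def dualNull (y a b n : Mink) (E : ℝ) : Mink :=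
  preDual y a b n E + ((1 / 2) * lor (preDual y a b n E) (preDual y a b n E)) • y

namespace IsNullFrame

variable {y a b n : Mink} {E : ℝ}

/-- The vector (1, 0) pairs with y to −y.1, and removing its components along a, b, n does not
affect this because they are orthogonal to y. Division by y.1 normalizes the pairing to −1. -/
theorem preDual_spec (h : IsNullFrame y a b n E) :
    lor (preDual y a b n E) y = -1 ∧ lor (preDual y a b n E) a = 0 ∧
      lor (preDual y a b n E) b = 0 ∧ lor (preDual y a b n E) n = 0 := by
  have hE := h.pos.ne'
  have e : lor (1, 0) y = -y.1 := by simp [lor]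
  have h0 := h.fst
  simp only [preDual, lor_smul_left, lor_sub_left, h.aa, h.bb, h.ab, h.an, h.bn, h.nn,
    lor_comm a y, lor_comm b y, lor_comm n y, lor_comm b a, lor_comm n a, lor_comm n b, h.ya,
    h.yb, h.yn, e]
  refine ⟨?_, ?_, ?_, ?_⟩ <;> field_simp <;> ring

/-- Adding t y to a vector p with ⟨p, y⟩ = −1 changes ⟨p, p⟩ by −2t and no product with y, a, b, n;
hence t = ⟨p, p⟩/2. -/
theorem dualNull_spec (h : IsNullFrame y a b n E) :
    lor (dualNull y a b n E) y = -1 ∧ lor (dualNull y a b n E) (dualNull y a b n E) = 0 ∧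
      lor (dualNull y a b n E) a = 0 ∧ lor (dualNull y a b n E) b = 0 ∧
      lor (dualNull y a b n E) n = 0 := by
  obtain ⟨h1, h2, h3, h4⟩ := h.preDual_spec
  refine ⟨?_, ?_, ?_, ?_, ?_⟩ <;>
    simp only [dualNull, lor_add_left, lor_add_right, lor_smul_left, lor_smul_right, h1, h2, h3,
      h4, lor_comm y (preDual y a b n E), h.yy, h.ya, h.yb, h.yn] <;> ring

/-- A vector in terms of a null frame and a dual null vector. -/
theorem expand (h : IsNullFrame y a b n E) {z : Mink} (hy : lor z y = -1) (hz : lor z z = 0)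
    (ha : lor z a = 0) (hb : lor z b = 0) (hn : lor z n = 0) (v : Mink) :
    v = -(lor v z) • y - lor v y • z + (E⁻¹ * lor v a) • a + (E⁻¹ * lor v b) • b
      + lor v n • n := by
  have hE := h.pos.ne'
  have pair : ∀ c : Fin 5 → ℝ, ∀ w : Mink, ∑ i, c i • (![y, z, a, b, n] : Fin 5 → Mink) i = w →
      lor w z = -c 0 ∧ lor w y = -c 1 ∧ lor w a = c 2 * E ∧ lor w b = c 3 * E ∧
        lor w n = c 4 := by
    rintro c w rfl
    simp only [Fin.sum_univ_five, lor_add_left, lor_smul_left]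
    simp [lor_comm y z, lor_comm a z, lor_comm b z, lor_comm n z, lor_comm a y, lor_comm b y,
      lor_comm n y, lor_comm b a, lor_comm n a, lor_comm n b, h.yy, h.ya, h.yb, h.yn, h.aa,
      h.bb, h.ab, h.an, h.bn, h.nn, hy, hz, ha, hb, hn]
  -- The products with z, y, a, b, n recover the coefficients of a combination, so only the zero
  -- combination vanishes. Five independent vectors span the five-dimensional ℝ^{1,4}.
  have li : LinearIndependent ℝ (![y, z, a, b, n] : Fin 5 → Mink) := by
    rw [Fintype.linearIndependent_iff]
    intro c hc
    obtain ⟨h1, h2, h3, h4, h5⟩ := pair c 0 hc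
    simp only [lor_zero_left] at h1 h2 h3 h4 h5
    intro i
    fin_cases i
    · simpa using h1
    · simpa using h2
    · simpa [hE] using h3
    · simpa [hE] using h4
    · simpa using h5.symm
  have sp := li.span_eq_top_of_card_eq_finrank' (by simp [Module.finrank_prod])
  have hv : v ∈ Submodule.span ℝ (Set.range (![y, z, a, b, n] : Fin 5 → Mink)) := by
    rw [sp]; trivial
  obtain ⟨c, hc⟩ := (Submodule.mem_span_range_iff_exists_fun ℝ).mp hv
  obtain ⟨h1, h2, h3, h4, h5⟩ := pair c v hc
  rw [h1, h2, h3, h4, h5]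
  rw [← hc]
  simp only [Fin.sum_univ_five]
  have e2 : E⁻¹ * (c 2 * E) = c 2 := by field_simp
  have e3 : E⁻¹ * (c 3 * E) = c 3 := by field_simp
  rw [e2, e3]
  simp

/-- Expanding z' in the frame of z leaves z' = z − ⟨z', z⟩ y. The square of the right side is 2⟨z',
z⟩, so nullity of z' forces z' = z. -/
theorem dual_unique (h : IsNullFrame y a b n E) {z z' : Mink} (hy : lor z y = -1)
    (hz : lor z z = 0) (ha : lor z a = 0) (hb : lor z b = 0) (hn : lor z n = 0)
    (hy' : lor z' y = -1) (hz' : lor z' z' = 0) (ha' : lor z' a = 0) (hb' : lor z' b = 0)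
    (hn' : lor z' n = 0) : z' = z := by
  have e := h.expand hy hz ha hb hn z'
  rw [hy', ha', hb', hn'] at e
  simp only [mul_zero, zero_smul, add_zero, neg_smul, one_smul, sub_neg_eq_add] at e
  have e2 : lor z' z' = 0 := hz'
  rw [e] at e2
  simp only [lor_add_left, lor_add_right, lor_neg_left, lor_neg_right, lor_smul_left,
    lor_smul_right, h.yy, hy, hz, lor_comm y z] at e2
  have e3 : lor z' z = 0 := by linarith
  rw [e3] at e
  simpa using e

end IsNullFrame

/-- The explicit formula for the dual vector is what gives smoothness of y*, which is itself only
introduced by choice. -/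
theorem contDiffAt_dualNull {d : ℕ} {y a b n : Coord d → Mink} {E : Coord d → ℝ} {c : Coord d}
    (hy : ContDiffAt ℝ ∞ y c) (ha : ContDiffAt ℝ ∞ a c) (hb : ContDiffAt ℝ ∞ b c)
    (hn : ContDiffAt ℝ ∞ n c) (hE : ContDiffAt ℝ ∞ E c) (h0 : (y c).1 ≠ 0) (hE0 : E c ≠ 0) :
    ContDiffAt ℝ ∞ (fun u => dualNull (y u) (a u) (b u) (n u) (E u)) c := by
  have hp : ContDiffAt ℝ ∞ (fun u => preDual (y u) (a u) (b u) (n u) (E u)) c := by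
    unfold preDual
    have e := hE.inv hE0
    exact (hy.fst.inv h0).smul (((contDiffAt_const.sub
      ((e.mul (contDiffAt_lor contDiffAt_const ha)).smul ha)).sub
      ((e.mul (contDiffAt_lor contDiffAt_const hb)).smul hb)).sub
      ((contDiffAt_lor contDiffAt_const hn).smul hn))
  exact hp.add ((contDiffAt_const.mul (contDiffAt_lor hp hp)).smul hy)

end AssocSurface

end

noncomputable section

namespace AssocSurface

/-! ### The metric induced on a submanifold of the light cone -/

theorem contDiffAt_det {d : ℕ} {k : ℕ} {g : Coord d → Matrix (Fin k) (Fin k) ℝ} {c : Coord d}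
    (hg : ∀ i j, ContDiffAt ℝ ∞ (fun b => g b i j) c) :
    ContDiffAt ℝ ∞ (fun b => (g b).det) c := by
  simp only [Matrix.det_apply]
  refine ContDiffAt.sum fun σ _ => ?_
  simp only [Units.smul_def, zsmul_eq_mul]
  exact contDiffAt_const.mul (contDiffAt_prod fun i _ => hg _ _)

theorem contDiffAt_matrix_inv {d : ℕ} {k : ℕ} {g : Coord d → Matrix (Fin k) (Fin k) ℝ}
    {c : Coord d} (hg : ∀ i j, ContDiffAt ℝ ∞ (fun b => g b i j) c) (h0 : (g c).det ≠ 0)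
    (i j : Fin k) : ContDiffAt ℝ ∞ (fun b => (g b)⁻¹ i j) c := by
  simp only [Matrix.inv_def, Ring.inverse_eq_inv', Matrix.smul_apply, smul_eq_mul,
    Matrix.adjugate_apply]
  refine ((contDiffAt_det hg).inv h0).mul (contDiffAt_det fun p q => ?_)
  simp only [Matrix.updateRow_apply]
  split_ifs
  · exact contDiffAt_const
  · exact hg p q

/-- `g` is the metric induced by `Y` on the open set `B`. -/
structure IsGram {d : ℕ} (B : Set (Coord d)) (Y : Coord d → Mink)
    (g : Coord d → Matrix (Fin d) (Fin d) ℝ) : Prop where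
  isOpen : IsOpen B
  smooth : ∀ c ∈ B, ContDiffAt ℝ ∞ Y c
  eq : ∀ c ∈ B, ∀ i j, g c i j = lor (pd i Y c) (pd j Y c)

namespace IsGram

variable {d : ℕ} {B : Set (Coord d)} {Y : Coord d → Mink}
  {g : Coord d → Matrix (Fin d) (Fin d) ℝ}

theorem symm (h : IsGram B Y g) {c : Coord d} (hc : c ∈ B) (i j : Fin d) : g c i j = g c j i := by
  rw [h.eq c hc, h.eq c hc, lor_comm]

theorem smooth_metric (h : IsGram B Y g) {c : Coord d} (hc : c ∈ B) (i j : Fin d) :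
    ContDiffAt ℝ ∞ (fun b => g b i j) c := by
  have hs := h.smooth c hc
  exact (contDiffAt_lor (contDiffAt_pd hs i) (contDiffAt_pd hs j)).congr_of_eventuallyEq
    (Filter.eventuallyEq_of_mem (h.isOpen.mem_nhds hc) fun b hb => h.eq b hb i j)

theorem pd_metric (h : IsGram B Y g) {c : Coord d} (hc : c ∈ B) (i j k : Fin d) :
    pd k (fun b => g b i j) c
      = lor (pd k (pd i Y) c) (pd j Y c) + lor (pd i Y c) (pd k (pd j Y) c) := by
  have hs := h.smooth c hc
  rw [pd_congr_of_isOpen h.isOpen (fun b hb => h.eq b hb i j) k hc,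
    pd_lor (contDiffAt_pd hs i) (contDiffAt_pd hs j)]

/-- Each of the three metric derivatives splits into two products. Symmetry of the second
derivatives of Y cancels all but the two copies of ⟨Y_ij, Y_l⟩. -/
theorem christoffel_eq (h : IsGram B Y g) {c : Coord d} (hc : c ∈ B) (k i j : Fin d) :
    christoffel g k i j c = ∑ l, (g c)⁻¹ k l * lor (pd i (pd j Y) c) (pd l Y c) := by
  have hs := h.smooth c hc
  rw [christoffel, Finset.mul_sum]
  refine Finset.sum_congr rfl fun l _ => ?_
  rw [h.pd_metric hc, h.pd_metric hc, h.pd_metric hc, pd_comm hs j i, pd_comm hs l i,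
    pd_comm hs l j, lor_comm (pd j Y c), lor_comm (pd i Y c)]
  ring

theorem smooth_christoffel (h : IsGram B Y g) {c : Coord d} (hc : c ∈ B) (h0 : (g c).det ≠ 0)
    (k i j : Fin d) : ContDiffAt ℝ ∞ (christoffel g k i j) c := by
  have hs := h.smooth c hc
  refine ContDiffAt.congr_of_eventuallyEq
    (f := fun b => ∑ l, (g b)⁻¹ k l * lor (pd i (pd j Y) b) (pd l Y b)) ?_
    (Filter.eventuallyEq_of_mem (h.isOpen.mem_nhds hc) fun b hb => h.christoffel_eq hb k i j)
  exact ContDiffAt.sum fun l _ => (contDiffAt_matrix_inv (h.smooth_metric hc) h0 k l).mul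
    (contDiffAt_lor (contDiffAt_pd (contDiffAt_pd hs j) i) (contDiffAt_pd hs l))

theorem sum_mul_christoffel (h : IsGram B Y g) {c : Coord d} (hc : c ∈ B) (h0 : (g c).det ≠ 0)
    (i j l : Fin d) :
    ∑ k, g c k l * christoffel g k i j c = lor (pd i (pd j Y) c) (pd l Y c) := by
  have hinv : g c * (g c)⁻¹ = 1 := Matrix.mul_nonsing_inv _ (isUnit_iff_ne_zero.mpr h0)
  simp only [h.christoffel_eq hc, Finset.mul_sum]
  rw [Finset.sum_comm]
  have : ∀ q, ∑ k, g c k l * ((g c)⁻¹ k q * lor (pd i (pd j Y) c) (pd q Y c))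
      = (if l = q then 1 else 0) * lor (pd i (pd j Y) c) (pd q Y c) := by
    intro q
    rw [← Matrix.one_apply, ← hinv, Matrix.mul_apply, Finset.sum_mul]
    refine Finset.sum_congr rfl fun k _ => ?_
    rw [h.symm hc k l]; ring
  simp [this]

/-- The part of the second derivative of `Y` that is normal to the submanifold. -/
def normalHess (Y : Coord d → Mink) (g : Coord d → Matrix (Fin d) (Fin d) ℝ) (i j : Fin d)
    (c : Coord d) : Mink :=
  pd i (pd j Y) c - ∑ q, christoffel g q i j c • pd q Y c

theorem normalHess_lor (h : IsGram B Y g) {c : Coord d} (hc : c ∈ B) (h0 : (g c).det ≠ 0)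
    (i j l : Fin d) : lor (normalHess Y g i j c) (pd l Y c) = 0 := by
  rw [normalHess, lor_sub_left, ← h.sum_mul_christoffel hc h0, lor_sum_left, sub_eq_zero]
  refine Finset.sum_congr rfl fun q _ => ?_
  rw [lor_smul_left, h.eq c hc]; ring

/-- Differentiating the identity Σ g Γ = ⟨Y_ik, Y_l⟩ gives the derivative of Γ with lowered index,
without ever differentiating the inverse metric. -/
theorem sum_mul_pd_christoffel (h : IsGram B Y g) {c : Coord d} (hc : c ∈ B)
    (h0 : (g c).det ≠ 0) (i j k l : Fin d) :
    ∑ q, g c q l * pd j (christoffel g q i k) c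
      = lor (pd j (pd i (pd k Y)) c) (pd l Y c) + lor (pd i (pd k Y) c) (pd j (pd l Y) c)
        - ∑ q, christoffel g q i k c *
          (lor (pd j (pd q Y) c) (pd l Y c) + lor (pd q Y c) (pd j (pd l Y) c)) := by
  have hs := h.smooth c hc
  have hdet : ∀ᶠ b in nhds c, (g b).det ≠ 0 :=
    (contDiffAt_det (h.smooth_metric hc)).continuousAt.eventually_ne h0
  have e : (fun b => ∑ q, g b q l * christoffel g q i k b)
      =ᶠ[nhds c] fun b => lor (pd i (pd k Y) b) (pd l Y b) := by
    filter_upwards [hdet, h.isOpen.mem_nhds hc] with b hb hb'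
    exact h.sum_mul_christoffel hb' hb i k l
  have e2 := pd_congr j e
  rw [pd_lor (contDiffAt_pd (contDiffAt_pd hs k) i) (contDiffAt_pd hs l),
    pd_sum _ fun q _ => (h.smooth_metric hc q l).mul (h.smooth_christoffel hc h0 q i k)] at e2
  rw [← e2, ← Finset.sum_sub_distrib]
  refine Finset.sum_congr rfl fun q _ => ?_
  rw [pd_mul (h.smooth_metric hc q l) (h.smooth_christoffel hc h0 q i k), h.pd_metric hc]
  ring

/-- This is the Gauss equation in flat ℝ^{1,4}: the third derivatives of Y cancel by symmetry, and
the quadratic terms in Γ turn second derivatives into their normal parts. -/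
theorem riemann_eq (h : IsGram B Y g) {c : Coord d} (hc : c ∈ B) (h0 : (g c).det ≠ 0)
    (i j k l : Fin d) :
    riemann g i j k l c = lor (normalHess Y g i k c) (pd j (pd l Y) c)
      - lor (normalHess Y g j k c) (pd i (pd l Y) c) := by
  have hs := h.smooth c hc
  have quad : ∀ a b : Fin d, ∑ q, g c q l * ∑ p, christoffel g p a k c * christoffel g q b p c
      = ∑ p, christoffel g p a k c * lor (pd b (pd p Y) c) (pd l Y c) := by
    intro a b
    simp only [Finset.mul_sum]
    rw [Finset.sum_comm]
    refine Finset.sum_congr rfl fun p _ => ?_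
    rw [← h.sum_mul_christoffel hc h0, Finset.mul_sum]
    exact Finset.sum_congr rfl fun q _ => by ring
  have split : riemann g i j k l c =
      ∑ q, g c q l * pd j (christoffel g q i k) c - ∑ q, g c q l * pd i (christoffel g q j k) c
      + (∑ q, g c q l * ∑ p, christoffel g p i k c * christoffel g q j p c)
      - ∑ q, g c q l * ∑ p, christoffel g p j k c * christoffel g q i p c := by
    rw [riemann, ← Finset.sum_sub_distrib, ← Finset.sum_add_distrib, ← Finset.sum_sub_distrib]
    refine Finset.sum_congr rfl fun q _ => ?_
    rw [Finset.sum_sub_distrib]; ring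
  rw [split, quad, quad, h.sum_mul_pd_christoffel hc h0, h.sum_mul_pd_christoffel hc h0,
    pd_comm (contDiffAt_pd hs k) j i]
  simp only [normalHess, lor_sub_left, lor_sum_left, lor_smul_left, mul_add,
    Finset.sum_add_distrib]
  ring

/-- The curvature of the induced metric, if `Y` lies in the light cone and `Z` is the null vector
dual to `Y` and orthogonal to the submanifold. -/
theorem riemann_of_null (h : IsGram B Y g) (hnull : ∀ c ∈ B, lor (Y c) (Y c) = 0) {c : Coord d}
    (hc : c ∈ B) (h0 : (g c).det ≠ 0) {Z : Mink} (hZ : ∀ i, lor (pd i Y c) Z = 0)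
    (hspan : ∀ v, (∀ i, lor v (pd i Y c) = 0) → v = -(lor v Z) • Y c - lor v (Y c) • Z)
    (i j k l : Fin d) :
    riemann g i j k l c = lor (pd i (pd k Y) c) Z * g c j l + g c i k * lor (pd j (pd l Y) c) Z
      - lor (pd j (pd k Y) c) Z * g c i l - g c j k * lor (pd i (pd l Y) c) Z := by
  have hs := h.smooth c hc
  have tang : ∀ b ∈ B, ∀ i, lor (Y b) (pd i Y b) = 0 := by
    intro b hb i
    have e := pd_eq_zero h.isOpen hnull i hb
    rw [pd_lor (h.smooth b hb) (h.smooth b hb), lor_comm (pd i Y b)] at e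
    linarith
  have hess : ∀ i j, lor (pd i (pd j Y) c) (Y c) = -g c i j := by
    intro i j
    have e := pd_eq_zero h.isOpen (fun b hb => tang b hb j) i hc
    rw [pd_lor hs (contDiffAt_pd hs j), ← h.eq c hc, lor_comm (Y c)] at e
    linarith
  have nh : ∀ i j, normalHess Y g i j c
      = -(lor (pd i (pd j Y) c) Z) • Y c + g c i j • Z := by
    intro i j
    rw [hspan _ (h.normalHess_lor hc h0 i j)]
    have e1 : lor (normalHess Y g i j c) Z = lor (pd i (pd j Y) c) Z := by
      simp [normalHess, lor_sub_left, lor_sum_left, lor_smul_left, hZ]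
    have e2 : lor (normalHess Y g i j c) (Y c) = -g c i j := by
      simp [normalHess, lor_sub_left, lor_sum_left, lor_smul_left, hess,
        lor_comm (pd _ Y c) (Y c), tang c hc]
    rw [e1, e2, neg_smul (g c i j), sub_neg_eq_add]
  rw [h.riemann_eq hc h0, nh, nh]
  simp only [lor_add_left, lor_smul_left, lor_comm (Y c), hess, lor_comm Z]
  ring

end IsGram

end AssocSurface

end

noncomputable section

namespace AssocSurface

/-! ### Surfaces in isothermal coordinates -/

/-- `f` is a surface in `𝕊³` without umbilical points in an isothermal coordinate, and `ν` is its
unit normal. -/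
structure IsoPatch (U : Set (Coord 2)) (f ν : Coord 2 → E4) : Prop where
  isOpen : IsOpen U
  smooth : ∀ u ∈ U, ContDiffAt ℝ ∞ f u
  smooth_normal : ∀ u ∈ U, ContDiffAt ℝ ∞ ν u
  unit : ∀ u ∈ U, ‖f u‖ = 1
  unit_normal : ∀ u ∈ U, ‖ν u‖ = 1
  normal_point : ∀ u ∈ U, inner ℝ (ν u) (f u) = 0
  normal_tangent : ∀ u ∈ U, ∀ i, inner ℝ (ν u) (pd i f u) = 0
  orth : ∀ u ∈ U, inner ℝ (pd 0 f u) (pd 1 f u) = 0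
  conf : ∀ u ∈ U, inner ℝ (pd 0 f u) (pd 0 f u) = inner ℝ (pd 1 f u) (pd 1 f u)
  pos : ∀ u ∈ U, 0 < inner ℝ (pd 0 f u) (pd 0 f u)
  not_umbilic : ∀ u ∈ U, ¬(inner ℝ (pd 0 f u) (pd 1 ν u) = 0 ∧
    inner ℝ (pd 0 f u) (pd 0 ν u) = inner ℝ (pd 1 f u) (pd 1 ν u))

theorem pd_real_comp {d : ℕ} {φ : ℝ → ℝ} {a : Coord d → ℝ} {c : Coord d}
    (hφ : DifferentiableAt ℝ φ (a c)) (ha : ContDiffAt ℝ ∞ a c) (i : Fin d) :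
    pd i (fun b => φ (a b)) c = deriv φ (a c) * pd i a c := by
  have h := hφ.hasDerivAt.comp_hasFDerivAt c (differentiableAt_of_smooth ha).hasFDerivAt
  simp only [pd]
  rw [show (fun b => φ (a b)) = φ ∘ a from rfl, h.fderiv]
  rfl

theorem pd_prodMk {d : ℕ} {a : Coord d → ℝ} {F : Coord d → E4} {c : Coord d}
    (ha : ContDiffAt ℝ ∞ a c) (hF : ContDiffAt ℝ ∞ F c) (i : Fin d) :
    pd i (fun b => ((a b, F b) : Mink)) c = (pd i a c, pd i F c) := by
  simp only [pd]
  rw [(differentiableAt_of_smooth ha).fderiv_prodMk (differentiableAt_of_smooth hF)]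
  rfl

theorem pd_light {d : ℕ} {F : Coord d → E4} {c : Coord d}
    (hF : ContDiffAt ℝ ∞ F c) (i : Fin d) :
    pd i (fun b => ((1, F b) : Mink)) c = (0, pd i F c) := by
  rw [pd_prodMk contDiffAt_const hF, pd_const]

theorem contDiff_planeProj : ContDiff ℝ ∞ (fun w : Coord 3 => (!₂[w 0, w 1] : Coord 2)) := by
  rw [contDiff_euclidean]
  intro i
  fin_cases i <;> simp <;> fun_prop

theorem contDiff_onSurface : ContDiff ℝ ∞ onSurface := by
  unfold onSurface
  rw [contDiff_euclidean]
  intro i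
  fin_cases i <;> simp <;> fun_prop

theorem planeProj_onSurface (u : Coord 2) : (!₂[onSurface u 0, onSurface u 1] : Coord 2) = u := by
  ext i; fin_cases i <;> simp [onSurface]

theorem onSurface_last (u : Coord 2) : onSurface u 2 = 0 := by simp [onSurface]

theorem pd_onSurface {V : Type*} [NormedAddCommGroup V] [NormedSpace ℝ V] {F : Coord 3 → V}
    {u : Coord 2} (hF : ContDiffAt ℝ ∞ F (onSurface u)) (i : Fin 2) :
    pd i (fun b => F (onSurface b)) u = pd i.castSucc F (onSurface u) := by
  rw [pd_comp hF contDiff_onSurface.contDiffAt, Fin.sum_univ_three]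
  have h0 : ∀ b : Coord 2, onSurface b 0 = b 0 := fun b => by simp [onSurface]
  have h1 : ∀ b : Coord 2, onSurface b 1 = b 1 := fun b => by simp [onSurface]
  simp only [h0, h1, onSurface_last, pd_coord, pd_const]
  fin_cases i <;> simp

/-- The part of `Coord 3` over `U`. -/
def slab (U : Set (Coord 2)) : Set (Coord 3) := {w | (!₂[w 0, w 1] : Coord 2) ∈ U}

theorem onSurface_mem_slab {U : Set (Coord 2)} {u : Coord 2} (hu : u ∈ U) :
    onSurface u ∈ slab U := by
  simpa only [slab, Set.mem_ofPred_eq, planeProj_onSurface] using hu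

/-- The lift of `normalParam` to the light cone that induces the metric `λ² g₀`. -/
def coneLift (f ν : Coord 2 → E4) (lam : E4 → ℝ) (w : Coord 3) : Mink :=
  lam (normalParam f ν w) • (1, normalParam f ν w)

/-- The unit normal of the lifted surface in the lifted sphere. -/
def liftNormal (f ν : Coord 2 → E4) (lam : E4 → ℝ) (u : Coord 2) : Mink :=
  (lam (f u))⁻¹ • pd 2 (coneLift f ν lam) (onSurface u)

theorem normalParam_onSurface (f ν : Coord 2 → E4) (u : Coord 2) :
    normalParam f ν (onSurface u) = f u := by
  simp only [normalParam, planeProj_onSurface, onSurface_last]; simp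

theorem coneLift_onSurface (f ν : Coord 2 → E4) (lam : E4 → ℝ) (u : Coord 2) :
    coneLift f ν lam (onSurface u) = yLam f lam u := by
  simp only [coneLift, normalParam_onSurface, yLam]

theorem lor_light {v : E4} (hv : ‖v‖ = 1) : lor (1, v) (1, v) = 0 := by
  simp [lor, hv]

namespace IsoPatch

variable {U : Set (Coord 2)} {f ν : Coord 2 → E4} {lam : E4 → ℝ}

theorem isOpen_slab (h : IsoPatch U f ν) : IsOpen (slab U) :=
  h.isOpen.preimage contDiff_planeProj.continuous

theorem smooth_normalParam (h : IsoPatch U f ν) {w : Coord 3} (hw : w ∈ slab U) :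
    ContDiffAt ℝ ∞ (normalParam f ν) w := by
  have hc : ContDiffAt ℝ ∞ (fun w : Coord 3 => w 2) w := contDiffAt_coord 2 w
  exact (hc.cos.smul ((h.smooth _ hw).comp w contDiff_planeProj.contDiffAt)).add
    (hc.sin.smul ((h.smooth_normal _ hw).comp w contDiff_planeProj.contDiffAt))

theorem norm_normalParam (h : IsoPatch U f ν) {w : Coord 3} (hw : w ∈ slab U) :
    ‖normalParam f ν w‖ = 1 := by
  have e : ‖normalParam f ν w‖ ^ 2 = 1 := by
    rw [normalParam, norm_add_sq_real, norm_smul, norm_smul, h.unit _ hw, h.unit_normal _ hw,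
      real_inner_smul_left, real_inner_smul_right, real_inner_comm, h.normal_point _ hw, mul_one,
      mul_one, Real.norm_eq_abs, Real.norm_eq_abs, sq_abs, sq_abs]
    nlinarith [Real.sin_sq_add_cos_sq (w 2)]
  nlinarith [norm_nonneg (normalParam f ν w)]

theorem smooth_lam (h : IsoPatch U f ν) (hl : IsConformalFactor lam) {u : Coord 2} (hu : u ∈ U) :
    ContDiffAt ℝ ∞ (fun b => lam (f b)) u :=
  (hl _ (h.unit u hu)).1.comp u (h.smooth u hu)

theorem lam_pos (h : IsoPatch U f ν) (hl : IsConformalFactor lam) {u : Coord 2} (hu : u ∈ U) :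
    0 < lam (f u) := (hl _ (h.unit u hu)).2

theorem smooth_coneLift (h : IsoPatch U f ν) (hl : IsConformalFactor lam) {w : Coord 3}
    (hw : w ∈ slab U) : ContDiffAt ℝ ∞ (coneLift f ν lam) w :=
  ((hl _ (h.norm_normalParam hw)).1.comp w (h.smooth_normalParam hw)).smul
    (contDiffAt_const.prodMk (h.smooth_normalParam hw))

theorem smooth_yLam (h : IsoPatch U f ν) (hl : IsConformalFactor lam) {u : Coord 2}
    (hu : u ∈ U) : ContDiffAt ℝ ∞ (yLam f lam) u :=
  (h.smooth_lam hl hu).smul (contDiffAt_const.prodMk (h.smooth u hu))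

theorem pd_coneLift (h : IsoPatch U f ν) (hl : IsConformalFactor lam) {w : Coord 3}
    (hw : w ∈ slab U) (i : Fin 3) :
    pd i (coneLift f ν lam) w = lam (normalParam f ν w) • (0, pd i (normalParam f ν) w)
      + pd i (fun b => lam (normalParam f ν b)) w • (1, normalParam f ν w) := by
  have hs := h.smooth_normalParam hw
  have := pd_smul (a := fun b => lam (normalParam f ν b))
    (F := fun b => ((1, normalParam f ν b) : Mink))
    ((hl _ (h.norm_normalParam hw)).1.comp w hs) (contDiffAt_const.prodMk hs) i
  rw [pd_light hs] at this
  exact this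

theorem inner_pd_normalParam (h : IsoPatch U f ν) {w : Coord 3} (hw : w ∈ slab U) (i : Fin 3) :
    lor (1, normalParam f ν w) (0, pd i (normalParam f ν) w) = 0 := by
  have hs : ContDiffAt ℝ ∞ (fun b => ((1, normalParam f ν b) : Mink)) w :=
    contDiffAt_const.prodMk (h.smooth_normalParam hw)
  have e := pd_eq_zero h.isOpen_slab (fun b hb => lor_light (h.norm_normalParam hb)) i hw
  rw [pd_lor hs hs, pd_light (h.smooth_normalParam hw),
    lor_comm (0, pd i (normalParam f ν) w)] at e
  linarith

/-- The vector (1, p) is null and orthogonal to (0, dp) because |p| = 1. The terms with dλ therefore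
drop out, and the induced metric is λ²|dp|². -/
theorem isGram (h : IsoPatch U f ν) (hl : IsConformalFactor lam) :
    IsGram (slab U) (coneLift f ν lam) (ambientMetric f ν lam) where
  isOpen := h.isOpen_slab
  smooth := fun _ hw => h.smooth_coneLift hl hw
  eq := fun w hw i j => by
    have e : lor (0, pd i (normalParam f ν) w) (0, pd j (normalParam f ν) w)
        = inner ℝ (pd i (normalParam f ν) w) (pd j (normalParam f ν) w) := by simp [lor]
    rw [h.pd_coneLift hl hw, h.pd_coneLift hl hw]
    simp only [lor_add_left, lor_add_right, lor_smul_left, lor_smul_right,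
      lor_comm _ (1, normalParam f ν w), h.inner_pd_normalParam hw,
      lor_light (h.norm_normalParam hw), e, ambientMetric, Matrix.of_apply]
    ring

theorem coneLift_null (h : IsoPatch U f ν) {w : Coord 3} (hw : w ∈ slab U) :
    lor (coneLift f ν lam w) (coneLift f ν lam w) = 0 := by
  simp only [coneLift, lor_smul_left, lor_smul_right, lor_light (h.norm_normalParam hw)]
  simp

theorem pd_coneLift_onSurface (h : IsoPatch U f ν) (hl : IsConformalFactor lam) {u : Coord 2}
    (hu : u ∈ U) (i : Fin 2) :
    pd i.castSucc (coneLift f ν lam) (onSurface u) = pd i (yLam f lam) u := by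
  rw [← pd_onSurface (h.smooth_coneLift hl (onSurface_mem_slab hu))]
  simp only [coneLift_onSurface]

theorem pd_pd_coneLift_onSurface (h : IsoPatch U f ν) (hl : IsConformalFactor lam) {u : Coord 2}
    (hu : u ∈ U) (i j : Fin 2) :
    pd i.castSucc (pd j.castSucc (coneLift f ν lam)) (onSurface u) = pd i (pd j (yLam f lam)) u := by
  rw [← pd_onSurface (contDiffAt_pd (h.smooth_coneLift hl (onSurface_mem_slab hu)) _)]
  exact pd_congr_of_isOpen h.isOpen (fun b hb => h.pd_coneLift_onSurface hl hb j) i hu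

theorem pd_last_normalParam (h : IsoPatch U f ν) {u : Coord 2} (hu : u ∈ U) :
    pd 2 (normalParam f ν) (onSurface u) = ν u := by
  have hc : ContDiffAt ℝ ∞ (fun w : Coord 3 => w 2) (onSurface u) := contDiffAt_coord 2 _
  have hw := onSurface_mem_slab hu
  have hf := h.smooth _ hw
  have hn := h.smooth_normal _ hw
  have hf' : ContDiffAt ℝ ∞ (fun w : Coord 3 => f !₂[w 0, w 1]) (onSurface u) :=
    hf.comp (onSurface u) contDiff_planeProj.contDiffAt
  have hn' : ContDiffAt ℝ ∞ (fun w : Coord 3 => ν !₂[w 0, w 1]) (onSurface u) :=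
    hn.comp (onSurface u) contDiff_planeProj.contDiffAt
  have e1 : pd 2 (fun w : Coord 3 => f !₂[w 0, w 1]) (onSurface u) = 0 := by
    rw [pd_comp hf contDiff_planeProj.contDiffAt]
    simp [pd_coord]
  have e2 : pd 2 (fun w : Coord 3 => ν !₂[w 0, w 1]) (onSurface u) = 0 := by
    rw [pd_comp hn contDiff_planeProj.contDiffAt]
    simp [pd_coord]
  have hcf : ContDiffAt ℝ ∞ (fun w : Coord 3 => Real.cos (w 2) • f !₂[w 0, w 1]) (onSurface u) :=
    hc.cos.smul hf'
  have hsn : ContDiffAt ℝ ∞ (fun w : Coord 3 => Real.sin (w 2) • ν !₂[w 0, w 1]) (onSurface u) :=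
    hc.sin.smul hn'
  unfold normalParam
  rw [pd_add hcf hsn, pd_smul hc.cos hf', pd_smul hc.sin hn', e1, e2,
    pd_real_comp Real.differentiableAt_cos hc, pd_real_comp Real.differentiableAt_sin hc, pd_coord,
    planeProj_onSurface, onSurface_last]
  simp

/-- Modulo (1, f) the lifted normal does not depend on λ. This is why one Gauss map serves all
conformal factors. -/
theorem liftNormal_eq (h : IsoPatch U f ν) (hl : IsConformalFactor lam) {u : Coord 2}
    (hu : u ∈ U) : liftNormal f ν lam u = (0, ν u)
      + ((lam (f u))⁻¹ * pd 2 (fun b => lam (normalParam f ν b)) (onSurface u)) • (1, f u) := by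
  have hw := onSurface_mem_slab hu
  have hp := (h.lam_pos hl hu).ne'
  rw [liftNormal, h.pd_coneLift hl hw, h.pd_last_normalParam hu, normalParam_onSurface, smul_add,
    smul_smul, smul_smul, inv_mul_cancel₀ hp, one_smul]

end IsoPatch

end AssocSurface

end

/-! ### The second fundamental form and the conformal Gauss map as Lorentz products -/

noncomputable section

namespace AssocSurface

theorem lor_spatial (v w : E4) : lor (0, v) (0, w) = inner ℝ v w := by simp [lor]

theorem lor_light_spatial (v w : E4) : lor (1, v) (0, w) = inner ℝ v w := by simp [lor]

theorem lor_spatial_light (v w : E4) : lor (0, v) (1, w) = inner ℝ v w := by simp [lor]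

theorem isConformalFactor_one : IsConformalFactor (fun _ => 1) :=
  fun _ _ => ⟨contDiffAt_const, one_pos⟩

/-- In `⟨v, v⟩ = const` the derivative of `v` is orthogonal to `v`. -/
theorem lor_pd_of_const {d : ℕ} {U : Set (Coord d)} (hU : IsOpen U) {F G : Coord d → Mink} {r : ℝ}
    (hF : ∀ u ∈ U, ContDiffAt ℝ ∞ F u) (hG : ∀ u ∈ U, ContDiffAt ℝ ∞ G u)
    (h : ∀ u ∈ U, lor (F u) (G u) = r) {u : Coord d} (hu : u ∈ U) (i : Fin d) :
    lor (pd i F u) (G u) = -lor (F u) (pd i G u) := by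
  have e := pd_eq_zero hU h i hu
  rw [pd_lor (hF u hu) (hG u hu)] at e
  linarith

namespace IsoPatch

variable {U : Set (Coord 2)} {f ν : Coord 2 → E4} {lam : E4 → ℝ} {u : Coord 2}

theorem smooth_light (h : IsoPatch U f ν) (hu : u ∈ U) :
    ContDiffAt ℝ ∞ (fun b => ((1, f b) : Mink)) u :=
  contDiffAt_const.prodMk (h.smooth u hu)

theorem inner_self_normal (h : IsoPatch U f ν) (hu : u ∈ U) : inner ℝ (ν u) (ν u) = 1 := by
  rw [real_inner_self_eq_norm_sq, h.unit_normal u hu]; norm_num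

theorem inner_pd_self (h : IsoPatch U f ν) (hu : u ∈ U) (i : Fin 2) :
    inner ℝ (f u) (pd i f u) = 0 := by
  have e := lor_pd_of_const h.isOpen (fun _ hb => h.smooth_light hb)
    (fun _ hb => h.smooth_light hb) (fun b hb => lor_light (h.unit b hb)) hu i
  rw [pd_light (h.smooth u hu), lor_spatial_light, lor_light_spatial, real_inner_comm] at e
  linarith

theorem pd_yLam (h : IsoPatch U f ν) (hl : IsConformalFactor lam) (hu : u ∈ U) (i : Fin 2) :
    pd i (yLam f lam) u = lam (f u) • (0, pd i f u) + pd i (fun b => lam (f b)) u • (1, f u) := by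
  have e := pd_smul (h.smooth_lam hl hu) (h.smooth_light hu) i
  rw [pd_light (h.smooth u hu)] at e
  exact e

theorem lor_pd_yLam (h : IsoPatch U f ν) (hl : IsConformalFactor lam) (hu : u ∈ U)
    (i j : Fin 2) : lor (pd i (yLam f lam) u) (pd j (yLam f lam) u)
      = lam (f u) ^ 2 * inner ℝ (pd i f u) (pd j f u) := by
  rw [h.pd_yLam hl hu, h.pd_yLam hl hu]
  simp only [lor_add_left, lor_add_right, lor_smul_left, lor_smul_right, lor_spatial,
    lor_light_spatial, lor_spatial_light, h.inner_pd_self hu, lor_light (h.unit u hu),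
    real_inner_comm (f u)]
  ring

theorem lor_pd_yLam_self (h : IsoPatch U f ν) (hl : IsConformalFactor lam) (hu : u ∈ U)
    (i : Fin 2) : lor (pd i (yLam f lam) u) (pd i (yLam f lam) u) = confE f lam u := by
  rw [h.lor_pd_yLam hl hu, confE]
  fin_cases i
  · rfl
  · exact congrArg _ (h.conf u hu).symm

theorem lor_pd_yLam_orth (h : IsoPatch U f ν) (hl : IsConformalFactor lam) (hu : u ∈ U) :
    lor (pd 0 (yLam f lam) u) (pd 1 (yLam f lam) u) = 0 := by
  rw [h.lor_pd_yLam hl hu, h.orth u hu, mul_zero]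

theorem confE_pos (h : IsoPatch U f ν) (hl : IsConformalFactor lam) (hu : u ∈ U) :
    0 < confE f lam u :=
  mul_pos (pow_pos (h.lam_pos hl hu) 2) (h.pos u hu)

theorem smooth_confE (h : IsoPatch U f ν) (hl : IsConformalFactor lam) (hu : u ∈ U) :
    ContDiffAt ℝ ∞ (confE f lam) u := by
  have hf := contDiffAt_pd (h.smooth u hu) 0
  exact ((h.smooth_lam hl hu).pow 2).mul (hf.inner ℝ hf)

theorem yLam_null (h : IsoPatch U f ν) (hu : u ∈ U) : lor (yLam f lam u) (yLam f lam u) = 0 := by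
  simp only [yLam, lor_smul_left, lor_smul_right, lor_light (h.unit u hu), mul_zero]

theorem yLam_pd (h : IsoPatch U f ν) (hl : IsConformalFactor lam) (hu : u ∈ U) (i : Fin 2) :
    lor (yLam f lam u) (pd i (yLam f lam) u) = 0 := by
  have e := lor_pd_of_const h.isOpen (fun _ hb => h.smooth_yLam hl hb)
    (fun _ hb => h.smooth_yLam hl hb) (fun b hb => h.yLam_null (lam := lam) hb) hu i
  rw [lor_comm] at e
  linarith

theorem yLam_fst_ne (h : IsoPatch U f ν) (hl : IsConformalFactor lam) (hu : u ∈ U) :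
    (yLam f lam u).1 ≠ 0 := by
  simpa [yLam] using (h.lam_pos hl hu).ne'

theorem isNullFrame_liftNormal (h : IsoPatch U f ν) (hl : IsConformalFactor lam) (hu : u ∈ U) :
    IsNullFrame (yLam f lam u) (pd 0 (yLam f lam) u) (pd 1 (yLam f lam) u)
      (liftNormal f ν lam u) (confE f lam u) := by
  have key : ∀ i, lor (pd i (yLam f lam) u) (liftNormal f ν lam u) = 0 := by
    intro i
    rw [h.liftNormal_eq hl hu, h.pd_yLam hl hu]
    simp only [lor_add_left, lor_add_right, lor_smul_left, lor_smul_right, lor_spatial,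
      lor_light_spatial, lor_spatial_light, h.inner_pd_self hu, lor_light (h.unit u hu),
      real_inner_comm (ν u), h.normal_tangent u hu, h.normal_point u hu,
      real_inner_comm (f u) (pd i f u)]
    ring
  refine ⟨h.yLam_null hu, h.yLam_pd hl hu 0, h.yLam_pd hl hu 1, ?_, h.lor_pd_yLam_self hl hu 0,
    h.lor_pd_yLam_self hl hu 1, h.lor_pd_yLam_orth hl hu, key 0, key 1, ?_, h.confE_pos hl hu,
    h.yLam_fst_ne hl hu⟩
  · rw [h.liftNormal_eq hl hu, yLam]
    simp only [lor_add_right, lor_smul_left, lor_smul_right, lor_light (h.unit u hu),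
      lor_light_spatial, real_inner_comm (ν u), h.normal_point u hu]
    ring
  · rw [h.liftNormal_eq hl hu]
    simp only [lor_add_right, lor_add_left, lor_smul_left, lor_smul_right,
      lor_light (h.unit u hu), lor_spatial, lor_light_spatial, lor_spatial_light,
      real_inner_comm (ν u), h.normal_point u hu, h.inner_self_normal hu]
    ring

theorem pd_last_coneLift (h : IsoPatch U f ν) (hl : IsConformalFactor lam) (hu : u ∈ U) :
    pd 2 (coneLift f ν lam) (onSurface u) = lam (f u) • liftNormal f ν lam u := by
  rw [liftNormal, smul_smul, mul_inv_cancel₀ (h.lam_pos hl hu).ne', one_smul]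

theorem smooth_liftNormal (h : IsoPatch U f ν) (hl : IsConformalFactor lam) (hu : u ∈ U) :
    ContDiffAt ℝ ∞ (liftNormal f ν lam) u := by
  refine ((h.smooth_lam hl hu).inv (h.lam_pos hl hu).ne').smul ?_
  exact (contDiffAt_pd (h.smooth_coneLift hl (onSurface_mem_slab hu)) 2).comp u
    contDiff_onSurface.contDiffAt

theorem ambientMetric_onSurface (h : IsoPatch U f ν) (hl : IsConformalFactor lam) (hu : u ∈ U) :
    ambientMetric f ν lam (onSurface u)
      = Matrix.diagonal ![confE f lam u, confE f lam u, lam (f u) ^ 2] := by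
  have N := h.isNullFrame_liftNormal hl hu
  have e0 : pd 0 (coneLift f ν lam) (onSurface u) = pd 0 (yLam f lam) u :=
    h.pd_coneLift_onSurface hl hu 0
  have e1 : pd 1 (coneLift f ν lam) (onSurface u) = pd 1 (yLam f lam) u :=
    h.pd_coneLift_onSurface hl hu 1
  ext i j
  rw [(h.isGram hl).eq _ (onSurface_mem_slab hu)]
  fin_cases i <;> fin_cases j <;>
    simp [e0, e1, h.pd_last_coneLift hl hu, lor_smul_left, lor_smul_right, N.aa, N.ab, N.bb, N.an,
      N.bn, N.nn, lor_comm (pd 1 (yLam f lam) u) (pd 0 (yLam f lam) u),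
      lor_comm (liftNormal f ν lam u), sq]

theorem ambientMetric_det (h : IsoPatch U f ν) (hl : IsConformalFactor lam) (hu : u ∈ U) :
    (ambientMetric f ν lam (onSurface u)).det ≠ 0 := by
  rw [h.ambientMetric_onSurface hl hu, Matrix.det_diagonal]
  simp [Fin.prod_univ_three, (h.confE_pos hl hu).ne', (h.lam_pos hl hu).ne']

theorem ambientMetric_inv (h : IsoPatch U f ν) (hl : IsConformalFactor lam) (hu : u ∈ U) :
    (ambientMetric f ν lam (onSurface u))⁻¹
      = Matrix.diagonal ![(confE f lam u)⁻¹, (confE f lam u)⁻¹, (lam (f u) ^ 2)⁻¹] := by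
  refine Matrix.inv_eq_right_inv ?_
  rw [h.ambientMetric_onSurface hl hu, Matrix.diagonal_mul_diagonal, ← Matrix.diagonal_one]
  congr 1
  ext i
  fin_cases i <;> simp [(h.confE_pos hl hu).ne', (h.lam_pos hl hu).ne']

/-- Along the surface the ambient metric is diagonal with last entry λ², so the normal Christoffel
symbol involves only ∂_s Y = λN. The powers of λ from the definition, the inverse metric and ∂_s Y
cancel. -/
theorem secondFF_eq (h : IsoPatch U f ν) (hl : IsConformalFactor lam) (hu : u ∈ U)
    (i j : Fin 2) : secondFF f ν lam i j u
      = lor (pd i (pd j (yLam f lam)) u) (liftNormal f ν lam u) := by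
  rw [secondFF, (h.isGram hl).christoffel_eq (onSurface_mem_slab hu), h.ambientMetric_inv hl hu,
    Fin.sum_univ_three, h.pd_pd_coneLift_onSurface hl hu, h.pd_last_coneLift hl hu]
  have := (h.lam_pos hl hu).ne'
  simp [lor_smul_right]
  field_simp

theorem meanCurv_eq (h : IsoPatch U f ν) (hl : IsConformalFactor lam) (hu : u ∈ U) :
    meanCurv f ν lam u = (1 / (2 * confE f lam u)) *
      (lor (pd 0 (pd 0 (yLam f lam)) u) (liftNormal f ν lam u)
        + lor (pd 1 (pd 1 (yLam f lam)) u) (liftNormal f ν lam u)) := by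
  rw [meanCurv, h.secondFF_eq hl hu, h.secondFF_eq hl hu]

theorem smooth_meanCurv (h : IsoPatch U f ν) (hl : IsConformalFactor lam) (hu : u ∈ U) :
    ContDiffAt ℝ ∞ (meanCurv f ν lam) u := by
  have hy := h.smooth_yLam hl hu
  have hN := h.smooth_liftNormal hl hu
  have hE := h.smooth_confE hl hu
  have hE0 := (h.confE_pos hl hu).ne'
  refine ContDiffAt.congr_of_eventuallyEq ?_
    (Filter.eventuallyEq_of_mem (h.isOpen.mem_nhds hu) fun b hb => h.meanCurv_eq hl hb)
  exact (contDiffAt_const.div (contDiffAt_const.mul hE) (by positivity)).mul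
    ((contDiffAt_lor (contDiffAt_pd (contDiffAt_pd hy 0) 0) hN).add
      (contDiffAt_lor (contDiffAt_pd (contDiffAt_pd hy 1) 1) hN))

theorem liftNormal_one (h : IsoPatch U f ν) (hu : u ∈ U) :
    liftNormal f ν (fun _ => 1) u = (0, ν u) := by
  rw [h.liftNormal_eq isConformalFactor_one hu, pd_const]
  simp

theorem smooth_gaussMap (h : IsoPatch U f ν) (hu : u ∈ U) : ContDiffAt ℝ ∞ (gaussMap f ν) u :=
  ((h.smooth_meanCurv isConformalFactor_one hu).smul (h.smooth_light hu)).add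
    (contDiffAt_const.prodMk (h.smooth_normal u hu))

theorem gaussMap_yLam (h : IsoPatch U f ν) (hu : u ∈ U) :
    lor (gaussMap f ν u) (yLam f lam u) = 0 := by
  simp only [gaussMap, yLam, lor_add_left, lor_smul_left, lor_smul_right, lor_light (h.unit u hu),
    lor_spatial_light, h.normal_point u hu]
  ring

theorem gaussMap_pd_yLam (h : IsoPatch U f ν) (hl : IsConformalFactor lam) (hu : u ∈ U)
    (i : Fin 2) : lor (gaussMap f ν u) (pd i (yLam f lam) u) = 0 := by
  rw [h.pd_yLam hl hu]
  simp only [gaussMap, lor_add_left, lor_add_right, lor_smul_left, lor_smul_right,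
    lor_light (h.unit u hu), lor_spatial_light, lor_spatial, lor_light_spatial,
    h.normal_point u hu, h.normal_tangent u hu, h.inner_pd_self hu]
  ring

theorem gaussMap_self (h : IsoPatch U f ν) (hu : u ∈ U) :
    lor (gaussMap f ν u) (gaussMap f ν u) = 1 := by
  simp only [gaussMap, lor_add_left, lor_add_right, lor_smul_left, lor_smul_right,
    lor_light (h.unit u hu), lor_spatial_light, lor_spatial, lor_light_spatial,
    h.normal_point u hu, h.inner_self_normal hu, real_inner_comm (ν u)]
  ring

theorem pd_gaussMap_yLam (h : IsoPatch U f ν) (hl : IsConformalFactor lam) (hu : u ∈ U)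
    (i : Fin 2) : lor (pd i (gaussMap f ν) u) (yLam f lam u) = 0 := by
  rw [lor_pd_of_const h.isOpen (fun _ hb => h.smooth_gaussMap hb)
    (fun _ hb => h.smooth_yLam hl hb) (fun b hb => h.gaussMap_yLam hb) hu,
    h.gaussMap_pd_yLam hl hu, neg_zero]

theorem pd_gaussMap_self (h : IsoPatch U f ν) (hu : u ∈ U)
    (i : Fin 2) : lor (pd i (gaussMap f ν) u) (gaussMap f ν u) = 0 := by
  have e := lor_pd_of_const h.isOpen (fun _ hb => h.smooth_gaussMap hb)
    (fun _ hb => h.smooth_gaussMap hb) (fun b hb => h.gaussMap_self hb) hu i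
  rw [lor_comm (gaussMap f ν u)] at e
  linarith

/-- The derivative is moved off ξ using ⟨ξ, y_j⟩ = 0; in this form Ω is visibly symmetric. -/
theorem OmegaT_eq (h : IsoPatch U f ν) (hl : IsConformalFactor lam) (hu : u ∈ U) (i j : Fin 2) :
    OmegaT f ν lam i j u = lor (pd i (pd j (yLam f lam)) u) (gaussMap f ν u) := by
  rw [OmegaT, lor_pd_of_const h.isOpen (fun _ hb => h.smooth_gaussMap hb)
    (fun _ hb => contDiffAt_pd (h.smooth_yLam hl hb) j)
    (fun b hb => h.gaussMap_pd_yLam hl hb j) hu, neg_neg, lor_comm]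

theorem OmegaT_symm (h : IsoPatch U f ν) (hl : IsConformalFactor lam) (hu : u ∈ U) (i j : Fin 2) :
    OmegaT f ν lam i j u = OmegaT f ν lam j i u := by
  rw [h.OmegaT_eq hl hu, h.OmegaT_eq hl hu, pd_comm (h.smooth_yLam hl hu)]

theorem pd_pd_yLam_yLam (h : IsoPatch U f ν) (hl : IsConformalFactor lam) (hu : u ∈ U)
    (i j : Fin 2) : lor (pd i (pd j (yLam f lam)) u) (yLam f lam u)
      = -lor (pd j (yLam f lam) u) (pd i (yLam f lam) u) :=
  lor_pd_of_const h.isOpen (fun _ hb => contDiffAt_pd (h.smooth_yLam hl hb) j)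
    (fun _ hb => h.smooth_yLam hl hb)
    (fun b hb => by rw [lor_comm, h.yLam_pd hl hb j]) hu i

/-- `Ω_λ = λ Ω_1`. -/
theorem OmegaT_lam (h : IsoPatch U f ν) (hl : IsConformalFactor lam) (hu : u ∈ U) (i j : Fin 2) :
    OmegaT f ν lam i j u = lam (f u) * OmegaT f ν (fun _ => 1) i j u := by
  have e := h.pd_gaussMap_yLam isConformalFactor_one hu i
  simp only [yLam, one_smul] at e
  simp only [OmegaT]
  rw [h.pd_yLam hl hu, h.pd_yLam isConformalFactor_one hu, pd_const]
  simp only [lor_add_right, lor_smul_right, e]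
  ring

/-- For λ = 1, the trace of ⟨y_ij, N⟩ is 2EH and that of ⟨y_ij, y⟩ is −2E, so H is exactly the
coefficient in ξ = N + Hy that makes the trace vanish. The general case follows from Ω_λ = λΩ_1. -/
theorem OmegaT_trace (h : IsoPatch U f ν) (hl : IsConformalFactor lam) (hu : u ∈ U) :
    OmegaT f ν lam 0 0 u + OmegaT f ν lam 1 1 u = 0 := by
  have h1 := isConformalFactor_one
  have hE := (h.confE_pos h1 hu).ne'
  have e : gaussMap f ν u = meanCurv f ν (fun _ => 1) u • yLam f (fun _ => 1) u
      + liftNormal f ν (fun _ => 1) u := by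
    rw [h.liftNormal_one hu, yLam, one_smul, gaussMap]
  rw [h.OmegaT_lam hl hu, h.OmegaT_lam hl hu, ← mul_add, h.OmegaT_eq h1 hu, h.OmegaT_eq h1 hu, e]
  simp only [lor_add_right, lor_smul_right, h.pd_pd_yLam_yLam h1 hu, h.lor_pd_yLam_self h1 hu,
    h.meanCurv_eq h1 hu]
  field_simp
  ring

/-- The conformal Gauss map is the mean curvature sphere for every conformal factor. -/
theorem gaussMap_eq (h : IsoPatch U f ν) (hl : IsConformalFactor lam) (hu : u ∈ U) :
    gaussMap f ν u = liftNormal f ν lam u + meanCurv f ν lam u • yLam f lam u := by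
  have hp := (h.lam_pos hl hu).ne'
  have hE := (h.confE_pos hl hu).ne'
  -- Both N_λ and ξ are (0, ν) plus a multiple of (1, f), so they differ by some c y_λ.
  obtain ⟨c, hc⟩ : ∃ c : ℝ, liftNormal f ν lam u = gaussMap f ν u - c • yLam f lam u := by
    rw [h.liftNormal_eq hl hu]
    generalize (lam (f u))⁻¹ * pd 2 (fun b => lam (normalParam f ν b)) (onSurface u) = a
    refine ⟨(meanCurv f ν (fun _ => 1) u - a) * (lam (f u))⁻¹, ?_⟩
    rw [yLam, gaussMap, smul_smul, mul_assoc, inv_mul_cancel₀ hp, mul_one, sub_smul]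
    abel
  -- The trace of Ω_λ vanishes, and the trace of ⟨y_ij, y⟩ is −2E; this forces c = H_λ.
  have e : meanCurv f ν lam u = c := by
    have t := h.OmegaT_trace hl hu
    rw [h.OmegaT_eq hl hu, h.OmegaT_eq hl hu] at t
    rw [h.meanCurv_eq hl hu, hc]
    simp only [lor_sub_right, lor_smul_right, h.pd_pd_yLam_yLam hl hu, h.lor_pd_yLam_self hl hu]
    field_simp
    linear_combination t
  rw [e, hc, sub_add_cancel]

theorem tracelessFF_eq (h : IsoPatch U f ν) (hl : IsConformalFactor lam) (hu : u ∈ U)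
    (i j : Fin 2) : tracelessFF f ν lam i j u = OmegaT f ν lam i j u := by
  rw [tracelessFF, h.secondFF_eq hl hu, h.OmegaT_eq hl hu, h.gaussMap_eq hl hu, lor_add_right,
    lor_smul_right, h.pd_pd_yLam_yLam hl hu]
  fin_cases i <;> fin_cases j <;>
    simp [h.lor_pd_yLam_self hl hu, h.lor_pd_yLam_orth hl hu,
      lor_comm (pd 1 (yLam f lam) u) (pd 0 (yLam f lam) u), sub_eq_add_neg]

end IsoPatch

end AssocSurface

end

/-! ### The dual vector y*, the curvature along the surface, and 𝓗 as a trace of Ω* -/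

noncomputable section

namespace AssocSurface

/-- The null vector dual to `y_λ` and orthogonal to the lifted surface and its unit normal. -/
def liftDual (f ν : Coord 2 → E4) (lam : E4 → ℝ) (u : Coord 2) : Mink :=
  dualNull (yLam f lam u) (pd 0 (yLam f lam) u) (pd 1 (yLam f lam) u) (liftNormal f ν lam u)
    (confE f lam u)

theorem forall_fin_two' {p : Fin 2 → Prop} (h0 : p 0) (h1 : p 1) (i : Fin 2) : p i := by
  fin_cases i
  · exact h0
  · exact h1

namespace IsoPatch

variable {U : Set (Coord 2)} {f ν : Coord 2 → E4} {lam : E4 → ℝ} {u : Coord 2}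

theorem smooth_liftDual (h : IsoPatch U f ν) (hl : IsConformalFactor lam) (hu : u ∈ U) :
    ContDiffAt ℝ ∞ (liftDual f ν lam) u :=
  contDiffAt_dualNull (h.smooth_yLam hl hu) (contDiffAt_pd (h.smooth_yLam hl hu) 0)
    (contDiffAt_pd (h.smooth_yLam hl hu) 1) (h.smooth_liftNormal hl hu) (h.smooth_confE hl hu)
    (h.yLam_fst_ne hl hu) (h.confE_pos hl hu).ne'

theorem liftDual_yLam (h : IsoPatch U f ν) (hl : IsConformalFactor lam) (hu : u ∈ U) :
    lor (liftDual f ν lam u) (yLam f lam u) = -1 :=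
  (h.isNullFrame_liftNormal hl hu).dualNull_spec.1

theorem liftDual_pd (h : IsoPatch U f ν) (hl : IsConformalFactor lam) (hu : u ∈ U) (i : Fin 2) :
    lor (liftDual f ν lam u) (pd i (yLam f lam) u) = 0 :=
  forall_fin_two' (p := fun i => lor (liftDual f ν lam u) (pd i (yLam f lam) u) = 0)
    (h.isNullFrame_liftNormal hl hu).dualNull_spec.2.2.1
    (h.isNullFrame_liftNormal hl hu).dualNull_spec.2.2.2.1 i

theorem liftDual_liftNormal (h : IsoPatch U f ν) (hl : IsConformalFactor lam) (hu : u ∈ U) :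
    lor (liftDual f ν lam u) (liftNormal f ν lam u) = 0 :=
  (h.isNullFrame_liftNormal hl hu).dualNull_spec.2.2.2.2

theorem expand_liftDual (h : IsoPatch U f ν) (hl : IsConformalFactor lam) (hu : u ∈ U)
    (v : Mink) : v = -(lor v (liftDual f ν lam u)) • yLam f lam u
      - lor v (yLam f lam u) • liftDual f ν lam u
      + ((confE f lam u)⁻¹ * lor v (pd 0 (yLam f lam) u)) • pd 0 (yLam f lam) u
      + ((confE f lam u)⁻¹ * lor v (pd 1 (yLam f lam) u)) • pd 1 (yLam f lam) u
      + lor v (liftNormal f ν lam u) • liftNormal f ν lam u := by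
  obtain ⟨h1, h2, h3, h4, h5⟩ := (h.isNullFrame_liftNormal hl hu).dualNull_spec
  exact (h.isNullFrame_liftNormal hl hu).expand h1 h2 h3 h4 h5 v

/-- Since ξ_i is orthogonal to y and to ξ, it is orthogonal to N = ξ − Hy as well, so its expansion
has no N and no Z component. -/
theorem pd_gaussMap_eq (h : IsoPatch U f ν) (hl : IsConformalFactor lam) (hu : u ∈ U)
    (i : Fin 2) : pd i (gaussMap f ν) u
      = -(lor (pd i (gaussMap f ν) u) (liftDual f ν lam u)) • yLam f lam u
        - ((confE f lam u)⁻¹ * OmegaT f ν lam i 0 u) • pd 0 (yLam f lam) u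
        - ((confE f lam u)⁻¹ * OmegaT f ν lam i 1 u) • pd 1 (yLam f lam) u := by
  have e : lor (pd i (gaussMap f ν) u) (liftNormal f ν lam u) = 0 := by
    rw [eq_sub_of_add_eq (h.gaussMap_eq hl hu).symm, lor_sub_right, lor_smul_right,
      h.pd_gaussMap_self hu, h.pd_gaussMap_yLam hl hu]
    ring
  conv_lhs => rw [h.expand_liftDual hl hu (pd i (gaussMap f ν) u)]
  rw [e, h.pd_gaussMap_yLam hl hu, OmegaT, OmegaT, zero_smul, zero_smul, mul_neg, mul_neg,
    neg_smul (_ * _), neg_smul (_ * _)]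
  abel

/-- The y-component of ξ_i is orthogonal to every ξ_j, so the metric of ξ is E⁻¹Ω². A symmetric
traceless 2×2 matrix has scalar square, hence ξ is conformal. -/
theorem lor_pd_gaussMap (h : IsoPatch U f ν) (hl : IsConformalFactor lam) (hu : u ∈ U)
    (i j : Fin 2) : lor (pd i (gaussMap f ν) u) (pd j (gaussMap f ν) u) = (confE f lam u)⁻¹ *
      (OmegaT f ν lam i 0 u * OmegaT f ν lam j 0 u
        + OmegaT f ν lam i 1 u * OmegaT f ν lam j 1 u) := by
  have a0 : lor (pd 0 (yLam f lam) u) (pd j (gaussMap f ν) u) = -OmegaT f ν lam j 0 u := by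
    rw [OmegaT, neg_neg, lor_comm]
  have a1 : lor (pd 1 (yLam f lam) u) (pd j (gaussMap f ν) u) = -OmegaT f ν lam j 1 u := by
    rw [OmegaT, neg_neg, lor_comm]
  conv_lhs => rw [h.pd_gaussMap_eq hl hu i]
  rw [lor_sub_left, lor_sub_left, lor_smul_left, lor_smul_left, lor_smul_left, a0, a1,
    lor_comm (yLam f lam u), h.pd_gaussMap_yLam hl hu]
  ring

theorem OmegaT_one_one (h : IsoPatch U f ν) (hl : IsConformalFactor lam) (hu : u ∈ U) :
    OmegaT f ν lam 1 1 u = -OmegaT f ν lam 0 0 u := by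
  linarith [h.OmegaT_trace hl hu]

theorem confE_mul_moebiusFactor (h : IsoPatch U f ν) (hl : IsConformalFactor lam) (hu : u ∈ U) :
    confE f lam u * moebiusFactor f ν u
      = OmegaT f ν lam 0 0 u ^ 2 + OmegaT f ν lam 0 1 u ^ 2 := by
  have := (h.confE_pos hl hu).ne'
  rw [moebiusFactor, h.lor_pd_gaussMap hl hu]
  field_simp

theorem lor_pd_gaussMap_one_one (h : IsoPatch U f ν) (hu : u ∈ U) :
    lor (pd 1 (gaussMap f ν) u) (pd 1 (gaussMap f ν) u) = moebiusFactor f ν u := by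
  have hl := isConformalFactor_one
  rw [moebiusFactor, h.lor_pd_gaussMap hl hu, h.lor_pd_gaussMap hl hu, h.OmegaT_one_one hl hu,
    h.OmegaT_symm hl hu 1 0]
  ring

theorem lor_pd_gaussMap_orth (h : IsoPatch U f ν) (hu : u ∈ U) :
    lor (pd 0 (gaussMap f ν) u) (pd 1 (gaussMap f ν) u) = 0 := by
  have hl := isConformalFactor_one
  rw [h.lor_pd_gaussMap hl hu, h.OmegaT_one_one hl hu, h.OmegaT_symm hl hu 1 0]
  ring

/-- By Em = Ω_00² + Ω_01², the factor m can only vanish where all of Ω does, and that is an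
umbilical point. -/
theorem moebiusFactor_pos (h : IsoPatch U f ν) (hu : u ∈ U) : 0 < moebiusFactor f ν u := by
  have hl := isConformalFactor_one
  have hE := h.confE_pos hl hu
  have e := h.confE_mul_moebiusFactor hl hu
  -- In terms of Euclidean data, Ω_1 is −⟨df, dν⟩ minus H times the first fundamental form.
  have hO : ∀ i j, OmegaT f ν (fun _ => 1) i j u = -(meanCurv f ν (fun _ => 1) u *
      inner ℝ (pd i f u) (pd j f u)) - inner ℝ (pd j f u) (pd i ν u) := by
    intro i j
    have hg : pd i (gaussMap f ν) u = (meanCurv f ν (fun _ => 1) u • (0, pd i f u)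
        + pd i (meanCurv f ν (fun _ => 1)) u • (1, f u)) + (0, pd i ν u) := by
      have hn : ContDiffAt ℝ ∞ (fun b => ((0, ν b) : Mink)) u :=
        contDiffAt_const.prodMk (h.smooth_normal u hu)
      have hs : ContDiffAt ℝ ∞
          (fun b => meanCurv f ν (fun _ => 1) b • ((1, f b) : Mink)) u :=
        (h.smooth_meanCurv hl hu).smul (h.smooth_light hu)
      have e := pd_add hs hn i
      rw [pd_smul (h.smooth_meanCurv hl hu) (h.smooth_light hu), pd_light (h.smooth u hu),
        pd_prodMk contDiffAt_const (h.smooth_normal u hu), pd_const] at e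
      exact e
    rw [OmegaT, h.pd_yLam hl hu, pd_const, hg]
    simp only [lor_add_left, lor_smul_left, lor_spatial, lor_light_spatial, h.inner_pd_self hu,
      one_smul, zero_smul, add_zero, real_inner_comm (pd j f u)]
    ring
  have hnu := h.not_umbilic u hu
  have t := h.OmegaT_trace hl hu
  by_contra hm
  have hz : OmegaT f ν (fun _ => 1) 0 0 u ^ 2 + OmegaT f ν (fun _ => 1) 0 1 u ^ 2 ≤ 0 := by
    rw [← e]; exact mul_nonpos_of_nonneg_of_nonpos hE.le (not_lt.mp hm)
  have h00 : OmegaT f ν (fun _ => 1) 0 0 u = 0 := by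
    nlinarith [sq_nonneg (OmegaT f ν (fun _ => 1) 0 0 u), sq_nonneg (OmegaT f ν (fun _ => 1) 0 1 u)]
  have h01 : OmegaT f ν (fun _ => 1) 0 1 u = 0 := by
    nlinarith [sq_nonneg (OmegaT f ν (fun _ => 1) 0 0 u), sq_nonneg (OmegaT f ν (fun _ => 1) 0 1 u)]
  have h10 := h.OmegaT_symm hl hu 1 0
  have h11 := h.OmegaT_one_one hl hu
  rw [h01, hO] at h10
  rw [h00, hO] at h11
  rw [hO] at h00
  refine hnu ⟨?_, ?_⟩
  · rw [real_inner_comm (pd 0 f u), h.orth u hu] at h10; linarith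
  · rw [← h.conf u hu] at h11; linarith

theorem isNullFrame_gaussMap (h : IsoPatch U f ν) (hl : IsConformalFactor lam) (hu : u ∈ U) :
    IsNullFrame (yLam f lam u) (pd 0 (gaussMap f ν) u) (pd 1 (gaussMap f ν) u) (gaussMap f ν u)
      (moebiusFactor f ν u) where
  yy := h.yLam_null hu
  ya := by rw [lor_comm, h.pd_gaussMap_yLam hl hu]
  yb := by rw [lor_comm, h.pd_gaussMap_yLam hl hu]
  yn := by rw [lor_comm, h.gaussMap_yLam hu]
  aa := rfl
  bb := h.lor_pd_gaussMap_one_one hu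
  ab := h.lor_pd_gaussMap_orth hu
  an := h.pd_gaussMap_self hu 0
  bn := h.pd_gaussMap_self hu 1
  nn := h.gaussMap_self hu
  pos := h.moebiusFactor_pos hu
  fst := h.yLam_fst_ne hl hu

theorem existsUnique_isDualNull (h : IsoPatch U f ν) (hl : IsConformalFactor lam) (hu : u ∈ U) :
    ∃! v, IsDualNull f ν lam u v := by
  have F := h.isNullFrame_gaussMap hl hu
  obtain ⟨h1, h2, h3, h4, h5⟩ := F.dualNull_spec
  refine ⟨_, ⟨h1, h2, h5, forall_fin_two' h3 h4⟩, ?_⟩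
  rintro v ⟨k1, k2, k3, k4⟩
  exact F.dual_unique h1 h2 h3 h4 h5 k1 k2 (k4 0) (k4 1) k3

theorem yStar_spec (h : IsoPatch U f ν) (hl : IsConformalFactor lam) (hu : u ∈ U) :
    IsDualNull f ν lam u (yStar f ν lam u) :=
  Classical.epsilon_spec (h.existsUnique_isDualNull hl hu).exists

theorem eq_yStar (h : IsoPatch U f ν) (hl : IsConformalFactor lam) (hu : u ∈ U) {v : Mink}
    (hv : IsDualNull f ν lam u v) : v = yStar f ν lam u :=
  (h.existsUnique_isDualNull hl hu).unique hv (h.yStar_spec hl hu)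

theorem smooth_moebiusFactor (h : IsoPatch U f ν) (hu : u ∈ U) :
    ContDiffAt ℝ ∞ (moebiusFactor f ν) u :=
  contDiffAt_lor (contDiffAt_pd (h.smooth_gaussMap hu) 0) (contDiffAt_pd (h.smooth_gaussMap hu) 0)

/-- By uniqueness the chosen vector coincides with the explicit dual vector of the frame y, ξ_1,
ξ_2, ξ at every point of U. -/
theorem smooth_yStar (h : IsoPatch U f ν) (hl : IsConformalFactor lam) (hu : u ∈ U) :
    ContDiffAt ℝ ∞ (yStar f ν lam) u := by
  refine ContDiffAt.congr_of_eventuallyEq (contDiffAt_dualNull (h.smooth_yLam hl hu)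
    (contDiffAt_pd (h.smooth_gaussMap hu) 0) (contDiffAt_pd (h.smooth_gaussMap hu) 1)
    (h.smooth_gaussMap hu) (h.smooth_moebiusFactor hu) (h.yLam_fst_ne hl hu)
    (h.moebiusFactor_pos hu).ne')
    (Filter.eventuallyEq_of_mem (h.isOpen.mem_nhds hu) fun b hb => ?_)
  obtain ⟨h1, h2, h3, h4, h5⟩ := (h.isNullFrame_gaussMap hl hb).dualNull_spec
  exact (h.eq_yStar hl hb ⟨h1, h2, h5, forall_fin_two' h3 h4⟩).symm

theorem expand_yStar (h : IsoPatch U f ν) (hl : IsConformalFactor lam) (hu : u ∈ U)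
    (v : Mink) : v = -(lor v (yStar f ν lam u)) • yLam f lam u
      - lor v (yLam f lam u) • yStar f ν lam u
      + ((moebiusFactor f ν u)⁻¹ * lor v (pd 0 (gaussMap f ν) u)) • pd 0 (gaussMap f ν) u
      + ((moebiusFactor f ν u)⁻¹ * lor v (pd 1 (gaussMap f ν) u)) • pd 1 (gaussMap f ν) u
      + lor v (gaussMap f ν u) • gaussMap f ν u := by
  obtain ⟨k1, k2, k3, k4⟩ := h.yStar_spec hl hu
  exact (h.isNullFrame_gaussMap hl hu).expand k1 k2 (k4 0) (k4 1) k3 v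

theorem OmegaStar_eq (h : IsoPatch U f ν) (hl : IsConformalFactor lam) (hu : u ∈ U)
    (i j : Fin 2) : OmegaStar f ν lam i j u
      = lor (pd j (pd i (gaussMap f ν)) u) (yStar f ν lam u) := by
  rw [OmegaStar, ← lor_pd_of_const h.isOpen (fun _ hb => contDiffAt_pd (h.smooth_gaussMap hb) i)
    (fun _ hb => h.smooth_yStar hl hb)
    (fun b hb => by rw [lor_comm]; exact (h.yStar_spec hl hb).2.2.2 i) hu]

theorem OmegaStar_symm (h : IsoPatch U f ν) (hl : IsConformalFactor lam) (hu : u ∈ U)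
    (i j : Fin 2) : OmegaStar f ν lam i j u = OmegaStar f ν lam j i u := by
  rw [h.OmegaStar_eq hl hu, h.OmegaStar_eq hl hu, pd_comm (h.smooth_gaussMap hu)]

/-- The curvature of `λ² g₀` along the surface. -/
theorem riemann_onSurface (h : IsoPatch U f ν) (hl : IsConformalFactor lam) (hu : u ∈ U)
    (i j k l : Fin 3) : riemann (ambientMetric f ν lam) i j k l (onSurface u)
      = lor (pd i (pd k (coneLift f ν lam)) (onSurface u)) (liftDual f ν lam u)
            * ambientMetric f ν lam (onSurface u) j l
        + ambientMetric f ν lam (onSurface u) i k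
            * lor (pd j (pd l (coneLift f ν lam)) (onSurface u)) (liftDual f ν lam u)
        - lor (pd j (pd k (coneLift f ν lam)) (onSurface u)) (liftDual f ν lam u)
            * ambientMetric f ν lam (onSurface u) i l
        - ambientMetric f ν lam (onSurface u) j k
            * lor (pd i (pd l (coneLift f ν lam)) (onSurface u)) (liftDual f ν lam u) := by
  have p0 : pd 0 (coneLift f ν lam) (onSurface u) = pd 0 (yLam f lam) u :=
    h.pd_coneLift_onSurface hl hu 0
  have p1 : pd 1 (coneLift f ν lam) (onSurface u) = pd 1 (yLam f lam) u :=
    h.pd_coneLift_onSurface hl hu 1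
  have p2 := h.pd_last_coneLift hl hu
  refine (h.isGram hl).riemann_of_null (fun w hw => h.coneLift_null hw) (onSurface_mem_slab hu)
    (h.ambientMetric_det hl hu) ?_ ?_ i j k l
  · intro i
    rw [lor_comm]
    fin_cases i
    · exact p0 ▸ h.liftDual_pd hl hu 0
    · exact p1 ▸ h.liftDual_pd hl hu 1
    · change lor _ (pd 2 (coneLift f ν lam) (onSurface u)) = 0
      rw [p2, lor_smul_right, h.liftDual_liftNormal hl hu, mul_zero]
  -- A vector orthogonal to the lifted sphere has no component along y_1, y_2 or N, so only y and
  -- its dual remain in the expansion.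
  · intro v hv
    have v0 := hv 0
    have v1 := hv 1
    have v2 := hv 2
    rw [p0] at v0
    rw [p1] at v1
    rw [p2, lor_smul_right] at v2
    have v3 := (mul_eq_zero.mp v2).resolve_left (h.lam_pos hl hu).ne'
    conv_lhs => rw [h.expand_liftDual hl hu v, v0, v1, v3]
    simp [coneLift_onSurface]

/-- Since g_{i3} = 0, only two of the four curvature terms survive, and one is a multiple of the
metric. Its value r is irrelevant: the tensor is later contracted with a traceless one. -/
theorem riemNormal_eq (h : IsoPatch U f ν) (hl : IsConformalFactor lam) (hu : u ∈ U) :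
    ∃ r : ℝ, ∀ i j, riemNormal f ν lam i j u
      = lor (pd i (pd j (yLam f lam)) u) (liftDual f ν lam u) + if i = j then r else 0 := by
  have hp := (h.lam_pos hl hu).ne'
  refine ⟨confE f lam u *
    lor (pd 2 (pd 2 (coneLift f ν lam)) (onSurface u)) (liftDual f ν lam u) / lam (f u) ^ 2, ?_⟩
  intro i j
  rw [riemNormal, h.riemann_onSurface hl hu, h.ambientMetric_onSurface hl hu,
    h.pd_pd_coneLift_onSurface hl hu]
  fin_cases i <;> fin_cases j <;> simp <;> field_simp

/-- In dimension three the off-diagonal Ricci entry is ⟨∂_i∂_s Y, Z⟩, which equals λ⟨N_i, Z⟩ because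
N ⟂ Z. Substituting N = ξ − Hy, with ⟨y, Z⟩ = −1 and y_i ⟂ Z, gives the formula. -/
theorem ricNormal_eq (h : IsoPatch U f ν) (hl : IsConformalFactor lam) (hu : u ∈ U) (i : Fin 2) :
    ricNormal f ν lam i u = lor (pd i (gaussMap f ν) u) (liftDual f ν lam u)
      + pd i (meanCurv f ν lam) u := by
  have hp := (h.lam_pos hl hu).ne'
  have hE := (h.confE_pos hl hu).ne'
  have hY := h.smooth_coneLift hl (onSurface_mem_slab hu)
  have e1 : pd i.castSucc (pd 2 (coneLift f ν lam)) (onSurface u)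
      = lam (f u) • pd i (liftNormal f ν lam) u
        + pd i (fun b => lam (f b)) u • liftNormal f ν lam u := by
    rw [← pd_onSurface (contDiffAt_pd hY 2),
      ← pd_smul (h.smooth_lam hl hu) (h.smooth_liftNormal hl hu)]
    exact pd_congr_of_isOpen h.isOpen (fun b hb => h.pd_last_coneLift hl hb) i hu
  have e2 : ricci (ambientMetric f ν lam) 2 i.castSucc (onSurface u)
      = lor (pd i.castSucc (pd 2 (coneLift f ν lam)) (onSurface u)) (liftDual f ν lam u) := by
    simp only [ricci, h.ambientMetric_inv hl hu]
    simp only [h.riemann_onSurface hl hu, h.ambientMetric_onSurface hl hu, Fin.sum_univ_three]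
    fin_cases i <;> simp [pd_comm hY 2 0, pd_comm hY 2 1] <;> field_simp <;> ring
  have e3 : pd i (gaussMap f ν) u = pd i (liftNormal f ν lam) u
      + (meanCurv f ν lam u • pd i (yLam f lam) u
        + pd i (meanCurv f ν lam) u • yLam f lam u) := by
    have s1 := h.smooth_meanCurv hl hu
    have s2 := h.smooth_yLam hl hu
    have s3 : ContDiffAt ℝ ∞ (fun b => meanCurv f ν lam b • yLam f lam b) u := s1.smul s2
    rw [← pd_smul s1 s2, ← pd_add (h.smooth_liftNormal hl hu) s3]
    exact pd_congr_of_isOpen h.isOpen (fun b hb => h.gaussMap_eq hl hb) i hu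
  rw [ricNormal, e2, e1, e3]
  simp only [lor_add_right, lor_smul_right, lor_comm _ (liftDual f ν lam u), h.liftDual_yLam hl hu,
    h.liftDual_pd hl hu, h.liftDual_liftNormal hl hu]
  field_simp
  ring

/-- Summed over i and divided by E, this part of the divergence of R_{3i} equals the contraction of
the traceless second fundamental form with R_{i3j3}. The two terms cancel in 𝓗. -/
theorem lor_pd_gaussMap_pd_liftDual (h : IsoPatch U f ν) (hl : IsConformalFactor lam)
    (hu : u ∈ U) (i : Fin 2) : lor (pd i (gaussMap f ν) u) (pd i (liftDual f ν lam) u)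
      = (confE f lam u)⁻¹ *
        (OmegaT f ν lam i 0 u * lor (pd i (pd 0 (yLam f lam)) u) (liftDual f ν lam u)
          + OmegaT f ν lam i 1 u * lor (pd i (pd 1 (yLam f lam)) u) (liftDual f ν lam u)) := by
  have a : lor (yLam f lam u) (pd i (liftDual f ν lam) u) = 0 := by
    have e := lor_pd_of_const h.isOpen (fun _ hb => h.smooth_yLam hl hb)
      (fun _ hb => h.smooth_liftDual hl hb)
      (fun b hb => by rw [lor_comm]; exact h.liftDual_yLam hl hb) hu i
    rw [lor_comm, h.liftDual_pd hl hu] at e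
    linarith
  have b : ∀ k, lor (pd k (yLam f lam) u) (pd i (liftDual f ν lam) u)
      = -lor (pd i (pd k (yLam f lam)) u) (liftDual f ν lam u) := by
    intro k
    have e := lor_pd_of_const h.isOpen (fun _ hb => contDiffAt_pd (h.smooth_yLam hl hb) k)
      (fun _ hb => h.smooth_liftDual hl hb)
      (fun b hb => by rw [lor_comm]; exact h.liftDual_pd hl hb k) hu i
    linarith
  conv_lhs => rw [h.pd_gaussMap_eq hl hu i]
  rw [lor_sub_left, lor_sub_left, lor_smul_left, lor_smul_left, lor_smul_left, a, b, b]
  ring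

/-- The Laplacian of the conformal Gauss map. -/
theorem laplace_gaussMap (h : IsoPatch U f ν) (hl : IsConformalFactor lam) (hu : u ∈ U) :
    pd 0 (pd 0 (gaussMap f ν)) u + pd 1 (pd 1 (gaussMap f ν)) u
      = -(OmegaStar f ν lam 0 0 u + OmegaStar f ν lam 1 1 u) • yLam f lam u
        - (2 * moebiusFactor f ν u) • gaussMap f ν u := by
  have hs := h.smooth_gaussMap hu
  have hsm := fun b (hb : b ∈ U) => h.smooth_gaussMap hb
  have y0 : ∀ i, lor (pd i (pd i (gaussMap f ν)) u) (yLam f lam u) = OmegaT f ν lam i i u := by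
    intro i
    rw [OmegaT]
    exact lor_pd_of_const h.isOpen (fun b hb => contDiffAt_pd (hsm b hb) i)
      (fun _ hb => h.smooth_yLam hl hb) (fun b hb => h.pd_gaussMap_yLam hl hb i) hu i
  have x0 : ∀ i, lor (pd i (pd i (gaussMap f ν)) u) (gaussMap f ν u)
      = -lor (pd i (gaussMap f ν) u) (pd i (gaussMap f ν) u) := by
    intro i
    exact lor_pd_of_const h.isOpen (fun b hb => contDiffAt_pd (hsm b hb) i) hsm
      (fun b hb => h.pd_gaussMap_self hb i) hu i
  -- From here to `c1`: differentiating the conformality relations |ξ_1|² = |ξ_2|² and ⟨ξ_1, ξ_2⟩ =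
  -- 0 shows that the flat Laplacian of ξ is orthogonal to both ξ_1 and ξ_2.
  have d0 : ∀ i, lor (pd i (pd 0 (gaussMap f ν)) u) (pd 0 (gaussMap f ν) u)
      = lor (pd i (pd 1 (gaussMap f ν)) u) (pd 1 (gaussMap f ν) u) := by
    intro i
    have s := contDiffAt_pd hs
    have e := pd_congr_of_isOpen h.isOpen (fun b hb => h.lor_pd_gaussMap_one_one hb) i hu
    rw [show moebiusFactor f ν = fun b => lor (pd 0 (gaussMap f ν) b) (pd 0 (gaussMap f ν) b)
      from rfl, pd_lor (s 1) (s 1), pd_lor (s 0) (s 0), lor_comm (pd 1 (gaussMap f ν) u),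
      lor_comm (pd 0 (gaussMap f ν) u)] at e
    linarith
  have o0 : ∀ i, lor (pd i (pd 0 (gaussMap f ν)) u) (pd 1 (gaussMap f ν) u)
      = -lor (pd 0 (gaussMap f ν) u) (pd i (pd 1 (gaussMap f ν)) u) := by
    intro i
    exact lor_pd_of_const h.isOpen (fun b hb => contDiffAt_pd (hsm b hb) 0)
      (fun b hb => contDiffAt_pd (hsm b hb) 1) (fun b hb => h.lor_pd_gaussMap_orth hb) hu i
  have c0 : lor (pd 0 (pd 0 (gaussMap f ν)) u + pd 1 (pd 1 (gaussMap f ν)) u)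
      (pd 0 (gaussMap f ν) u) = 0 := by
    have e := o0 1
    rw [pd_comm hs 1 0, ← d0 0, lor_comm (pd 0 (gaussMap f ν) u)] at e
    rw [lor_add_left]
    linarith
  have c1 : lor (pd 0 (pd 0 (gaussMap f ν)) u + pd 1 (pd 1 (gaussMap f ν)) u)
      (pd 1 (gaussMap f ν) u) = 0 := by
    have e := o0 0
    rw [pd_comm hs 0 1, lor_comm (pd 0 (gaussMap f ν) u), d0 1] at e
    rw [lor_add_left]
    linarith
  conv_lhs => rw [h.expand_yStar hl hu
    (pd 0 (pd 0 (gaussMap f ν)) u + pd 1 (pd 1 (gaussMap f ν)) u)]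
  rw [c0, c1, lor_add_left, lor_add_left, lor_add_left, y0, y0, h.OmegaT_trace hl hu, x0, x0,
    h.lor_pd_gaussMap_one_one hu, ← h.OmegaStar_eq hl hu, ← h.OmegaStar_eq hl hu,
    show lor (pd 0 (gaussMap f ν) u) (pd 0 (gaussMap f ν) u) = moebiusFactor f ν u from rfl,
    show -moebiusFactor f ν u + -moebiusFactor f ν u = -(2 * moebiusFactor f ν u) by ring]
  simp only [mul_zero, zero_smul, sub_zero, add_zero, neg_smul]
  abel

/-- `𝓗_λ = - tr Ω*_λ / E_λ`. -/
theorem scriptH_eq (h : IsoPatch U f ν) (hl : IsConformalFactor lam) (hu : u ∈ U) :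
    scriptH f ν lam u
      = -(OmegaStar f ν lam 0 0 u + OmegaStar f ν lam 1 1 u) / confE f lam u := by
  have hE := (h.confE_pos hl hu).ne'
  obtain ⟨r, hr⟩ := h.riemNormal_eq hl hu
  -- The second derivatives of H that appear here cancel ΔH in the definition of 𝓗.
  have hdiv : ∀ i, pd i (ricNormal f ν lam i) u
      = lor (pd i (pd i (gaussMap f ν)) u) (liftDual f ν lam u)
        + lor (pd i (gaussMap f ν) u) (pd i (liftDual f ν lam) u)
        + pd i (pd i (meanCurv f ν lam)) u := by
    intro i
    have s1 := contDiffAt_pd (h.smooth_gaussMap hu) i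
    have s2 := h.smooth_liftDual hl hu
    rw [← pd_lor s1 s2, ← pd_add (contDiffAt_lor s1 s2) (contDiffAt_pd (h.smooth_meanCurv hl hu) i)]
    exact pd_congr_of_isOpen h.isOpen (fun b hb => h.ricNormal_eq hl hb i) i hu
  -- The term 2mH cancels |II°|²H, because |II°|² = 2m/E. Only the trace of Ω* is left.
  have lap : lor (pd 0 (pd 0 (gaussMap f ν)) u) (liftDual f ν lam u)
      + lor (pd 1 (pd 1 (gaussMap f ν)) u) (liftDual f ν lam u)
      = OmegaStar f ν lam 0 0 u + OmegaStar f ν lam 1 1 u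
        + 2 * moebiusFactor f ν u * meanCurv f ν lam u := by
    rw [← lor_add_left, h.laplace_gaussMap hl hu, h.gaussMap_eq hl hu]
    simp only [lor_sub_right, lor_add_right, lor_smul_right, lor_comm _ (liftDual f ν lam u),
      h.liftDual_yLam hl hu, h.liftDual_liftNormal hl hu]
    ring
  have hm := h.confE_mul_moebiusFactor hl hu
  simp only [scriptH, surfLaplace, tensorInner, surfDiv, Fin.sum_univ_two, hdiv, hr,
    h.tracelessFF_eq hl hu, h.lor_pd_gaussMap_pd_liftDual hl hu, h.OmegaT_one_one hl hu,
    h.OmegaT_symm hl hu 1 0]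
  simp only [if_true, Fin.zero_eq_one_iff, Fin.one_eq_zero_iff, if_false, OfNat.ofNat_ne_one]
  have e1 : lor (pd 0 (pd 0 (gaussMap f ν)) u) (liftDual f ν lam u) =
      OmegaStar f ν lam 0 0 u + OmegaStar f ν lam 1 1 u
        + 2 * moebiusFactor f ν u * meanCurv f ν lam u
        - lor (pd 1 (pd 1 (gaussMap f ν)) u) (liftDual f ν lam u) := by linarith
  rw [e1]
  field_simp
  linear_combination (-2 * meanCurv f ν lam u) * hm

end IsoPatch

end AssocSurface

end

noncomputable section

namespace AssocSurface

/-! ### Functions of `(α, ρ, u¹, u²)` -/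

theorem contDiff_baseCoord : ContDiff ℝ ∞ baseCoord := by
  unfold baseCoord
  rw [contDiff_euclidean]
  intro i
  fin_cases i <;> simp <;> fun_prop

theorem baseCoord_mk (a r : ℝ) (u : Coord 2) : baseCoord !₂[a, r, u 0, u 1] = u := by
  ext i; fin_cases i <;> simp [baseCoord]

section Base

variable {V : Type*} [NormedAddCommGroup V] [NormedSpace ℝ V] {F : Coord 2 → V} {c : Coord 4}

theorem contDiffAt_base (hF : ContDiffAt ℝ ∞ F (baseCoord c)) :
    ContDiffAt ℝ ∞ (fun b => F (baseCoord b)) c :=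
  ContDiffAt.comp c hF contDiff_baseCoord.contDiffAt

theorem pd_base (hF : ContDiffAt ℝ ∞ F (baseCoord c)) (i : Fin 4) :
    pd i (fun b => F (baseCoord b)) c
      = (![0, 0, pd 0 F (baseCoord c), pd 1 F (baseCoord c)] : Fin 4 → V) i := by
  rw [pd_comp hF contDiff_baseCoord.contDiffAt, Fin.sum_univ_two]
  have h0 : ∀ b : Coord 4, baseCoord b 0 = b 2 := fun b => by simp [baseCoord]
  have h1 : ∀ b : Coord 4, baseCoord b 1 = b 3 := fun b => by simp [baseCoord]
  simp only [h0, h1, pd_coord]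
  fin_cases i <;> simp

end Base

/-- Two functions that agree where `ρ = 0` have the same derivatives in the other directions. -/
theorem pd_congr_slice {V : Type*} [NormedAddCommGroup V] [NormedSpace ℝ V] {F G : Coord 4 → V}
    {D : Set (Coord 4)} (hD : IsOpen D) {c : Coord 4} (hc : c ∈ D) (h1 : c 1 = 0)
    (hF : ContDiffAt ℝ ∞ F c) (hG : ContDiffAt ℝ ∞ G c)
    (h : ∀ b ∈ D, b 1 = 0 → F b = G b) {i : Fin 4} (hi : i ≠ 1) : pd i F c = pd i G c := by
  -- A coordinate derivative is taken along the coordinate line through c, and for i ≠ 1 this line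
  -- stays in ρ = 0.
  have key : ∀ {H : Coord 4 → V}, ContDiffAt ℝ ∞ H c →
      pd i H c = deriv (fun t : ℝ => H (c + t • EuclideanSpace.single i 1)) 0 := by
    intro H hH
    have hl : HasDerivAt (fun t : ℝ => c + t • EuclideanSpace.single i (1 : ℝ))
        (EuclideanSpace.single i 1) 0 := by
      simpa using ((hasDerivAt_id (0 : ℝ)).smul_const (EuclideanSpace.single i (1 : ℝ))).const_add c
    have hH' : HasFDerivAt H (fderiv ℝ H c) (c + (0 : ℝ) • EuclideanSpace.single i 1) := by
      simpa using (differentiableAt_of_smooth hH).hasFDerivAt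
    exact (hH'.comp_hasDerivAt (0 : ℝ) hl).deriv.symm
  rw [key hF, key hG]
  refine Filter.EventuallyEq.deriv_eq ?_
  have ht : Filter.Tendsto (fun t : ℝ => c + t • EuclideanSpace.single i (1 : ℝ)) (nhds 0)
      (nhds c) := by
    have : Continuous (fun t : ℝ => c + t • EuclideanSpace.single i (1 : ℝ)) := by fun_prop
    simpa using this.tendsto 0
  filter_upwards [ht.eventually (hD.mem_nhds hc)] with t ht
  exact h _ ht (by simp [h1, hi.symm])

theorem pd_separated {k : ℝ → ℝ} {s : Coord 2 → ℝ} {c : Coord 4} (hk : ContDiffAt ℝ ∞ k (c 0))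
    (hs : ContDiffAt ℝ ∞ s (baseCoord c)) (i : Fin 4) :
    pd i (fun b => k (b 0) * s (baseCoord b)) c
      = ![deriv k (c 0) * s (baseCoord c), 0, k (c 0) * pd 0 s (baseCoord c),
          k (c 0) * pd 1 s (baseCoord c)] i := by
  have hk' : ContDiffAt ℝ ∞ (fun b : Coord 4 => k (b 0)) c := hk.comp c (contDiffAt_coord 0 c)
  rw [pd_mul hk' (contDiffAt_base hs), pd_base hs,
    pd_real_comp (hk.differentiableAt (by simp)) (contDiffAt_coord 0 c), pd_coord]
  fin_cases i <;> simp

theorem contDiffAt_separated {k : ℝ → ℝ} {s : Coord 2 → ℝ} {c : Coord 4}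
    (hk : ContDiffAt ℝ ∞ k (c 0)) (hs : ContDiffAt ℝ ∞ s (baseCoord c)) :
    ContDiffAt ℝ ∞ (fun b => k (b 0) * s (baseCoord b)) c :=
  ContDiffAt.mul (ContDiffAt.comp c hk (contDiffAt_coord 0 c)) (contDiffAt_base hs)

/-! ### The metric of the associate surface -/

/-- The metric `-2 (dα - αω)(ρ dα + α dρ + αρω) + α² m⁻¹ |P du|²`, with `P = (p q; q s)`. -/
def coneMetric (a r w0 w1 p q s m : ℝ) : Matrix (Fin 4) (Fin 4) ℝ :=
  !![-2 * r, -a, 0, 0;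
    -a, 0, a ^ 2 * w0, a ^ 2 * w1;
    0, a ^ 2 * w0, a ^ 2 * (2 * r * w0 * w0 + m⁻¹ * (p * p + q * q)),
      a ^ 2 * (2 * r * w0 * w1 + m⁻¹ * (p * q + q * s));
    0, a ^ 2 * w1, a ^ 2 * (2 * r * w0 * w1 + m⁻¹ * (p * q + q * s)),
      a ^ 2 * (2 * r * w1 * w1 + m⁻¹ * (q * q + s * s))]

/-- The inverse of `coneMetric`, with `K = P⁻²`. -/
def coneMetricInv (a r w0 w1 m k00 k01 k11 : ℝ) : Matrix (Fin 4) (Fin 4) ℝ :=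
  let v0 := k00 * w0 + k01 * w1
  let v1 := k01 * w0 + k11 * w1
  let n := w0 * v0 + w1 * v1
  !![m * n, -a⁻¹ - 2 * m * r * n / a, m * v0 / a, m * v1 / a;
    -a⁻¹ - 2 * m * r * n / a, 2 * r / a ^ 2 + 4 * m * r ^ 2 * n / a ^ 2,
      -(2 * r * m * v0 / a ^ 2), -(2 * r * m * v1 / a ^ 2);
    m * v0 / a, -(2 * r * m * v0 / a ^ 2), m * k00 / a ^ 2, m * k01 / a ^ 2;
    m * v1 / a, -(2 * r * m * v1 / a ^ 2), m * k01 / a ^ 2, m * k11 / a ^ 2]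

theorem coneMetric_det (a r w0 w1 p q s m : ℝ) :
    (coneMetric a r w0 w1 p q s m).det = -(a ^ 6 * m⁻¹ ^ 2 * (p * s - q ^ 2) ^ 2) := by
  rw [coneMetric, Matrix.det_succ_row_zero]
  simp [Fin.sum_univ_four, Matrix.det_fin_three, Fin.succAbove]
  ring

theorem coneMetric_inv {a r w0 w1 p q s m : ℝ} (ha : a ≠ 0) (hm : m ≠ 0)
    (hD : p * s - q ^ 2 ≠ 0) :
    (coneMetric a r w0 w1 p q s m)⁻¹ = coneMetricInv a r w0 w1 m
      ((s ^ 2 + q ^ 2) / (p * s - q ^ 2) ^ 2) (-(q * (p + s)) / (p * s - q ^ 2) ^ 2)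
      ((p ^ 2 + q ^ 2) / (p * s - q ^ 2) ^ 2) := by
  obtain ⟨k00, hk00⟩ : ∃ k, k = (s ^ 2 + q ^ 2) / (p * s - q ^ 2) ^ 2 := ⟨_, rfl⟩
  obtain ⟨k01, hk01⟩ : ∃ k, k = -(q * (p + s)) / (p * s - q ^ 2) ^ 2 := ⟨_, rfl⟩
  obtain ⟨k11, hk11⟩ : ∃ k, k = (p ^ 2 + q ^ 2) / (p * s - q ^ 2) ^ 2 := ⟨_, rfl⟩
  -- The matrix K is adj(P)²/(det P)². The four identities say P²K = 1, which is all that the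
  -- verification of the inverse uses about K.
  have e1 : (p * p + q * q) * k00 + (p * q + q * s) * k01 = 1 := by
    rw [hk00, hk01]; field_simp; ring
  have e2 : (p * p + q * q) * k01 + (p * q + q * s) * k11 = 0 := by
    rw [hk01, hk11]; field_simp; ring
  have e3 : (p * q + q * s) * k00 + (q * q + s * s) * k01 = 0 := by
    rw [hk00, hk01]; field_simp; ring
  have e4 : (p * q + q * s) * k01 + (q * q + s * s) * k11 = 1 := by
    rw [hk01, hk11]; field_simp; ring
  rw [← hk00, ← hk01, ← hk11]
  refine Matrix.inv_eq_right_inv ?_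
  ext i j
  rw [Matrix.mul_apply, Fin.sum_univ_four]
  fin_cases i <;> fin_cases j <;>
    simp only [coneMetric, coneMetricInv, Matrix.of_apply, Matrix.cons_val', Matrix.cons_val,
      Fin.zero_eta, Fin.mk_one, Fin.reduceFinMk, Matrix.one_apply, Fin.reduceEq, if_true, if_false,
      Fin.isValue] <;> field_simp
  all_goals first
    | ring1
    | linear_combination a * w0 * e1 + a * w1 * e2
    | linear_combination (-2 * r * a) * (w0 * e1 + w1 * e2)
    | linear_combination a * e1
    | linear_combination a * e2
    | linear_combination a * w0 * e3 + a * w1 * e4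
    | linear_combination (-2 * r * a) * (w0 * e3 + w1 * e4)
    | linear_combination a * e3
    | linear_combination a * e4

/-- `Ω_λ + ρ Ω*_λ`. -/
def assocP (f ν : Coord 2 → E4) (lam : E4 → ℝ) (i j : Fin 2) (c : Coord 4) : ℝ :=
  OmegaT f ν lam i j (baseCoord c) + c 1 * OmegaStar f ν lam i j (baseCoord c)

/-- `|det (Ω_λ + ρ Ω*_λ)| / m` for small `ρ`. -/
def assocQ (f ν : Coord 2 → E4) (lam : E4 → ℝ) (c : Coord 4) : ℝ :=
  (assocP f ν lam 0 1 c ^ 2 - assocP f ν lam 0 0 c * assocP f ν lam 1 1 c)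
    / moebiusFactor f ν (baseCoord c)

/-- The set over `U` where `α > 0` and `ρ` is so small that the associate surface is regular. -/
def assocDom (f ν : Coord 2 → E4) (lam : E4 → ℝ) (U : Set (Coord 2)) : Set (Coord 4) :=
  {c | 0 < c 0 ∧ baseCoord c ∈ U ∧ 0 < assocQ f ν lam c}

namespace IsoPatch

variable {U : Set (Coord 2)} {f ν : Coord 2 → E4} {lam : E4 → ℝ} {u : Coord 2} {c : Coord 4}

/-- Structure equation of the frame y, y*, ξ_1, ξ_2, ξ. There is no y* component because y is null
and no ξ component because ξ is normal to the surface; the companion equation for y* carries the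
opposite sign of ω. -/
theorem pd_yLam_eq (h : IsoPatch U f ν) (hl : IsConformalFactor lam) (hu : u ∈ U) (i : Fin 2) :
    pd i (yLam f lam) u = -(omegaForm f ν lam i u) • yLam f lam u
      - ((moebiusFactor f ν u)⁻¹ * OmegaT f ν lam i 0 u) • pd 0 (gaussMap f ν) u
      - ((moebiusFactor f ν u)⁻¹ * OmegaT f ν lam i 1 u) • pd 1 (gaussMap f ν) u := by
  have e : ∀ k, lor (pd i (yLam f lam) u) (pd k (gaussMap f ν) u) = -OmegaT f ν lam i k u := by
    intro k
    rw [h.OmegaT_symm hl hu, OmegaT, neg_neg, lor_comm]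
  conv_lhs => rw [h.expand_yStar hl hu (pd i (yLam f lam) u)]
  rw [e, e, lor_comm _ (gaussMap f ν u), h.gaussMap_pd_yLam hl hu, lor_comm _ (yLam f lam u),
    h.yLam_pd hl hu, zero_smul, zero_smul, mul_neg, mul_neg, neg_smul (_ * _), neg_smul (_ * _),
    omegaForm]
  abel

theorem pd_yStar_eq (h : IsoPatch U f ν) (hl : IsConformalFactor lam) (hu : u ∈ U) (i : Fin 2) :
    pd i (yStar f ν lam) u = omegaForm f ν lam i u • yStar f ν lam u
      - ((moebiusFactor f ν u)⁻¹ * OmegaStar f ν lam i 0 u) • pd 0 (gaussMap f ν) u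
      - ((moebiusFactor f ν u)⁻¹ * OmegaStar f ν lam i 1 u) • pd 1 (gaussMap f ν) u := by
  have hys := fun b (hb : b ∈ U) => h.smooth_yStar hl hb
  have e : ∀ k, lor (pd i (yStar f ν lam) u) (pd k (gaussMap f ν) u)
      = -OmegaStar f ν lam i k u := by
    intro k
    rw [h.OmegaStar_symm hl hu, OmegaStar, neg_neg, lor_comm]
  have e1 : lor (pd i (yStar f ν lam) u) (yStar f ν lam u) = 0 := by
    have := lor_pd_of_const h.isOpen hys hys (fun b hb => (h.yStar_spec hl hb).2.1) hu i
    rw [lor_comm (yStar f ν lam u)] at this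
    linarith
  have e2 : lor (pd i (yStar f ν lam) u) (yLam f lam u) = -omegaForm f ν lam i u := by
    rw [omegaForm, lor_comm (pd i (yLam f lam) u)]
    exact lor_pd_of_const h.isOpen hys (fun _ hb => h.smooth_yLam hl hb)
      (fun b hb => (h.yStar_spec hl hb).1) hu i
  have e3 : lor (pd i (yStar f ν lam) u) (gaussMap f ν u) = 0 := by
    rw [lor_pd_of_const h.isOpen hys (fun _ hb => h.smooth_gaussMap hb)
      (fun b hb => (h.yStar_spec hl hb).2.2.1) hu i, (h.yStar_spec hl hu).2.2.2 i, neg_zero]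
  conv_lhs => rw [h.expand_yStar hl hu (pd i (yStar f ν lam) u)]
  rw [e, e, e1, e2, e3, zero_smul, neg_zero, zero_smul, mul_neg, mul_neg, neg_smul (_ * _),
    neg_smul (_ * _), neg_smul]
  abel

theorem assocP_symm (h : IsoPatch U f ν) (hl : IsConformalFactor lam) (hc : baseCoord c ∈ U) :
    assocP f ν lam 1 0 c = assocP f ν lam 0 1 c := by
  rw [assocP, assocP, h.OmegaT_symm hl hc 1 0, h.OmegaStar_symm hl hc 1 0]

theorem pd_assoc (h : IsoPatch U f ν) (hl : IsConformalFactor lam) (hc : baseCoord c ∈ U)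
    (A : Fin 4) : pd A (assoc f ν lam) c
      = (![yLam f lam (baseCoord c) + c 1 • yStar f ν lam (baseCoord c),
          c 0 • yStar f ν lam (baseCoord c),
          c 0 • (pd 0 (yLam f lam) (baseCoord c) + c 1 • pd 0 (yStar f ν lam) (baseCoord c)),
          c 0 • (pd 1 (yLam f lam) (baseCoord c) + c 1 • pd 1 (yStar f ν lam) (baseCoord c))]
          : Fin 4 → Mink) A := by
  have hy := h.smooth_yLam hl hc
  have hs := h.smooth_yStar hl hc
  have a0 := contDiffAt_coord 0 c
  have a1 := contDiffAt_coord 1 c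
  have s1 : ContDiffAt ℝ ∞ (fun b : Coord 4 => b 0 • yLam f lam (baseCoord b)) c :=
    a0.smul (contDiffAt_base hy)
  have a01 : ContDiffAt ℝ ∞ (fun b : Coord 4 => b 0 * b 1) c := a0.mul a1
  have s2 : ContDiffAt ℝ ∞ (fun b : Coord 4 => (b 0 * b 1) • yStar f ν lam (baseCoord b)) c :=
    a01.smul (contDiffAt_base hs)
  have e := pd_add s1 s2 A
  rw [pd_smul a0 (contDiffAt_base hy), pd_smul a01 (contDiffAt_base hs), pd_mul a0 a1,
    pd_base hy, pd_base hs, pd_coord, pd_coord] at e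
  refine e.trans ?_
  fin_cases A <;> simp [smul_smul]

/-- Along ξ_1 and ξ_2, the matrices Ω and ρΩ* enter only through their sum P, so the metric keeps
the same shape for all ρ. -/
theorem tangent_eq (h : IsoPatch U f ν) (hl : IsConformalFactor lam) (hc : baseCoord c ∈ U)
    (i : Fin 2) :
    pd i (yLam f lam) (baseCoord c) + c 1 • pd i (yStar f ν lam) (baseCoord c)
      = -(omegaForm f ν lam i (baseCoord c)) • yLam f lam (baseCoord c)
        + (c 1 * omegaForm f ν lam i (baseCoord c)) • yStar f ν lam (baseCoord c)
        - ((moebiusFactor f ν (baseCoord c))⁻¹ * assocP f ν lam i 0 c)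
          • pd 0 (gaussMap f ν) (baseCoord c)
        - ((moebiusFactor f ν (baseCoord c))⁻¹ * assocP f ν lam i 1 c)
          • pd 1 (gaussMap f ν) (baseCoord c) := by
  rw [h.pd_yLam_eq hl hc, h.pd_yStar_eq hl hc, assocP, assocP]
  module

theorem assocI_eq (h : IsoPatch U f ν) (hl : IsConformalFactor lam) (hc : baseCoord c ∈ U) :
    assocI f ν lam c = coneMetric (c 0) (c 1) (omegaForm f ν lam 0 (baseCoord c))
      (omegaForm f ν lam 1 (baseCoord c)) (assocP f ν lam 0 0 c) (assocP f ν lam 0 1 c)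
      (assocP f ν lam 1 1 c) (moebiusFactor f ν (baseCoord c)) := by
  have F := h.isNullFrame_gaussMap hl hc
  obtain ⟨k1, k2, k3, k4⟩ := h.yStar_spec hl hc
  have k5 := k4 0
  have k6 := k4 1
  have hm := (h.moebiusFactor_pos hc).ne'
  have k1' := k1
  have k5' := k5
  have k6' := k6
  have ya := F.ya
  have yb := F.yb
  have ab := F.ab
  rw [lor_comm] at k1' k5' k6' ya yb ab
  ext A B
  rw [assocI, Matrix.of_apply, h.pd_assoc hl hc, h.pd_assoc hl hc, h.tangent_eq hl hc,
    h.tangent_eq hl hc, h.assocP_symm hl hc]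
  fin_cases A <;> fin_cases B <;>
    simp only [coneMetric, Matrix.of_apply, Matrix.cons_val', Matrix.cons_val,
      Fin.zero_eta, Fin.mk_one, Fin.reduceFinMk, Fin.isValue, lor_add_left, lor_add_right,
      lor_sub_left, lor_sub_right, lor_smul_left, lor_smul_right, F.yy, F.ya, F.yb, F.aa, F.bb,
      F.ab, ya, yb, ab, k1, k2, k5, k6, k1', k5', k6'] <;> field_simp <;> ring

/-- The directions y and y* are orthogonal to dξ, and in the u-block the factor m⁻¹ cancels against
⟨ξ_i, ξ_i⟩ = m. -/
theorem assocII_eq (h : IsoPatch U f ν) (hl : IsConformalFactor lam) (hc : baseCoord c ∈ U) :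
    assocII f ν lam c = !![0, 0, 0, 0; 0, 0, 0, 0;
      0, 0, c 0 * assocP f ν lam 0 0 c, c 0 * assocP f ν lam 0 1 c;
      0, 0, c 0 * assocP f ν lam 0 1 c, c 0 * assocP f ν lam 1 1 c] := by
  have F := h.isNullFrame_gaussMap hl hc
  obtain ⟨k1, k2, k3, k4⟩ := h.yStar_spec hl hc
  have k5 := k4 0
  have k6 := k4 1
  have hm := (h.moebiusFactor_pos hc).ne'
  have ab := F.ab
  rw [lor_comm] at ab
  ext A B
  rw [assocII, Matrix.of_apply, h.pd_assoc hl hc, pd_base (h.smooth_gaussMap hc),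
    h.tangent_eq hl hc, h.tangent_eq hl hc, h.assocP_symm hl hc]
  fin_cases A <;> fin_cases B <;>
    simp only [Matrix.of_apply, Matrix.cons_val', Matrix.cons_val,
      Fin.zero_eta, Fin.mk_one, Fin.reduceFinMk, Fin.isValue, lor_add_left, lor_zero_right,
      lor_sub_left, lor_smul_left, F.ya, F.yb, F.aa, F.bb,
      F.ab, ab, k5, k6] <;> field_simp <;> ring

end IsoPatch

end AssocSurface

end

/-! ### The Laplacian of the associate surface in divergence form -/

noncomputable section

namespace AssocSurface

theorem laplaceBeltrami_congr {d : ℕ} {g : Coord d → Matrix (Fin d) (Fin d) ℝ}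
    {F G : Coord d → ℝ} {D : Set (Coord d)} (hD : IsOpen D) (h : ∀ c ∈ D, F c = G c)
    {c : Coord d} (hc : c ∈ D) : laplaceBeltrami g F c = laplaceBeltrami g G c := by
  simp only [laplaceBeltrami]
  congr 1
  refine Finset.sum_congr rfl fun A _ => Finset.sum_congr rfl fun B _ => ?_
  refine pd_congr_of_isOpen hD (fun b hb => ?_) A hc
  rw [pd_congr_of_isOpen hD h B hb]

/-- `m⁻¹ Q⁻¹ (adj P)²`, which is the identity matrix at `ρ = 0`. -/
def assocN (f ν : Coord 2 → E4) (lam : E4 → ℝ) (i j : Fin 2) (c : Coord 4) : ℝ :=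
  !![assocP f ν lam 1 1 c ^ 2 + assocP f ν lam 0 1 c ^ 2,
      -(assocP f ν lam 0 1 c * (assocP f ν lam 0 0 c + assocP f ν lam 1 1 c));
    -(assocP f ν lam 0 1 c * (assocP f ν lam 0 0 c + assocP f ν lam 1 1 c)),
      assocP f ν lam 0 0 c ^ 2 + assocP f ν lam 0 1 c ^ 2] i j
    / (moebiusFactor f ν (baseCoord c) * assocQ f ν lam c)

/-- `α N (β₀, β₁)`. -/
def assocX (f ν : Coord 2 → E4) (lam : E4 → ℝ) (β : Fin 2 → Coord 4 → ℝ) (i : Fin 2)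
    (c : Coord 4) : ℝ :=
  c 0 * (assocN f ν lam i 0 c * β 0 c + assocN f ν lam i 1 c * β 1 c)

/-- The derivatives of `F` in the directions `∂_i + α ω_i ∂_α - 2 ρ ω_i ∂_ρ`. -/
def assocD (f ν : Coord 2 → E4) (lam : E4 → ℝ) (F : Coord 4 → ℝ) (i : Fin 2) (c : Coord 4) : ℝ :=
  pd (![2, 3] i) F c + c 0 * omegaForm f ν lam i (baseCoord c) * pd 0 F c
    - 2 * c 1 * omegaForm f ν lam i (baseCoord c) * pd 1 F c

/-- `ω(X)`. -/
def omegaX (f ν : Coord 2 → E4) (lam : E4 → ℝ) (X : Fin 2 → Coord 4 → ℝ) (c : Coord 4) : ℝ :=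
  omegaForm f ν lam 0 (baseCoord c) * X 0 c + omegaForm f ν lam 1 (baseCoord c) * X 1 c

/-- The vector density `|g|^{1/2} ∇F` of the associate surface. -/
def assocFlux (f ν : Coord 2 → E4) (lam : E4 → ℝ) (F : Coord 4 → ℝ) (A : Fin 4) (c : Coord 4) :
    ℝ :=
  ![-(c 0 ^ 2 * assocQ f ν lam c * pd 1 F c)
        + c 0 * omegaX f ν lam (assocX f ν lam (assocD f ν lam F)) c,
    -(c 0 ^ 2 * assocQ f ν lam c * pd 0 F c) + c 1 * (2 * c 0 * assocQ f ν lam c * pd 1 F c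
        - 2 * omegaX f ν lam (assocX f ν lam (assocD f ν lam F)) c),
    assocX f ν lam (assocD f ν lam F) 0 c, assocX f ν lam (assocD f ν lam F) 1 c] A

namespace IsoPatch

variable {U : Set (Coord 2)} {f ν : Coord 2 → E4} {lam : E4 → ℝ} {u : Coord 2} {c : Coord 4}

theorem smooth_OmegaT (h : IsoPatch U f ν) (hl : IsConformalFactor lam) (hu : u ∈ U)
    (i j : Fin 2) : ContDiffAt ℝ ∞ (OmegaT f ν lam i j) u :=
  (contDiffAt_lor (contDiffAt_pd (h.smooth_gaussMap hu) i)
    (contDiffAt_pd (h.smooth_yLam hl hu) j)).neg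

theorem smooth_OmegaStar (h : IsoPatch U f ν) (hl : IsConformalFactor lam) (hu : u ∈ U)
    (i j : Fin 2) : ContDiffAt ℝ ∞ (OmegaStar f ν lam i j) u :=
  (contDiffAt_lor (contDiffAt_pd (h.smooth_gaussMap hu) i)
    (contDiffAt_pd (h.smooth_yStar hl hu) j)).neg

theorem smooth_omegaForm (h : IsoPatch U f ν) (hl : IsConformalFactor lam) (hu : u ∈ U)
    (i : Fin 2) : ContDiffAt ℝ ∞ (omegaForm f ν lam i) u :=
  contDiffAt_lor (contDiffAt_pd (h.smooth_yLam hl hu) i) (h.smooth_yStar hl hu)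

theorem smooth_scriptH (h : IsoPatch U f ν) (hl : IsConformalFactor lam) (hu : u ∈ U) :
    ContDiffAt ℝ ∞ (scriptH f ν lam) u :=
  ContDiffAt.congr_of_eventuallyEq
    ((((h.smooth_OmegaStar hl hu 0 0).add (h.smooth_OmegaStar hl hu 1 1)).neg).div
      (h.smooth_confE hl hu) (h.confE_pos hl hu).ne')
    (Filter.eventuallyEq_of_mem (h.isOpen.mem_nhds hu) fun _ hb => h.scriptH_eq hl hb)

theorem smooth_assocP (h : IsoPatch U f ν) (hl : IsConformalFactor lam) (hc : baseCoord c ∈ U)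
    (i j : Fin 2) : ContDiffAt ℝ ∞ (assocP f ν lam i j) c :=
  (contDiffAt_base (h.smooth_OmegaT hl hc i j)).add
    ((contDiffAt_coord 1 c).mul (contDiffAt_base (h.smooth_OmegaStar hl hc i j)))

theorem smooth_assocQ (h : IsoPatch U f ν) (hl : IsConformalFactor lam) (hc : baseCoord c ∈ U) :
    ContDiffAt ℝ ∞ (assocQ f ν lam) c :=
  (((h.smooth_assocP hl hc 0 1).pow 2).sub
    ((h.smooth_assocP hl hc 0 0).mul (h.smooth_assocP hl hc 1 1))).div
    (contDiffAt_base (h.smooth_moebiusFactor hc)) (h.moebiusFactor_pos hc).ne'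

theorem isOpen_assocDom (h : IsoPatch U f ν) (hl : IsConformalFactor lam) :
    IsOpen (assocDom f ν lam U) := by
  have h1 : IsOpen {c : Coord 4 | baseCoord c ∈ U} :=
    h.isOpen.preimage contDiff_baseCoord.continuous
  have h2 : IsOpen {c : Coord 4 | 0 < c 0} :=
    isOpen_lt continuous_const (contDiff_iff_contDiffAt.mpr fun c => contDiffAt_coord 0 c).continuous
  have h3 : ContinuousOn (assocQ f ν lam) {c : Coord 4 | baseCoord c ∈ U} :=
    fun c hc => (h.smooth_assocQ hl hc).continuousAt.continuousWithinAt
  exact h2.inter (h3.isOpen_inter_preimage h1 isOpen_Ioi)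

theorem moebiusFactor_mul_assocQ (h : IsoPatch U f ν) (hc : baseCoord c ∈ U) :
    moebiusFactor f ν (baseCoord c) * assocQ f ν lam c
      = assocP f ν lam 0 1 c ^ 2 - assocP f ν lam 0 0 c * assocP f ν lam 1 1 c := by
  rw [assocQ, mul_div_cancel₀ _ (h.moebiusFactor_pos hc).ne']

theorem smooth_assocN (h : IsoPatch U f ν) (hl : IsConformalFactor lam)
    (hc : c ∈ assocDom f ν lam U) (i j : Fin 2) : ContDiffAt ℝ ∞ (assocN f ν lam i j) c := by
  have hP := h.smooth_assocP hl hc.2.1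
  have hmQ := (contDiffAt_base (h.smooth_moebiusFactor hc.2.1)).mul (h.smooth_assocQ hl hc.2.1)
  have h0 : moebiusFactor f ν (baseCoord c) * assocQ f ν lam c ≠ 0 :=
    (mul_pos (h.moebiusFactor_pos hc.2.1) hc.2.2).ne'
  refine ContDiffAt.div ?_ hmQ h0
  fin_cases i <;> fin_cases j
  · exact ((hP 1 1).pow 2).add ((hP 0 1).pow 2)
  · exact ((hP 0 1).mul ((hP 0 0).add (hP 1 1))).neg
  · exact ((hP 0 1).mul ((hP 0 0).add (hP 1 1))).neg
  · exact ((hP 0 0).pow 2).add ((hP 0 1).pow 2)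

theorem smooth_assocX (h : IsoPatch U f ν) (hl : IsConformalFactor lam)
    (hc : c ∈ assocDom f ν lam U) {β : Fin 2 → Coord 4 → ℝ} (hβ : ∀ i, ContDiffAt ℝ ∞ (β i) c)
    (i : Fin 2) : ContDiffAt ℝ ∞ (assocX f ν lam β i) c :=
  (contDiffAt_coord 0 c).mul (((h.smooth_assocN hl hc i 0).mul (hβ 0)).add
    ((h.smooth_assocN hl hc i 1).mul (hβ 1)))

theorem smooth_omegaBase (h : IsoPatch U f ν) (hl : IsConformalFactor lam)
    (hc : baseCoord c ∈ U) (i : Fin 2) :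
    ContDiffAt ℝ ∞ (fun b => omegaForm f ν lam i (baseCoord b)) c :=
  contDiffAt_base (h.smooth_omegaForm hl hc i)

theorem smooth_assocD (h : IsoPatch U f ν) (hl : IsConformalFactor lam)
    (hc : baseCoord c ∈ U) {F : Coord 4 → ℝ} (hF : ContDiffAt ℝ ∞ F c) (i : Fin 2) :
    ContDiffAt ℝ ∞ (assocD f ν lam F i) c :=
  ((contDiffAt_pd hF _).add (((contDiffAt_coord 0 c).mul (h.smooth_omegaBase hl hc i)).mul
    (contDiffAt_pd hF 0))).sub (((contDiffAt_const.mul (contDiffAt_coord 1 c)).mul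
      (h.smooth_omegaBase hl hc i)).mul (contDiffAt_pd hF 1))

theorem smooth_omegaX (h : IsoPatch U f ν) (hl : IsConformalFactor lam)
    (hc : baseCoord c ∈ U) {X : Fin 2 → Coord 4 → ℝ} (hX : ∀ i, ContDiffAt ℝ ∞ (X i) c) :
    ContDiffAt ℝ ∞ (omegaX f ν lam X) c :=
  ((h.smooth_omegaBase hl hc 0).mul (hX 0)).add ((h.smooth_omegaBase hl hc 1).mul (hX 1))

theorem smooth_assocFlux (h : IsoPatch U f ν) (hl : IsConformalFactor lam)
    (hc : c ∈ assocDom f ν lam U) {F : Coord 4 → ℝ} (hF : ContDiffAt ℝ ∞ F c) (A : Fin 4) :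
    ContDiffAt ℝ ∞ (assocFlux f ν lam F A) c := by
  have hX := h.smooth_assocX hl hc (h.smooth_assocD hl hc.2.1 hF)
  have hw := h.smooth_omegaX hl hc.2.1 hX
  have hQ := h.smooth_assocQ hl hc.2.1
  have a0 := contDiffAt_coord 0 c
  have a1 := contDiffAt_coord 1 c
  fin_cases A
  · exact (((a0.pow 2).mul hQ).mul (contDiffAt_pd hF 1)).neg.add (a0.mul hw)
  · exact (((a0.pow 2).mul hQ).mul (contDiffAt_pd hF 0)).neg.add (a1.mul
      ((((contDiffAt_const.mul a0).mul hQ).mul (contDiffAt_pd hF 1)).sub (contDiffAt_const.mul hw)))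
  · exact hX 0
  · exact hX 1

theorem assocP_det_ne (h : IsoPatch U f ν) (hc : c ∈ assocDom f ν lam U) :
    assocP f ν lam 0 0 c * assocP f ν lam 1 1 c - assocP f ν lam 0 1 c ^ 2 ≠ 0 := by
  have e := h.moebiusFactor_mul_assocQ (lam := lam) hc.2.1
  have := mul_pos (h.moebiusFactor_pos hc.2.1) hc.2.2
  intro h0
  linarith

theorem assocI_inv (h : IsoPatch U f ν) (hl : IsConformalFactor lam)
    (hc : c ∈ assocDom f ν lam U) :
    (assocI f ν lam c)⁻¹ = coneMetricInv (c 0) (c 1) (omegaForm f ν lam 0 (baseCoord c))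
      (omegaForm f ν lam 1 (baseCoord c)) (moebiusFactor f ν (baseCoord c))
      (assocN f ν lam 0 0 c / (moebiusFactor f ν (baseCoord c) * assocQ f ν lam c))
      (assocN f ν lam 0 1 c / (moebiusFactor f ν (baseCoord c) * assocQ f ν lam c))
      (assocN f ν lam 1 1 c / (moebiusFactor f ν (baseCoord c) * assocQ f ν lam c)) := by
  rw [h.assocI_eq hl hc.2.1, coneMetric_inv hc.1.ne' (h.moebiusFactor_pos hc.2.1).ne'
    (h.assocP_det_ne hc)]
  -- Since det P = −mQ, the matrix K = adj(P)²/(det P)² is N/(mQ).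
  have e : (assocP f ν lam 0 0 c * assocP f ν lam 1 1 c - assocP f ν lam 0 1 c ^ 2) ^ 2
      = (moebiusFactor f ν (baseCoord c) * assocQ f ν lam c)
        * (moebiusFactor f ν (baseCoord c) * assocQ f ν lam c) := by
    rw [h.moebiusFactor_mul_assocQ hc.2.1]; ring
  rw [e]
  simp [assocN, div_div]

theorem sqrt_abs_det_assocI (h : IsoPatch U f ν) (hl : IsConformalFactor lam)
    (hc : c ∈ assocDom f ν lam U) :
    Real.sqrt |(assocI f ν lam c).det| = c 0 ^ 3 * assocQ f ν lam c := by
  have hm := (h.moebiusFactor_pos hc.2.1).ne'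
  have e : (assocI f ν lam c).det = -(c 0 ^ 3 * assocQ f ν lam c) ^ 2 := by
    rw [h.assocI_eq hl hc.2.1, coneMetric_det, assocQ]
    field_simp
    ring
  rw [e, abs_neg, abs_sq, Real.sqrt_sq (mul_pos (pow_pos hc.1 3) hc.2.2).le]

theorem det_assocI_ne (h : IsoPatch U f ν) (hl : IsConformalFactor lam)
    (hc : c ∈ assocDom f ν lam U) : (assocI f ν lam c).det ≠ 0 := by
  rw [h.assocI_eq hl hc.2.1, coneMetric_det]
  have := h.assocP_det_ne hc
  have := hc.1.ne'
  have := (h.moebiusFactor_pos hc.2.1).ne'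
  simp only [ne_eq, neg_eq_zero, mul_eq_zero, pow_eq_zero_iff, inv_eq_zero, OfNat.ofNat_ne_zero,
    not_false_eq_true]
  tauto

/-- The entries of the inverse metric that contain ω combine the coordinate derivatives into the
fields D_i = ∂_i + αω_i∂_α − 2ρω_i∂_ρ. What remains is the block N in the u-directions and an
off-diagonal pairing of ∂_α with ∂_ρ. -/
theorem sum_flux (h : IsoPatch U f ν) (hl : IsConformalFactor lam)
    (hc : c ∈ assocDom f ν lam U) (F : Coord 4 → ℝ) (A : Fin 4) :
    ∑ B, Real.sqrt |(assocI f ν lam c).det| * (assocI f ν lam c)⁻¹ A B * pd B F c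
      = assocFlux f ν lam F A c := by
  have h10 : assocN f ν lam 1 0 c = assocN f ν lam 0 1 c := by simp [assocN]
  have hm := (h.moebiusFactor_pos hc.2.1).ne'
  have hQ := hc.2.2.ne'
  have ha := hc.1.ne'
  rw [h.sqrt_abs_det_assocI hl hc, h.assocI_inv hl hc, Fin.sum_univ_four]
  fin_cases A <;>
    simp only [coneMetricInv, assocFlux, omegaX, assocX, assocD, h10, Matrix.of_apply,
      Matrix.cons_val', Matrix.cons_val, Fin.zero_eta, Fin.mk_one, Fin.reduceFinMk,
      Fin.isValue] <;> field_simp <;> ring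

/-- The trace is m tr(P⁻¹)/α = −tr P/(αQ), and tr P = ρ tr Ω* = −ρE𝓗 because Ω is traceless.
Exhibiting the factor ρ for all small ρ allows later differentiation in ρ. -/
theorem assocH_eq (h : IsoPatch U f ν) (hl : IsConformalFactor lam)
    (hc : c ∈ assocDom f ν lam U) :
    assocH f ν lam c = c 1 * ((c 0)⁻¹ * (assocQ f ν lam c)⁻¹
      * (confE f lam (baseCoord c) * scriptH f ν lam (baseCoord c))) := by
  have hm := (h.moebiusFactor_pos hc.2.1).ne'
  have hQ := hc.2.2.ne'
  have ha := hc.1.ne'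
  have hE := (h.confE_pos hl hc.2.1).ne'
  have e := h.moebiusFactor_mul_assocQ (lam := lam) hc.2.1
  have t : confE f lam (baseCoord c) * scriptH f ν lam (baseCoord c) * c 1
      = -(assocP f ν lam 0 0 c + assocP f ν lam 1 1 c) := by
    rw [h.scriptH_eq hl hc.2.1, assocP, assocP]
    field_simp
    linear_combination h.OmegaT_trace hl hc.2.1
  rw [assocH, h.assocI_inv hl hc, h.assocII_eq hl hc.2.1, Matrix.trace, Fin.sum_univ_four]
  simp only [Matrix.diag_apply, Matrix.mul_apply, Fin.sum_univ_four, coneMetricInv,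
    Matrix.of_apply, Matrix.cons_val', Matrix.cons_val, assocN, Fin.isValue]
  have t' : c 1 * ((c 0)⁻¹ * (assocQ f ν lam c)⁻¹
      * (confE f lam (baseCoord c) * scriptH f ν lam (baseCoord c)))
      = -(assocP f ν lam 0 0 c + assocP f ν lam 1 1 c) * ((c 0)⁻¹ * (assocQ f ν lam c)⁻¹) := by
    rw [← t]; ring
  rw [t']
  clear t t'
  generalize assocP f ν lam 0 0 c = p at *
  generalize assocP f ν lam 0 1 c = q at *
  generalize assocP f ν lam 1 1 c = s at *
  generalize assocQ f ν lam c = Q at *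
  generalize moebiusFactor f ν (baseCoord c) = m at *
  field_simp
  linear_combination c 0 * (p + s) * e

/-- The Laplacian of the associate surface in divergence form. -/
theorem assocLaplace_eq (h : IsoPatch U f ν) (hl : IsConformalFactor lam)
    (hc : c ∈ assocDom f ν lam U) {F : Coord 4 → ℝ} (hF : ContDiffAt ℝ ∞ F c) :
    assocLaplace f ν lam F c
      = (c 0 ^ 3 * assocQ f ν lam c)⁻¹ * ∑ A, pd A (assocFlux f ν lam F A) c := by
  have hD := h.isOpen_assocDom hl
  have hs : ContDiffAt ℝ ∞ (fun b => Real.sqrt |(assocI f ν lam b).det|) c :=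
    ContDiffAt.congr_of_eventuallyEq (f := fun b => b 0 ^ 3 * assocQ f ν lam b)
      (((contDiffAt_coord 0 c).pow 3).mul (h.smooth_assocQ hl hc.2.1))
      (Filter.eventuallyEq_of_mem (hD.mem_nhds hc) fun b hb => h.sqrt_abs_det_assocI hl hb)
  have hy : ContDiffAt ℝ ∞ (assoc f ν lam) c :=
    ((contDiffAt_coord 0 c).smul (contDiffAt_base (h.smooth_yLam hl hc.2.1))).add
      (((contDiffAt_coord 0 c).mul (contDiffAt_coord 1 c)).smul
        (contDiffAt_base (h.smooth_yStar hl hc.2.1)))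
  have hi : ∀ A B, ContDiffAt ℝ ∞ (fun b => (assocI f ν lam b)⁻¹ A B) c :=
    contDiffAt_matrix_inv (fun i j => contDiffAt_lor (contDiffAt_pd hy i) (contDiffAt_pd hy j))
      (h.det_assocI_ne hl hc)
  rw [assocLaplace, laplaceBeltrami, h.sqrt_abs_det_assocI hl hc]
  congr 1
  refine Finset.sum_congr rfl fun A _ => ?_
  rw [← pd_sum _ fun B _ => (hs.mul (hi A B)).mul (contDiffAt_pd hF B)]
  exact pd_congr_of_isOpen hD (fun b hb => h.sum_flux hl hb F A) A hc

end IsoPatch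

end AssocSurface

end

/-! ### Restriction to ρ = 0 -/

noncomputable section

namespace AssocSurface

/-- The covariant derivative `ds - 3 s ω` of a density `s` of weight `-3`. -/
def weightedGrad (f ν : Coord 2 → E4) (lam : E4 → ℝ) (s : Coord 2 → ℝ) (i : Fin 2)
    (u : Coord 2) : ℝ :=
  pd i s u - 3 * omegaForm f ν lam i u * s u

/-- `ω(X)` for a 1-form on the surface. -/
def omegaDot (f ν : Coord 2 → E4) (lam : E4 → ℝ) (X : Fin 2 → Coord 2 → ℝ) (u : Coord 2) : ℝ :=
  omegaForm f ν lam 0 u * X 0 u + omegaForm f ν lam 1 u * X 1 u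

/-- `tr(Ω Ω*) / m`. -/
def traceOmega (f ν : Coord 2 → E4) (lam : E4 → ℝ) (u : Coord 2) : ℝ :=
  (OmegaT f ν lam 0 0 u * OmegaStar f ν lam 0 0 u + OmegaT f ν lam 0 1 u * OmegaStar f ν lam 1 0 u
    + OmegaT f ν lam 1 0 u * OmegaStar f ν lam 0 1 u
    + OmegaT f ν lam 1 1 u * OmegaStar f ν lam 1 1 u) / moebiusFactor f ν u

/-- `∑ (∂_i - 3 ω_i)(∂_i - 3 ω_i) s`. -/
def weightedLaplace (f ν : Coord 2 → E4) (lam : E4 → ℝ) (s : Coord 2 → ℝ) (u : Coord 2) : ℝ :=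
  pd 0 (weightedGrad f ν lam s 0) u + pd 1 (weightedGrad f ν lam s 1) u
    - 3 * omegaDot f ν lam (weightedGrad f ν lam s) u

namespace IsoPatch

variable {U : Set (Coord 2)} {f ν : Coord 2 → E4} {lam : E4 → ℝ} {u : Coord 2} {c : Coord 4}

theorem smooth_weightedGrad (h : IsoPatch U f ν) (hl : IsConformalFactor lam) (hu : u ∈ U)
    {s : Coord 2 → ℝ} (hs : ContDiffAt ℝ ∞ s u) (i : Fin 2) :
    ContDiffAt ℝ ∞ (weightedGrad f ν lam s i) u :=
  (contDiffAt_pd hs i).sub ((contDiffAt_const.mul (h.smooth_omegaForm hl hu i)).mul hs)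

theorem smooth_omegaDot (h : IsoPatch U f ν) (hl : IsConformalFactor lam) (hu : u ∈ U)
    {X : Fin 2 → Coord 2 → ℝ} (hX : ∀ i, ContDiffAt ℝ ∞ (X i) u) :
    ContDiffAt ℝ ∞ (omegaDot f ν lam X) u :=
  ((h.smooth_omegaForm hl hu 0).mul (hX 0)).add ((h.smooth_omegaForm hl hu 1).mul (hX 1))

theorem assocP_slice (h1 : c 1 = 0) (i j : Fin 2) :
    assocP f ν lam i j c = OmegaT f ν lam i j (baseCoord c) := by
  rw [assocP, h1, zero_mul, add_zero]

theorem assocQ_slice (h : IsoPatch U f ν) (hl : IsConformalFactor lam) (hc : baseCoord c ∈ U)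
    (h1 : c 1 = 0) : assocQ f ν lam c = confE f lam (baseCoord c) := by
  rw [assocQ, assocP_slice h1, assocP_slice h1, assocP_slice h1, h.OmegaT_one_one hl hc,
    div_eq_iff (h.moebiusFactor_pos hc).ne', h.confE_mul_moebiusFactor hl hc]
  ring

theorem mem_assocDom (h : IsoPatch U f ν) (hl : IsConformalFactor lam) (h0 : 0 < c 0)
    (h1 : c 1 = 0) (hc : baseCoord c ∈ U) : c ∈ assocDom f ν lam U :=
  ⟨h0, hc, by rw [h.assocQ_slice hl hc h1]; exact h.confE_pos hl hc⟩

/-- At ρ = 0 the matrix N is the identity: adj(Ω)² is the scalar matrix Ω_00² + Ω_01² = mE, and Q =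
E. -/
theorem assocX_slice (h : IsoPatch U f ν) (hl : IsConformalFactor lam) (hc : baseCoord c ∈ U)
    (h1 : c 1 = 0) (β : Fin 2 → Coord 4 → ℝ) (i : Fin 2) :
    assocX f ν lam β i c = c 0 * β i c := by
  have hm := (h.moebiusFactor_pos hc).ne'
  have hE := (h.confE_pos hl hc).ne'
  have e := h.confE_mul_moebiusFactor hl hc
  have n01 : ∀ x : ℝ, -(x * (OmegaT f ν lam 0 0 (baseCoord c)
      + -OmegaT f ν lam 0 0 (baseCoord c))) = 0 := by intro x; ring
  have key : ∀ x y : ℝ, confE f lam (baseCoord c) * moebiusFactor f ν (baseCoord c) = x →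
      x / (moebiusFactor f ν (baseCoord c) * confE f lam (baseCoord c)) * y = y := by
    rintro x y rfl
    field_simp
  simp only [assocX, assocN, h.assocQ_slice hl hc h1, assocP_slice h1, h.OmegaT_one_one hl hc, n01]
  congr 1
  fin_cases i
  · simp only [Fin.zero_eta, Matrix.of_apply, Matrix.cons_val', Matrix.cons_val, Fin.isValue,
      zero_div, zero_mul, add_zero]
    exact key _ _ (by rw [e]; ring)
  · simp only [Fin.mk_one, Matrix.of_apply, Matrix.cons_val', Matrix.cons_val, Fin.isValue,
      zero_div, zero_mul, zero_add]
    exact key _ _ (by rw [e])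

theorem pd_assocP (h : IsoPatch U f ν) (hl : IsConformalFactor lam) (hc : baseCoord c ∈ U)
    (i j : Fin 2) : pd 0 (assocP f ν lam i j) c = 0 ∧
      pd 1 (assocP f ν lam i j) c = OmegaStar f ν lam i j (baseCoord c) := by
  have s1 := contDiffAt_base (h.smooth_OmegaT hl hc i j)
  have s2 := contDiffAt_base (h.smooth_OmegaStar hl hc i j)
  have s3 : ContDiffAt ℝ ∞ (fun b : Coord 4 => b 1 * OmegaStar f ν lam i j (baseCoord b)) c :=
    (contDiffAt_coord 1 c).mul s2
  have e := pd_add s1 s3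
  simp only [pd_mul (contDiffAt_coord 1 c) s2, pd_base (h.smooth_OmegaT hl hc i j),
    pd_base (h.smooth_OmegaStar hl hc i j), pd_coord] at e
  exact ⟨(e 0).trans (by simp), (e 1).trans (by simp)⟩

theorem pd_assocQ (h : IsoPatch U f ν) (hl : IsConformalFactor lam) (hc : baseCoord c ∈ U)
    {A : Fin 4} (hA : pd A (fun b => moebiusFactor f ν (baseCoord b)) c = 0) :
    pd A (assocQ f ν lam) c = (2 * assocP f ν lam 0 1 c * pd A (assocP f ν lam 0 1) c
      - assocP f ν lam 0 0 c * pd A (assocP f ν lam 1 1) c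
      - pd A (assocP f ν lam 0 0) c * assocP f ν lam 1 1 c) / moebiusFactor f ν (baseCoord c) := by
  have hP := h.smooth_assocP hl hc
  have hm := contDiffAt_base (h.smooth_moebiusFactor hc)
  have hm0 := (h.moebiusFactor_pos hc).ne'
  have s1 := (hP 0 1).mul (hP 0 1)
  have s2 := (hP 0 0).mul (hP 1 1)
  have e : assocQ f ν lam = fun b => (assocP f ν lam 0 1 b * assocP f ν lam 0 1 b
      - assocP f ν lam 0 0 b * assocP f ν lam 1 1 b) * (moebiusFactor f ν (baseCoord b))⁻¹ := by
    funext b; rw [assocQ, sq, div_eq_mul_inv]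
  have s3 : ContDiffAt ℝ ∞ (fun b => assocP f ν lam 0 1 b * assocP f ν lam 0 1 b
      - assocP f ν lam 0 0 b * assocP f ν lam 1 1 b) c := s1.sub s2
  have s4 : ContDiffAt ℝ ∞ (fun b => (moebiusFactor f ν (baseCoord b))⁻¹) c := hm.inv hm0
  rw [e, pd_mul s3 s4, pd_sub s1 s2, pd_mul (hP 0 1) (hP 0 1), pd_mul (hP 0 0) (hP 1 1),
    pd_inv hm hm0, hA]
  field_simp
  ring

/-- The derivative of −det P is −tr(adj(P)Ω*), and at ρ = 0 the adjugate of the traceless matrix Ω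
is −Ω. -/
theorem pd_assocQ_slice (h : IsoPatch U f ν) (hl : IsConformalFactor lam) (hc : baseCoord c ∈ U)
    (h1 : c 1 = 0) : pd 1 (assocQ f ν lam) c = traceOmega f ν lam (baseCoord c) := by
  have dP := fun i j => (h.pd_assocP hl hc i j).2
  rw [h.pd_assocQ hl hc (by rw [pd_base (h.smooth_moebiusFactor hc)]; simp), dP, dP, dP]
  simp only [assocP_slice h1, traceOmega, h.OmegaT_one_one hl hc, h.OmegaT_symm hl hc 1 0,
    h.OmegaStar_symm hl hc 1 0]
  ring

theorem pd_zero_assocQ (h : IsoPatch U f ν) (hl : IsConformalFactor lam) (hc : baseCoord c ∈ U) :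
    pd 0 (assocQ f ν lam) c = 0 := by
  have dP := fun i j => (h.pd_assocP hl hc i j).1
  rw [h.pd_assocQ hl hc (by rw [pd_base (h.smooth_moebiusFactor hc)]; simp), dP, dP, dP]
  simp

theorem contDiffAt_zpow {a : ℝ} (ha : a ≠ 0) (n : ℤ) : ContDiffAt ℝ ∞ (fun x : ℝ => x ^ n) a := by
  cases n with
  | ofNat n => simpa using (contDiffAt_id (𝕜 := ℝ) (n := ∞) (x := a)).pow n
  | negSucc n =>
    have e : (fun x : ℝ => x ^ (Int.negSucc n)) = (fun x : ℝ => x ^ (n + 1))⁻¹ := by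
      funext x; simp [zpow_negSucc]
    rw [e]
    exact ((contDiffAt_id (𝕜 := ℝ) (n := ∞) (x := a)).pow (n + 1)).inv (pow_ne_zero _ ha)

/-- The derivatives at `ρ = 0` of a function that is `αⁿ s` there. -/
theorem pd_of_slice (h : IsoPatch U f ν) (hl : IsConformalFactor lam) {G : Coord 4 → ℝ} {n : ℤ}
    {s : Coord 2 → ℝ} (hG : ∀ b ∈ assocDom f ν lam U, ContDiffAt ℝ ∞ G b)
    (hs : ∀ u ∈ U, ContDiffAt ℝ ∞ s u)
    (hGs : ∀ b ∈ assocDom f ν lam U, b 1 = 0 → G b = b 0 ^ n * s (baseCoord b))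
    (hc : c ∈ assocDom f ν lam U) (h1 : c 1 = 0) :
    pd 0 G c = n * c 0 ^ (n - 1) * s (baseCoord c) ∧
      pd 2 G c = c 0 ^ n * pd 0 s (baseCoord c) ∧ pd 3 G c = c 0 ^ n * pd 1 s (baseCoord c) := by
  have hk := contDiffAt_zpow hc.1.ne' n
  have e := fun i (hi : i ≠ 1) => (pd_congr_slice (h.isOpen_assocDom hl) hc h1 (hG c hc)
    (contDiffAt_separated (k := fun x => x ^ n) hk (hs _ hc.2.1)) hGs hi).trans
    (pd_separated (k := fun x => x ^ n) hk (hs _ hc.2.1) i)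
  refine ⟨(e 0 (by decide)).trans ?_, (e 2 (by decide)).trans ?_, (e 3 (by decide)).trans ?_⟩ <;>
    simp [deriv_zpow]

/-- The Laplacian at `ρ = 0` of a function `F` with `F = α⁻³ w` and `∂F/∂ρ = α⁻³ z` there. -/
theorem assocLaplace_slice (h : IsoPatch U f ν) (hl : IsConformalFactor lam) {F : Coord 4 → ℝ}
    {w z : Coord 2 → ℝ} (hF : ∀ b ∈ assocDom f ν lam U, ContDiffAt ℝ ∞ F b)
    (hw : ∀ u ∈ U, ContDiffAt ℝ ∞ w u) (hz : ∀ u ∈ U, ContDiffAt ℝ ∞ z u)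
    (hFw : ∀ b ∈ assocDom f ν lam U, b 1 = 0 → F b = b 0 ^ (-3 : ℤ) * w (baseCoord b))
    (hFz : ∀ b ∈ assocDom f ν lam U, b 1 = 0 → pd 1 F b = b 0 ^ (-3 : ℤ) * z (baseCoord b))
    (hc : c ∈ assocDom f ν lam U) (h1 : c 1 = 0) :
    assocLaplace f ν lam F c = (c 0 ^ 5)⁻¹ * (confE f lam (baseCoord c))⁻¹ *
      (6 * confE f lam (baseCoord c) * z (baseCoord c)
        + 3 * traceOmega f ν lam (baseCoord c) * w (baseCoord c)
        + weightedLaplace f ν lam w (baseCoord c)) := by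
  have hX := fun b (hb : b ∈ assocDom f ν lam U) =>
    h.smooth_assocX hl hb (h.smooth_assocD hl hb.2.1 (hF b hb))
  have hg := fun u (hu : u ∈ U) => h.smooth_weightedGrad hl hu (hw u hu)
  -- The α-homogeneity −3 of F turns αω_i∂_α into −3ω_i. This is the origin of the weighted
  -- gradient.
  have Xs : ∀ i, ∀ b ∈ assocDom f ν lam U, b 1 = 0 →
      assocX f ν lam (assocD f ν lam F) i b
        = b 0 ^ (-2 : ℤ) * weightedGrad f ν lam w i (baseCoord b) := by
    intro i b hb hb1
    obtain ⟨e0, e2, e3⟩ := h.pd_of_slice hl hF hw hFw hb hb1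
    have hb0 := hb.1.ne'
    rw [h.assocX_slice hl hb.2.1 hb1, assocD, hb1, weightedGrad, e0]
    fin_cases i <;> simp [e2, e3] <;> field_simp <;> ring
  have f0 : ∀ b ∈ assocDom f ν lam U, b 1 = 0 → assocFlux f ν lam F 0 b
      = b 0 ^ (-1 : ℤ) * (-(confE f lam (baseCoord b) * z (baseCoord b))
        + omegaDot f ν lam (weightedGrad f ν lam w) (baseCoord b)) := by
    intro b hb hb1
    have hb0 := hb.1.ne'
    simp only [assocFlux, omegaX, Matrix.cons_val, Xs _ b hb hb1, hFz b hb hb1,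
      h.assocQ_slice hl hb.2.1 hb1, omegaDot]
    field_simp
  have hs0 : ∀ u ∈ U, ContDiffAt ℝ ∞ (fun u => -(confE f lam u * z u)
        + omegaDot f ν lam (weightedGrad f ν lam w) u) u := fun u hu =>
    (((h.smooth_confE hl hu).mul (hz u hu)).neg).add (h.smooth_omegaDot hl hu (hg u hu))
  have D0 := (h.pd_of_slice hl (fun b hb => h.smooth_assocFlux hl hb (hF b hb) 0) hs0 f0 hc h1).1
  have D2 := (h.pd_of_slice hl (fun b hb => hX b hb 0) (fun u hu => hg u hu 0) (Xs 0) hc h1).2.1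
  have D3 := (h.pd_of_slice hl (fun b hb => hX b hb 1) (fun u hu => hg u hu 1) (Xs 1) hc h1).2.2
  have E0 := (h.pd_of_slice hl hF hw hFw hc h1).1
  have E10 := (h.pd_of_slice hl (fun b hb => contDiffAt_pd (hF b hb) 1) hz hFz hc h1).1
  -- The part of the flux with explicit factor ρ contributes just its coefficient. In the other part
  -- ∂_ρQ = q, and ∂_ρ∂_αF is rewritten as ∂_α∂_ρF, which is determined by the known values of ∂_ρF
  -- on the slice.
  have D1 : pd 1 (assocFlux f ν lam F 1) c
      = -(c 0 ^ 2 * (traceOmega f ν lam (baseCoord c) * pd 0 F c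
          + confE f lam (baseCoord c) * pd 0 (pd 1 F) c))
        + (2 * c 0 * confE f lam (baseCoord c) * pd 1 F c
          - 2 * omegaX f ν lam (assocX f ν lam (assocD f ν lam F)) c) := by
    have a0 := contDiffAt_coord 0 c
    have a1 := contDiffAt_coord 1 c
    have hQ := h.smooth_assocQ hl hc.2.1
    have p0 := contDiffAt_pd (hF c hc) 0
    have p1 := contDiffAt_pd (hF c hc) 1
    have r1 : ContDiffAt ℝ ∞ (fun b : Coord 4 => b 0 ^ 2 * assocQ f ν lam b) c := (a0.pow 2).mul hQ
    have r2 : ContDiffAt ℝ ∞ (fun b : Coord 4 => b 0 ^ 2) c := a0.pow 2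
    have r3 : ContDiffAt ℝ ∞ (fun b : Coord 4 => 2 * b 0 * assocQ f ν lam b * pd 1 F b
        - 2 * omegaX f ν lam (assocX f ν lam (assocD f ν lam F)) b) c :=
      (((contDiffAt_const.mul a0).mul hQ).mul p1).sub
        (contDiffAt_const.mul (h.smooth_omegaX hl hc.2.1 (hX c hc)))
    have r4 : ContDiffAt ℝ ∞ (fun b : Coord 4 => -(b 0 ^ 2 * assocQ f ν lam b * pd 0 F b)) c :=
      (r1.mul p0).neg
    have r5 : ContDiffAt ℝ ∞ (fun b : Coord 4 => b 1 * (2 * b 0 * assocQ f ν lam b * pd 1 F b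
        - 2 * omegaX f ν lam (assocX f ν lam (assocD f ν lam F)) b)) c := a1.mul r3
    have hsq : pd 1 (fun b : Coord 4 => b 0 ^ 2) c = 0 := by
      rw [pd_real_comp (φ := fun x => x ^ 2) (by fun_prop) a0, pd_coord]; simp
    have e := pd_add r4 r5 1
    rw [pd_neg, pd_mul r1 p0, pd_mul r2 hQ, pd_mul a1 r3, hsq, pd_coord, h1,
      h.assocQ_slice hl hc.2.1 h1, h.pd_assocQ_slice hl hc.2.1 h1, pd_comm (hF c hc) 1 0] at e
    refine e.trans ?_
    simp only [if_true]
    ring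
  have hc0 := hc.1.ne'
  have hE := (h.confE_pos hl hc.2.1).ne'
  have F2 : pd 2 (assocFlux f ν lam F 2) c = pd 2 (assocX f ν lam (assocD f ν lam F) 0) c := rfl
  have F3 : pd 3 (assocFlux f ν lam F 3) c = pd 3 (assocX f ν lam (assocD f ν lam F) 1) c := rfl
  rw [h.assocLaplace_eq hl hc (hF c hc), Fin.sum_univ_four, F2, F3, D0, D1, D2, D3, E0, E10, omegaX,
    Xs 0 c hc h1, Xs 1 c hc h1, hFz c hc h1, h.assocQ_slice hl hc.2.1 h1, weightedLaplace]
  simp only [omegaDot]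
  norm_num
  field_simp
  ring

end IsoPatch

end AssocSurface

end

/-! ### The Laplacian and the bi-Laplacian of H̃ -/

noncomputable section

namespace AssocSurface

/-- The function `a` in `H̃ = ρ a`. -/
def assocHDiv (f ν : Coord 2 → E4) (lam : E4 → ℝ) (c : Coord 4) : ℝ :=
  (c 0)⁻¹ * (assocQ f ν lam c)⁻¹ * (confE f lam (baseCoord c) * scriptH f ν lam (baseCoord c))

/-- `ρ⁻¹` times the derivatives `assocD` of `H̃`. -/
def assocHGrad (f ν : Coord 2 → E4) (lam : E4 → ℝ) (i : Fin 2) (c : Coord 4) : ℝ :=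
  pd (![2, 3] i) (assocHDiv f ν lam) c
    + c 0 * omegaForm f ν lam i (baseCoord c) * pd 0 (assocHDiv f ν lam) c
    - 2 * omegaForm f ν lam i (baseCoord c)
      * (assocHDiv f ν lam c + c 1 * pd 1 (assocHDiv f ν lam) c)

/-- `ω` of the vector density given by `assocHGrad`. -/
def assocHOmega (f ν : Coord 2 → E4) (lam : E4 → ℝ) (c : Coord 4) : ℝ :=
  omegaX f ν lam (assocX f ν lam (assocHGrad f ν lam)) c

/-- The `ρ`-coefficient of the `α`-component of the flux of `H̃`. -/
def fluxAlpha (f ν : Coord 2 → E4) (lam : E4 → ℝ) (c : Coord 4) : ℝ :=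
  -(c 0 ^ 2 * assocQ f ν lam c * pd 1 (assocHDiv f ν lam) c) + c 0 * assocHOmega f ν lam c

/-- The `ρ²`-coefficient of the `ρ`-component of the flux of `H̃`. -/
def fluxRho (f ν : Coord 2 → E4) (lam : E4 → ℝ) (c : Coord 4) : ℝ :=
  2 * c 0 * assocQ f ν lam c * pd 1 (assocHDiv f ν lam) c - 2 * assocHOmega f ν lam c

/-- The `ρ`-coefficient of the divergence of the flux of `H̃`. -/
def fluxDiv (f ν : Coord 2 → E4) (lam : E4 → ℝ) (c : Coord 4) : ℝ :=
  pd 0 (fluxAlpha f ν lam) c + 2 * fluxRho f ν lam c + c 1 * pd 1 (fluxRho f ν lam) c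
    + pd 2 (assocX f ν lam (assocHGrad f ν lam) 0) c
    + pd 3 (assocX f ν lam (assocHGrad f ν lam) 1) c

namespace IsoPatch

variable {U : Set (Coord 2)} {f ν : Coord 2 → E4} {lam : E4 → ℝ} {u : Coord 2} {c : Coord 4}

theorem smooth_confE_mul_scriptH (h : IsoPatch U f ν) (hl : IsConformalFactor lam)
    (hu : u ∈ U) : ContDiffAt ℝ ∞ (fun u => confE f lam u * scriptH f ν lam u) u :=
  (h.smooth_confE hl hu).mul (h.smooth_scriptH hl hu)

theorem smooth_traceOmega (h : IsoPatch U f ν) (hl : IsConformalFactor lam)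
    (hu : u ∈ U) : ContDiffAt ℝ ∞ (traceOmega f ν lam) u := by
  have o := h.smooth_OmegaT hl hu
  have s := h.smooth_OmegaStar hl hu
  exact (((((o 0 0).mul (s 0 0)).add ((o 0 1).mul (s 1 0))).add ((o 1 0).mul (s 0 1))).add
    ((o 1 1).mul (s 1 1))).div (h.smooth_moebiusFactor hu) (h.moebiusFactor_pos hu).ne'

theorem smooth_assocHDiv (h : IsoPatch U f ν) (hl : IsConformalFactor lam)
    (hc : c ∈ assocDom f ν lam U) : ContDiffAt ℝ ∞ (assocHDiv f ν lam) c :=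
  (((contDiffAt_coord 0 c).inv hc.1.ne').mul ((h.smooth_assocQ hl hc.2.1).inv hc.2.2.ne')).mul
    (contDiffAt_base (h.smooth_confE_mul_scriptH hl hc.2.1))

theorem smooth_assocHGrad (h : IsoPatch U f ν) (hl : IsConformalFactor lam)
    (hc : c ∈ assocDom f ν lam U) (i : Fin 2) : ContDiffAt ℝ ∞ (assocHGrad f ν lam i) c := by
  have ha := h.smooth_assocHDiv hl hc
  have hw := h.smooth_omegaBase hl hc.2.1 i
  exact ((contDiffAt_pd ha _).add (((contDiffAt_coord 0 c).mul hw).mul (contDiffAt_pd ha 0))).sub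
    ((contDiffAt_const.mul hw).mul (ha.add ((contDiffAt_coord 1 c).mul (contDiffAt_pd ha 1))))

theorem smooth_assocHX (h : IsoPatch U f ν) (hl : IsConformalFactor lam)
    (hc : c ∈ assocDom f ν lam U) (i : Fin 2) :
    ContDiffAt ℝ ∞ (assocX f ν lam (assocHGrad f ν lam) i) c :=
  h.smooth_assocX hl hc (h.smooth_assocHGrad hl hc) i

theorem smooth_assocHOmega (h : IsoPatch U f ν) (hl : IsConformalFactor lam)
    (hc : c ∈ assocDom f ν lam U) : ContDiffAt ℝ ∞ (assocHOmega f ν lam) c :=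
  h.smooth_omegaX hl hc.2.1 (h.smooth_assocHX hl hc)

theorem smooth_fluxAlpha (h : IsoPatch U f ν) (hl : IsConformalFactor lam)
    (hc : c ∈ assocDom f ν lam U) : ContDiffAt ℝ ∞ (fluxAlpha f ν lam) c :=
  ((((contDiffAt_coord 0 c).pow 2).mul (h.smooth_assocQ hl hc.2.1)).mul
    (contDiffAt_pd (h.smooth_assocHDiv hl hc) 1)).neg.add
    ((contDiffAt_coord 0 c).mul (h.smooth_assocHOmega hl hc))

theorem smooth_fluxRho (h : IsoPatch U f ν) (hl : IsConformalFactor lam)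
    (hc : c ∈ assocDom f ν lam U) : ContDiffAt ℝ ∞ (fluxRho f ν lam) c :=
  (((contDiffAt_const.mul (contDiffAt_coord 0 c)).mul (h.smooth_assocQ hl hc.2.1)).mul
    (contDiffAt_pd (h.smooth_assocHDiv hl hc) 1)).sub
    (contDiffAt_const.mul (h.smooth_assocHOmega hl hc))

theorem smooth_fluxDiv (h : IsoPatch U f ν) (hl : IsConformalFactor lam)
    (hc : c ∈ assocDom f ν lam U) : ContDiffAt ℝ ∞ (fluxDiv f ν lam) c := by
  have hr := h.smooth_fluxRho hl hc
  exact ((((contDiffAt_pd (h.smooth_fluxAlpha hl hc) 0).add (contDiffAt_const.mul hr)).add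
    ((contDiffAt_coord 1 c).mul (contDiffAt_pd hr 1))).add
    (contDiffAt_pd (h.smooth_assocHX hl hc 0) 2)).add (contDiffAt_pd (h.smooth_assocHX hl hc 1) 3)

theorem pd_rho_mul (h : IsoPatch U f ν) (hl : IsConformalFactor lam)
    (hc : c ∈ assocDom f ν lam U) (A : Fin 4) :
    pd A (fun b : Coord 4 => b 1 * assocHDiv f ν lam b) c
      = c 1 * pd A (assocHDiv f ν lam) c + if A = 1 then assocHDiv f ν lam c else 0 := by
  rw [pd_mul (contDiffAt_coord 1 c) (h.smooth_assocHDiv hl hc), pd_coord, ite_mul, one_mul,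
    zero_mul]

/-- Because Q does not depend on α, the function a is homogeneous of degree −1 in α. -/
theorem pd_zero_assocHDiv (h : IsoPatch U f ν) (hl : IsConformalFactor lam)
    (hc : c ∈ assocDom f ν lam U) :
    pd 0 (assocHDiv f ν lam) c = -(assocHDiv f ν lam c / c 0) := by
  have s1 : ContDiffAt ℝ ∞ (fun b : Coord 4 => (b 0)⁻¹) c :=
    (contDiffAt_coord 0 c).inv hc.1.ne'
  have s2 : ContDiffAt ℝ ∞ (fun b => (assocQ f ν lam b)⁻¹) c :=
    (h.smooth_assocQ hl hc.2.1).inv hc.2.2.ne'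
  have hk := h.smooth_confE_mul_scriptH hl hc.2.1
  have e := pd_mul (s1.mul s2) (contDiffAt_base hk) 0
  rw [pd_mul s1 s2, pd_inv (contDiffAt_coord 0 c) hc.1.ne',
    pd_inv (h.smooth_assocQ hl hc.2.1) hc.2.2.ne', h.pd_zero_assocQ hl hc.2.1, pd_base hk,
    pd_coord] at e
  refine e.trans ?_
  have := hc.1.ne'
  have := hc.2.2.ne'
  simp [assocHDiv]
  field_simp

theorem pd_one_assocHDiv_slice (h : IsoPatch U f ν) (hl : IsConformalFactor lam)
    (hc : c ∈ assocDom f ν lam U) (h1 : c 1 = 0) :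
    pd 1 (assocHDiv f ν lam) c = -((c 0)⁻¹ * (traceOmega f ν lam (baseCoord c)
      * scriptH f ν lam (baseCoord c) / confE f lam (baseCoord c))) := by
  have s1 : ContDiffAt ℝ ∞ (fun b : Coord 4 => (b 0)⁻¹) c :=
    (contDiffAt_coord 0 c).inv hc.1.ne'
  have s2 : ContDiffAt ℝ ∞ (fun b => (assocQ f ν lam b)⁻¹) c :=
    (h.smooth_assocQ hl hc.2.1).inv hc.2.2.ne'
  have hk := h.smooth_confE_mul_scriptH hl hc.2.1
  have e := pd_mul (s1.mul s2) (contDiffAt_base hk) 1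
  rw [pd_mul s1 s2, pd_inv (contDiffAt_coord 0 c) hc.1.ne',
    pd_inv (h.smooth_assocQ hl hc.2.1) hc.2.2.ne', h.pd_assocQ_slice hl hc.2.1 h1, pd_base hk,
    pd_coord, h.assocQ_slice hl hc.2.1 h1] at e
  refine e.trans ?_
  have := hc.1.ne'
  have := (h.confE_pos hl hc.2.1).ne'
  simp
  field_simp

theorem assocHDiv_slice (h : IsoPatch U f ν) (hl : IsConformalFactor lam)
    (hc : c ∈ assocDom f ν lam U) (h1 : c 1 = 0) :
    assocHDiv f ν lam c = c 0 ^ (-1 : ℤ) * scriptH f ν lam (baseCoord c) := by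
  have := (h.confE_pos hl hc.2.1).ne'
  rw [assocHDiv, h.assocQ_slice hl hc.2.1 h1, zpow_neg_one]
  field_simp

/-- With F = ρa one has ∂_αF = −ρa/α and ∂_ρF = a + ρ∂_ρa, while αQa = E𝓗. The coefficient 3 is 1
from ∂_αF plus 2 from ∂_ρF. The identity is needed for all small ρ, since Δ̃H̃ must still be
differentiated in ρ. -/
theorem assocFlux_rho_mul (h : IsoPatch U f ν) (hl : IsConformalFactor lam)
    (hc : c ∈ assocDom f ν lam U) (A : Fin 4) :
    assocFlux f ν lam (fun b => b 1 * assocHDiv f ν lam b) A c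
      = ![-(c 0 * (confE f lam (baseCoord c) * scriptH f ν lam (baseCoord c)))
            + c 1 * fluxAlpha f ν lam c,
          c 1 * (3 * (confE f lam (baseCoord c) * scriptH f ν lam (baseCoord c))
            + c 1 * fluxRho f ν lam c),
          c 1 * assocX f ν lam (assocHGrad f ν lam) 0 c,
          c 1 * assocX f ν lam (assocHGrad f ν lam) 1 c] A := by
  have hD : ∀ i, assocD f ν lam (fun b => b 1 * assocHDiv f ν lam b) i c
      = c 1 * assocHGrad f ν lam i c := by
    intro i
    rw [assocD, assocHGrad, h.pd_rho_mul hl hc, h.pd_rho_mul hl hc, h.pd_rho_mul hl hc]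
    fin_cases i <;> simp <;> ring
  have hX : ∀ i, assocX f ν lam (assocD f ν lam (fun b => b 1 * assocHDiv f ν lam b)) i c
      = c 1 * assocX f ν lam (assocHGrad f ν lam) i c := by
    intro i
    rw [assocX, assocX, hD, hD]; ring
  have hW : omegaX f ν lam
      (assocX f ν lam (assocD f ν lam (fun b => b 1 * assocHDiv f ν lam b))) c
      = c 1 * assocHOmega f ν lam c := by
    rw [omegaX, hX, hX, assocHOmega, omegaX]; ring
  have hk : confE f lam (baseCoord c) * scriptH f ν lam (baseCoord c)
      = c 0 * assocQ f ν lam c * assocHDiv f ν lam c := by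
    have := hc.1.ne'
    have := hc.2.2.ne'
    rw [assocHDiv]; field_simp
  have ha := hc.1.ne'
  simp only [assocFlux, hX, hW, h.pd_rho_mul hl hc, h.pd_zero_assocHDiv hl hc, fluxAlpha, fluxRho,
    hk]
  fin_cases A <;>
    simp only [Matrix.cons_val, Fin.zero_eta, Fin.mk_one, Fin.reduceFinMk, Fin.isValue, if_true,
      Fin.reduceEq, if_false] <;> field_simp <;> ring

/-- The factor 2 is 3 − 1, from the ρ- and α-components of the flux. Neither contribution depends on
ρ, and every remaining term carries a factor ρ. -/
theorem assocLaplace_assocH (h : IsoPatch U f ν) (hl : IsConformalFactor lam)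
    (hc : c ∈ assocDom f ν lam U) :
    assocLaplace f ν lam (assocH f ν lam) c = (c 0 ^ 3 * assocQ f ν lam c)⁻¹ *
      (2 * (confE f lam (baseCoord c) * scriptH f ν lam (baseCoord c))
        + c 1 * fluxDiv f ν lam c) := by
  have hD := h.isOpen_assocDom hl
  have a0 := contDiffAt_coord 0 c
  have a1 := contDiffAt_coord 1 c
  have hk := h.smooth_confE_mul_scriptH hl hc.2.1
  have hkb := contDiffAt_base hk
  have s0 := h.smooth_fluxAlpha hl hc
  have s1 := h.smooth_fluxRho hl hc
  have sF : ContDiffAt ℝ ∞ (fun b : Coord 4 => b 1 * assocHDiv f ν lam b) c :=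
    a1.mul (h.smooth_assocHDiv hl hc)
  have e := fun A => pd_congr_of_isOpen hD (fun b hb => h.assocFlux_rho_mul hl hb A) A hc
  have m0 : ContDiffAt ℝ ∞ (fun b : Coord 4 =>
      -(b 0 * (confE f lam (baseCoord b) * scriptH f ν lam (baseCoord b)))) c := (a0.mul hkb).neg
  have m1 : ContDiffAt ℝ ∞ (fun b : Coord 4 => b 1 * fluxAlpha f ν lam b) c := a1.mul s0
  have m2 : ContDiffAt ℝ ∞ (fun b : Coord 4 => b 1 * fluxRho f ν lam b) c := a1.mul s1
  have m3 : ContDiffAt ℝ ∞ (fun b : Coord 4 =>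
      3 * (confE f lam (baseCoord b) * scriptH f ν lam (baseCoord b))) c := contDiffAt_const.mul hkb
  have m4 : ContDiffAt ℝ ∞ (fun b : Coord 4 =>
      3 * (confE f lam (baseCoord b) * scriptH f ν lam (baseCoord b)) + b 1 * fluxRho f ν lam b) c :=
    m3.add m2
  have e0 := e 0
  have e1 := e 1
  have e2 := e 2
  have e3 := e 3
  simp only [Matrix.cons_val, Fin.isValue] at e0 e1 e2 e3
  rw [pd_add m0 m1, pd_neg, pd_mul a0 hkb, pd_mul a1 s0, pd_base hk, pd_coord, pd_coord] at e0
  rw [pd_mul a1 m4, pd_add m3 m2, pd_const_mul 3 hkb, pd_mul a1 s1, pd_base hk, pd_coord] at e1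
  rw [pd_mul a1 (h.smooth_assocHX hl hc 0), pd_coord] at e2
  rw [pd_mul a1 (h.smooth_assocHX hl hc 1), pd_coord] at e3
  have key : assocLaplace f ν lam (assocH f ν lam) c
      = assocLaplace f ν lam (fun b => b 1 * assocHDiv f ν lam b) c :=
    laplaceBeltrami_congr hD (fun b hb => h.assocH_eq hl hb) hc
  rw [key, h.assocLaplace_eq hl hc sF, Fin.sum_univ_four, e0, e1, e2, e3, fluxDiv]
  simp
  left
  ring

theorem fluxDiv_slice (h : IsoPatch U f ν) (hl : IsConformalFactor lam)
    (hc : c ∈ assocDom f ν lam U) (h1 : c 1 = 0) :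
    fluxDiv f ν lam c = weightedLaplace f ν lam (scriptH f ν lam) (baseCoord c)
      - 3 * (traceOmega f ν lam (baseCoord c) * scriptH f ν lam (baseCoord c)) := by
  have hh := fun u (hu : u ∈ U) => h.smooth_scriptH hl hu
  have hg := fun u (hu : u ∈ U) => h.smooth_weightedGrad hl hu (hh u hu)
  -- The same coefficient −3 now arises as −1 − 2: from the α-degree −1 of a, and from the −2ρω_i∂_ρ
  -- part of D_i acting on the factor ρ.
  have Xs : ∀ i, ∀ b ∈ assocDom f ν lam U, b 1 = 0 → assocX f ν lam (assocHGrad f ν lam) i b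
      = b 0 ^ (0 : ℤ) * weightedGrad f ν lam (scriptH f ν lam) i (baseCoord b) := by
    intro i b hb hb1
    have hb0 := hb.1.ne'
    obtain ⟨e0, e2, e3⟩ := h.pd_of_slice hl (fun b hb => h.smooth_assocHDiv hl hb) hh
      (fun b hb => h.assocHDiv_slice hl hb) hb hb1
    rw [h.assocX_slice hl hb.2.1 hb1, assocHGrad, hb1, weightedGrad, e0,
      h.assocHDiv_slice hl hb hb1]
    fin_cases i <;> simp [e2, e3] <;> field_simp <;> ring
  have Os : ∀ b ∈ assocDom f ν lam U, b 1 = 0 → assocHOmega f ν lam b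
      = omegaDot f ν lam (weightedGrad f ν lam (scriptH f ν lam)) (baseCoord b) := by
    intro b hb hb1
    simp only [assocHOmega, omegaX, Xs _ b hb hb1, omegaDot, zpow_zero, one_mul]
  have As : ∀ b ∈ assocDom f ν lam U, b 1 = 0 → fluxAlpha f ν lam b
      = b 0 ^ (1 : ℤ) * (traceOmega f ν lam (baseCoord b) * scriptH f ν lam (baseCoord b)
        + omegaDot f ν lam (weightedGrad f ν lam (scriptH f ν lam)) (baseCoord b)) := by
    intro b hb hb1
    have hb0 := hb.1.ne'
    have hE := (h.confE_pos hl hb.2.1).ne'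
    rw [fluxAlpha, Os b hb hb1, h.pd_one_assocHDiv_slice hl hb hb1, h.assocQ_slice hl hb.2.1 hb1]
    field_simp
  have hq := fun u (hu : u ∈ U) => h.smooth_traceOmega hl hu
  have D0 := (h.pd_of_slice hl (fun b hb => h.smooth_fluxAlpha hl hb)
    (s := fun u => traceOmega f ν lam u * scriptH f ν lam u
      + omegaDot f ν lam (weightedGrad f ν lam (scriptH f ν lam)) u)
    (fun u hu => ((hq u hu).mul (hh u hu)).add (h.smooth_omegaDot hl hu (hg u hu))) As hc h1).1
  have D2 := (h.pd_of_slice hl (fun b hb => h.smooth_assocHX hl hb 0) (fun u hu => hg u hu 0)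
    (Xs 0) hc h1).2.1
  have D3 := (h.pd_of_slice hl (fun b hb => h.smooth_assocHX hl hb 1) (fun u hu => hg u hu 1)
    (Xs 1) hc h1).2.2
  have hc0 := hc.1.ne'
  have hE := (h.confE_pos hl hc.2.1).ne'
  rw [fluxDiv, D0, D2, D3, fluxRho, Os c hc h1, h.pd_one_assocHDiv_slice hl hc h1,
    h.assocQ_slice hl hc.2.1 h1, h1, weightedLaplace]
  simp
  field_simp
  ring

/-- Expanding Σ(∂_i − 3ω_i)²𝓗 produces the Laplacian and the coefficients −6, −3 and 9 of the
ω-terms. Since |Ω|² = 2m/E, the last term of 𝓘 is 3q𝓗/E. -/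
theorem invariantFive_eq (h : IsoPatch U f ν) (hl : IsConformalFactor lam) (hu : u ∈ U) :
    invariantFive f ν lam u = (confE f lam u)⁻¹ *
      (weightedLaplace f ν lam (scriptH f ν lam) u
        - 3 * (traceOmega f ν lam u * scriptH f ν lam u)) := by
  have hE := (h.confE_pos hl hu).ne'
  have hm := (h.moebiusFactor_pos hu).ne'
  have e := h.confE_mul_moebiusFactor hl hu
  have hs := h.smooth_scriptH hl hu
  have hd : ∀ i, pd i (weightedGrad f ν lam (scriptH f ν lam) i) u
      = pd i (pd i (scriptH f ν lam)) u - (3 * omegaForm f ν lam i u * pd i (scriptH f ν lam) u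
        + 3 * pd i (omegaForm f ν lam i) u * scriptH f ν lam u) := by
    intro i
    have s1 := h.smooth_omegaForm hl hu i
    have s2 : ContDiffAt ℝ ∞ (fun u => 3 * omegaForm f ν lam i u) u := contDiffAt_const.mul s1
    have s3 : ContDiffAt ℝ ∞ (fun u => 3 * omegaForm f ν lam i u * scriptH f ν lam u) u := s2.mul hs
    have := pd_sub (contDiffAt_pd hs i) s3 i
    rw [pd_mul s2 hs, pd_const_mul 3 s1] at this
    exact this
  have n : tensorInner f lam (OmegaT f ν lam) (OmegaT f ν lam) u
      = 2 * moebiusFactor f ν u / confE f lam u := by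
    simp only [tensorInner, Fin.sum_univ_two, h.OmegaT_one_one hl hu, h.OmegaT_symm hl hu 1 0]
    field_simp
    linear_combination -2 * e
  have t : (Matrix.of (fun i j => OmegaT f ν lam i j u) *
      Matrix.of (fun i j => OmegaStar f ν lam i j u)).trace
      = moebiusFactor f ν u * traceOmega f ν lam u := by
    simp only [Matrix.trace, Fin.sum_univ_two, Matrix.diag_apply, Matrix.mul_apply,
      Matrix.of_apply, traceOmega]
    field_simp
    ring
  rw [invariantFive, n, t, weightedLaplace, hd, hd]
  simp only [surfLaplace, formInner, surfDiv, Fin.sum_univ_two, omegaDot, weightedGrad]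
  field_simp
  ring

theorem assocLaplace_assocLaplace_assocH (h : IsoPatch U f ν) (hl : IsConformalFactor lam)
    (hc : c ∈ assocDom f ν lam U) (h1 : c 1 = 0) :
    assocLaplace f ν lam (assocLaplace f ν lam (assocH f ν lam)) c
      = 8 * (c 0 ^ 5)⁻¹ * invariantFive f ν lam (baseCoord c) := by
  have hD := h.isOpen_assocDom hl
  have hE := fun u (hu : u ∈ U) => (h.confE_pos hl hu).ne'
  have hh := fun u (hu : u ∈ U) => h.smooth_scriptH hl hu
  have hV : ∀ b ∈ assocDom f ν lam U,
      ContDiffAt ℝ ∞ (fun b : Coord 4 => b 0 ^ 3 * assocQ f ν lam b) b := fun b hb =>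
    ((contDiffAt_coord 0 b).pow 3).mul (h.smooth_assocQ hl hb.2.1)
  have hV0 : ∀ b ∈ assocDom f ν lam U, b 0 ^ 3 * assocQ f ν lam b ≠ 0 := fun b hb =>
    (mul_pos (pow_pos hb.1 3) hb.2.2).ne'
  have hVi : ∀ b ∈ assocDom f ν lam U,
      ContDiffAt ℝ ∞ (fun b : Coord 4 => (b 0 ^ 3 * assocQ f ν lam b)⁻¹) b := fun b hb =>
    (hV b hb).inv (hV0 b hb)
  have hk2 : ∀ b ∈ assocDom f ν lam U, ContDiffAt ℝ ∞ (fun b : Coord 4 =>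
      2 * (confE f lam (baseCoord b) * scriptH f ν lam (baseCoord b))) b := fun b hb =>
    contDiffAt_const.mul (contDiffAt_base (h.smooth_confE_mul_scriptH hl hb.2.1))
  have hrC : ∀ b ∈ assocDom f ν lam U,
      ContDiffAt ℝ ∞ (fun b : Coord 4 => b 1 * fluxDiv f ν lam b) b := fun b hb =>
    (contDiffAt_coord 1 b).mul (h.smooth_fluxDiv hl hb)
  have hS : ∀ b ∈ assocDom f ν lam U, ContDiffAt ℝ ∞ (fun b : Coord 4 =>
      2 * (confE f lam (baseCoord b) * scriptH f ν lam (baseCoord b))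
        + b 1 * fluxDiv f ν lam b) b := fun b hb => (hk2 b hb).add (hrC b hb)
  have hF : ∀ b ∈ assocDom f ν lam U,
      ContDiffAt ℝ ∞ (assocLaplace f ν lam (assocH f ν lam)) b := fun b hb =>
    ContDiffAt.congr_of_eventuallyEq ((hVi b hb).mul (hS b hb))
      (Filter.eventuallyEq_of_mem (hD.mem_nhds hb) fun b hb => h.assocLaplace_assocH hl hb)
  have hq := fun u (hu : u ∈ U) => h.smooth_traceOmega hl hu
  have hJ : ∀ u ∈ U, ContDiffAt ℝ ∞ (weightedLaplace f ν lam (scriptH f ν lam)) u := by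
    intro u hu
    have hg := h.smooth_weightedGrad hl hu (hh u hu)
    exact ((contDiffAt_pd (hg 0) 0).add (contDiffAt_pd (hg 1) 1)).sub
      (contDiffAt_const.mul (h.smooth_omegaDot hl hu hg))
  -- At ρ = 0, the value of Δ̃H̃ = (α³Q)⁻¹(2E𝓗 + ρC) gives w = 2𝓗. Its ρ-derivative gives z = (C −
  -- 2q𝓗)/E with C = J𝓗 − 3q𝓗, hence the coefficient 5. The total is then 6(J𝓗 − 5q𝓗) + 6q𝓗 + 2J𝓗 =
  -- 8(J𝓗 − 3q𝓗).
  have res := h.assocLaplace_slice hl hF (w := fun u => 2 * scriptH f ν lam u)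
    (z := fun u => (weightedLaplace f ν lam (scriptH f ν lam) u
      - 5 * (traceOmega f ν lam u * scriptH f ν lam u)) / confE f lam u)
    (fun u hu => contDiffAt_const.mul (hh u hu))
    (fun u hu => ((hJ u hu).sub (contDiffAt_const.mul ((hq u hu).mul (hh u hu)))).div
      (h.smooth_confE hl hu) (hE u hu)) ?_ ?_ hc h1
  · have w2 : weightedLaplace f ν lam (fun u => 2 * scriptH f ν lam u) (baseCoord c)
        = 2 * weightedLaplace f ν lam (scriptH f ν lam) (baseCoord c) := by
      have hg : ∀ u ∈ U, ∀ i, weightedGrad f ν lam (fun u => 2 * scriptH f ν lam u) i u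
          = 2 * weightedGrad f ν lam (scriptH f ν lam) i u := by
        intro u hu i
        rw [weightedGrad, weightedGrad, pd_const_mul 2 (hh u hu)]; ring
      have hg' := fun i => (pd_congr_of_isOpen h.isOpen (fun u hu => hg u hu i) i hc.2.1).trans
        (pd_const_mul 2 (h.smooth_weightedGrad hl hc.2.1 (hh _ hc.2.1) i) i)
      rw [weightedLaplace, weightedLaplace, hg' 0, hg' 1, omegaDot, omegaDot, hg _ hc.2.1,
        hg _ hc.2.1]
      ring
    rw [res, w2, h.invariantFive_eq hl hc.2.1]
    have := hE _ hc.2.1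
    have := hc.1.ne'
    field_simp
    ring
  · intro b hb hb1
    have := hE _ hb.2.1
    have := hb.1.ne'
    rw [h.assocLaplace_assocH hl hb, hb1, h.assocQ_slice hl hb.2.1 hb1]
    field_simp
    simp
  · intro b hb hb1
    have e := pd_congr_of_isOpen hD (fun b hb => h.assocLaplace_assocH hl hb) 1 hb
    have hk := h.smooth_confE_mul_scriptH hl hb.2.1
    have a3 : ContDiffAt ℝ ∞ (fun b : Coord 4 => b 0 ^ 3) b := (contDiffAt_coord 0 b).pow 3
    have hcb : pd 1 (fun b : Coord 4 => b 0 ^ 3) b = 0 := by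
      rw [pd_real_comp (φ := fun x => x ^ 3) (by fun_prop) (contDiffAt_coord 0 b), pd_coord]; simp
    rw [pd_mul (hVi b hb) (hS b hb), pd_inv (hV b hb) (hV0 b hb), pd_add (hk2 b hb) (hrC b hb),
      pd_const_mul 2 (contDiffAt_base hk), pd_base hk,
      pd_mul (contDiffAt_coord 1 b) (h.smooth_fluxDiv hl hb), pd_coord,
      pd_mul a3 (h.smooth_assocQ hl hb.2.1), hcb, hb1, h.pd_assocQ_slice hl hb.2.1 hb1,
      h.assocQ_slice hl hb.2.1 hb1, h.fluxDiv_slice hl hb hb1] at e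
    rw [e]
    have := hE _ hb.2.1
    have := hb.1.ne'
    simp
    field_simp
    ring

end IsoPatch

end AssocSurface

end

/-! ### Uniqueness of the Gauss map and conformal invariance -/

noncomputable section

namespace AssocSurface

theorem IsConformalFactor.mul {lam mu : E4 → ℝ} (hl : IsConformalFactor lam)
    (hm : IsConformalFactor mu) : IsConformalFactor (fun v => mu v * lam v) :=
  fun v hv => ⟨(hm v hv).1.mul (hl v hv).1, mul_pos (hm v hv).2 (hl v hv).2⟩

namespace IsoPatch

variable {U : Set (Coord 2)} {f ν : Coord 2 → E4} {lam mu : E4 → ℝ} {u : Coord 2}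

/-- The conformal Gauss map is the only map `(0, ν) + c (1, f)` with `∑ ⟨η_i, (y_λ)_i⟩ = 0`. -/
theorem eq_gaussMap (h : IsoPatch U f ν) (hl : IsConformalFactor lam) {η : Coord 2 → Mink}
    (hη : ∀ u ∈ U, ContDiffAt ℝ ∞ η u)
    (hform : ∀ u ∈ U, η u = (0, ν u) + (η u).1 • ((1, f u) : Mink))
    (htr : ∀ u ∈ U, lor (pd 0 η u) (pd 0 (yLam f lam) u)
      + lor (pd 1 η u) (pd 1 (yLam f lam) u) = 0) (hu : u ∈ U) : η u = gaussMap f ν u := by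
  set c : Coord 2 → ℝ := fun u => ((η u).1 - meanCurv f ν (fun _ => 1) u) * (lam (f u))⁻¹ with hcdef
  have hc : ∀ u ∈ U, ContDiffAt ℝ ∞ c u := fun u hu =>
    ((hη u hu).fst.sub (h.smooth_meanCurv isConformalFactor_one hu)).mul
      ((h.smooth_lam hl hu).inv (h.lam_pos hl hu).ne')
  have hηc : ∀ u ∈ U, η u = gaussMap f ν u + c u • yLam f lam u := by
    intro u hu
    have hp := (h.lam_pos hl hu).ne'
    rw [hform u hu, gaussMap, yLam, smul_smul, hcdef]
    simp only [mul_assoc, inv_mul_cancel₀ hp]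
    module
  have hd : ∀ i, pd i η u = pd i (gaussMap f ν) u
      + (c u • pd i (yLam f lam) u + pd i c u • yLam f lam u) := by
    intro i
    have s1 := h.smooth_yLam hl hu
    have s2 : ContDiffAt ℝ ∞ (fun u => c u • yLam f lam u) u := (hc u hu).smul s1
    rw [pd_congr_of_isOpen h.isOpen hηc i hu, pd_add (h.smooth_gaussMap hu) s2,
      pd_smul (hc u hu) s1]
  have t := htr u hu
  have t0 := h.OmegaT_trace hl hu
  rw [OmegaT, OmegaT] at t0
  -- If η = ξ + c y, the y-term of η_i drops and the trace condition for η reduces to 2cE = 0.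
  simp only [hd, lor_add_left, lor_smul_left, h.lor_pd_yLam_self hl hu, h.yLam_pd hl hu] at t
  have hE := (h.confE_pos hl hu).ne'
  have c0 : c u = 0 := by
    have : c u * confE f lam u = 0 := by linarith
    exact (mul_eq_zero.mp this).resolve_right hE
  rw [hηc u hu, c0, zero_smul, add_zero]

theorem mono (h : IsoPatch U f ν) {W : Set (Coord 2)} (hW : IsOpen W) (hWU : W ⊆ U) :
    IsoPatch W f ν where
  isOpen := hW
  smooth := fun u hu => h.smooth u (hWU hu)
  smooth_normal := fun u hu => h.smooth_normal u (hWU hu)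
  unit := fun u hu => h.unit u (hWU hu)
  unit_normal := fun u hu => h.unit_normal u (hWU hu)
  normal_point := fun u hu => h.normal_point u (hWU hu)
  normal_tangent := fun u hu => h.normal_tangent u (hWU hu)
  orth := fun u hu => h.orth u (hWU hu)
  conf := fun u hu => h.conf u (hWU hu)
  pos := fun u hu => h.pos u (hWU hu)
  not_umbilic := fun u hu => h.not_umbilic u (hWU hu)

/-! ### Scaling -/

theorem yStar_mul (h : IsoPatch U f ν) (hl : IsConformalFactor lam) (hm : IsConformalFactor mu)
    (hu : u ∈ U) :
    yStar f ν (fun v => mu v * lam v) u = (mu (f u))⁻¹ • yStar f ν lam u := by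
  obtain ⟨h1, h2, h3, h4⟩ := h.yStar_spec hl hu
  have hp := (h.lam_pos hm hu).ne'
  refine (h.eq_yStar (hl.mul hm) hu ⟨?_, ?_, ?_, fun i => ?_⟩).symm
  · have : yLam f (fun v => mu v * lam v) u = mu (f u) • yLam f lam u := by
      simp only [yLam, smul_smul]
    rw [this, lor_smul_left, lor_smul_right, h1]
    field_simp
  · rw [lor_smul_left, lor_smul_right, h2]; ring
  · rw [lor_smul_left, h3, mul_zero]
  · rw [lor_smul_left, h4, mul_zero]

/-- The form ω transforms like a connection form, by −d log μ; the extra term comes from ⟨y, y*⟩ =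
−1. -/
theorem omegaForm_mul (h : IsoPatch U f ν) (hl : IsConformalFactor lam)
    (hm : IsConformalFactor mu) (hu : u ∈ U) (i : Fin 2) :
    omegaForm f ν (fun v => mu v * lam v) i u
      = omegaForm f ν lam i u - pd i (fun b => mu (f b)) u / mu (f u) := by
  have hp := (h.lam_pos hm hu).ne'
  have e : yLam f (fun v => mu v * lam v) = fun b => mu (f b) • yLam f lam b := by
    funext b; simp only [yLam, smul_smul]
  rw [omegaForm, e, pd_smul (h.smooth_lam hm hu) (h.smooth_yLam hl hu), h.yStar_mul hl hm hu,
    lor_add_left, lor_smul_left, lor_smul_left, lor_smul_right, lor_smul_right,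
    lor_comm (yLam f lam u), (h.yStar_spec hl hu).1, omegaForm]
  field_simp
  ring

theorem OmegaT_mul (h : IsoPatch U f ν) (hl : IsConformalFactor lam) (hm : IsConformalFactor mu)
    (hu : u ∈ U) (i j : Fin 2) :
    OmegaT f ν (fun v => mu v * lam v) i j u = mu (f u) * OmegaT f ν lam i j u := by
  rw [h.OmegaT_lam (hl.mul hm) hu, h.OmegaT_lam hl hu]; ring

theorem OmegaStar_mul (h : IsoPatch U f ν) (hl : IsConformalFactor lam)
    (hm : IsConformalFactor mu) (hu : u ∈ U) (i j : Fin 2) :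
    OmegaStar f ν (fun v => mu v * lam v) i j u = (mu (f u))⁻¹ * OmegaStar f ν lam i j u := by
  rw [h.OmegaStar_eq (hl.mul hm) hu, h.OmegaStar_eq hl hu, h.yStar_mul hl hm hu, lor_smul_right]

theorem confE_mul (f : Coord 2 → E4) (lam mu : E4 → ℝ) (u : Coord 2) :
    confE f (fun v => mu v * lam v) u = mu (f u) ^ 2 * confE f lam u := by
  simp only [confE]; ring

/-- Of the weight −3, one power comes from y* in tr Ω* and two from E. -/
theorem scriptH_mul (h : IsoPatch U f ν) (hl : IsConformalFactor lam)
    (hm : IsConformalFactor mu) (hu : u ∈ U) :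
    scriptH f ν (fun v => mu v * lam v) u = ((mu (f u))⁻¹) ^ 3 * scriptH f ν lam u := by
  have hp := (h.lam_pos hm hu).ne'
  have hE := (h.confE_pos hl hu).ne'
  rw [h.scriptH_eq (hl.mul hm) hu, h.scriptH_eq hl hu, h.OmegaStar_mul hl hm hu,
    h.OmegaStar_mul hl hm hu, confE_mul]
  field_simp

/-- Differentiating μ⁻³ yields −3 d log μ, which is compensated by the change of −3ω. Thus d − 3ω is
covariant on weight −3. -/
theorem weightedGrad_mul (h : IsoPatch U f ν) (hl : IsConformalFactor lam)
    (hm : IsConformalFactor mu) {s s' : Coord 2 → ℝ} (hs : ∀ u ∈ U, ContDiffAt ℝ ∞ s u)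
    (hss : ∀ u ∈ U, s' u = ((mu (f u))⁻¹) ^ 3 * s u) (hu : u ∈ U) (i : Fin 2) :
    weightedGrad f ν (fun v => mu v * lam v) s' i u
      = ((mu (f u))⁻¹) ^ 3 * weightedGrad f ν lam s i u := by
  have hp := (h.lam_pos hm hu).ne'
  have s1 : ContDiffAt ℝ ∞ (fun b => (mu (f b))⁻¹) u := (h.smooth_lam hm hu).inv hp
  have s2 : ContDiffAt ℝ ∞ (fun b => ((mu (f b))⁻¹) ^ 3) u := s1.pow 3
  have s3 : pd i (fun b => ((mu (f b))⁻¹) ^ 3) u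
      = 3 * ((mu (f u))⁻¹) ^ 2 * (-pd i (fun b => mu (f b)) u / mu (f u) ^ 2) := by
    rw [pd_real_comp (φ := fun x => x ^ 3) (by fun_prop) s1, pd_inv (h.smooth_lam hm hu) hp]
    simp
  rw [weightedGrad, weightedGrad, pd_congr_of_isOpen h.isOpen hss i hu, pd_mul s2 (hs u hu), s3,
    h.omegaForm_mul hl hm hu, hss u hu]
  field_simp
  ring

theorem weightedLaplace_mul (h : IsoPatch U f ν) (hl : IsConformalFactor lam)
    (hm : IsConformalFactor mu) {s s' : Coord 2 → ℝ} (hs : ∀ u ∈ U, ContDiffAt ℝ ∞ s u)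
    (hss : ∀ u ∈ U, s' u = ((mu (f u))⁻¹) ^ 3 * s u) (hu : u ∈ U) :
    weightedLaplace f ν (fun v => mu v * lam v) s' u
      = ((mu (f u))⁻¹) ^ 3 * weightedLaplace f ν lam s u := by
  -- The components of the weighted gradient again have weight −3, so the covariance applies a
  -- second time.
  have e := fun i => h.weightedGrad_mul hl hm (s := weightedGrad f ν lam s i)
    (s' := weightedGrad f ν (fun v => mu v * lam v) s' i)
    (fun u hu => h.smooth_weightedGrad hl hu (hs u hu) i)
    (fun u hu => h.weightedGrad_mul hl hm hs hss hu i) hu i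
  have split : ∀ (lam : E4 → ℝ) (s : Coord 2 → ℝ), weightedLaplace f ν lam s u
      = weightedGrad f ν lam (weightedGrad f ν lam s 0) 0 u
        + weightedGrad f ν lam (weightedGrad f ν lam s 1) 1 u := by
    intro lam s
    have g : ∀ (t : Coord 2 → ℝ) i, weightedGrad f ν lam t i u
        = pd i t u - 3 * omegaForm f ν lam i u * t u := fun _ _ => rfl
    rw [g (weightedGrad f ν lam s 0) 0, g (weightedGrad f ν lam s 1) 1, weightedLaplace, omegaDot]
    ring
  rw [split, split, e, e]; ring

theorem traceOmega_mul (h : IsoPatch U f ν) (hl : IsConformalFactor lam)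
    (hm : IsConformalFactor mu) (hu : u ∈ U) :
    traceOmega f ν (fun v => mu v * lam v) u = traceOmega f ν lam u := by
  have hp := (h.lam_pos hm hu).ne'
  simp only [traceOmega, h.OmegaT_mul hl hm hu, h.OmegaStar_mul hl hm hu]
  field_simp

theorem invariantFive_mul (h : IsoPatch U f ν) (hl : IsConformalFactor lam)
    (hm : IsConformalFactor mu) (hu : u ∈ U) :
    invariantFive f ν (fun v => mu v * lam v) u
      = (mu (f u) ^ 5)⁻¹ * invariantFive f ν lam u := by
  have hp := (h.lam_pos hm hu).ne'
  have hE := (h.confE_pos hl hu).ne'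
  rw [h.invariantFive_eq (hl.mul hm) hu, h.invariantFive_eq hl hu,
    h.weightedLaplace_mul hl hm (fun u hu => h.smooth_scriptH hl hu)
      (fun u hu => h.scriptH_mul hl hm hu) hu,
    h.traceOmega_mul hl hm hu, h.scriptH_mul hl hm hu, confE_mul]
  field_simp

end IsoPatch

/-! ### Change of the isothermal coordinate -/

/-- `f₁ = f₂ ∘ τ` is a change of the isothermal coordinate. -/
structure IsReparam (W U : Set (Coord 2)) (f₁ ν₁ f₂ ν₂ : Coord 2 → E4)
    (τ : Coord 2 → Coord 2) : Prop where
  left : IsoPatch W f₁ ν₁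
  right : IsoPatch U f₂ ν₂
  smooth : ∀ u ∈ W, ContDiffAt ℝ ∞ τ u
  maps : ∀ u ∈ W, τ u ∈ U
  eq : ∀ u ∈ W, f₁ u = f₂ (τ u)
  eq_normal : ∀ u ∈ W, ν₁ u = ν₂ (τ u)

/-- The matrix entry `∂τ^k/∂u^i`. -/
def jac (τ : Coord 2 → Coord 2) (k i : Fin 2) (u : Coord 2) : ℝ := pd i (fun b => τ b k) u

namespace IsReparam

variable {W U : Set (Coord 2)} {f₁ ν₁ f₂ ν₂ : Coord 2 → E4} {τ : Coord 2 → Coord 2}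
  {lam : E4 → ℝ} {u : Coord 2}

theorem smooth_comp (r : IsReparam W U f₁ ν₁ f₂ ν₂ τ) {V : Type*} [NormedAddCommGroup V]
    [NormedSpace ℝ V] {F : Coord 2 → V} (hF : ∀ u ∈ U, ContDiffAt ℝ ∞ F u) (hu : u ∈ W) :
    ContDiffAt ℝ ∞ (fun b => F (τ b)) u :=
  (hF _ (r.maps u hu)).comp u (r.smooth u hu)

theorem pd_pullback (r : IsReparam W U f₁ ν₁ f₂ ν₂ τ) {V : Type*} [NormedAddCommGroup V]
    [NormedSpace ℝ V] {F₁ F₂ : Coord 2 → V} (hF : ∀ u ∈ U, ContDiffAt ℝ ∞ F₂ u)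
    (e : ∀ u ∈ W, F₁ u = F₂ (τ u)) (hu : u ∈ W) (i : Fin 2) :
    pd i F₁ u = jac τ 0 i u • pd 0 F₂ (τ u) + jac τ 1 i u • pd 1 F₂ (τ u) := by
  rw [pd_congr_of_isOpen r.left.isOpen e i hu, pd_comp (hF _ (r.maps u hu)) (r.smooth u hu),
    Fin.sum_univ_two]
  rfl

theorem yLam_eq (r : IsReparam W U f₁ ν₁ f₂ ν₂ τ) (lam : E4 → ℝ) (u : Coord 2) (hu : u ∈ W) :
    yLam f₁ lam u = yLam f₂ lam (τ u) := by
  rw [yLam, yLam, r.eq u hu]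

/-- The square of the conformal factor of `τ`. -/
def ratio (f₁ f₂ : Coord 2 → E4) (τ : Coord 2 → Coord 2) (u : Coord 2) : ℝ :=
  confE f₁ (fun _ => 1) u / confE f₂ (fun _ => 1) (τ u)

theorem confE_eq (r : IsReparam W U f₁ ν₁ f₂ ν₂ τ) (lam : E4 → ℝ) (hu : u ∈ W) :
    confE f₁ lam u = ratio f₁ f₂ τ u * confE f₂ lam (τ u) := by
  have hp := (r.right.pos _ (r.maps u hu)).ne'
  simp only [ratio, confE, r.eq u hu]
  field_simp

theorem ratio_pos (r : IsReparam W U f₁ ν₁ f₂ ν₂ τ) (hu : u ∈ W) : 0 < ratio f₁ f₂ τ u :=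
  div_pos (r.left.confE_pos isConformalFactor_one hu)
    (r.right.confE_pos isConformalFactor_one (r.maps u hu))

/-- Both coordinates are isothermal for the same metric, so the Jacobian satisfies JᵀJ = k with k
the ratio of the two factors. -/
theorem jac_col (r : IsReparam W U f₁ ν₁ f₂ ν₂ τ) (hu : u ∈ W) :
    jac τ 0 0 u * jac τ 0 0 u + jac τ 1 0 u * jac τ 1 0 u = ratio f₁ f₂ τ u ∧
    jac τ 0 1 u * jac τ 0 1 u + jac τ 1 1 u * jac τ 1 1 u = ratio f₁ f₂ τ u ∧
    jac τ 0 0 u * jac τ 0 1 u + jac τ 1 0 u * jac τ 1 1 u = 0 := by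
  have hl := isConformalFactor_one
  have hE := r.right.confE_pos hl (r.maps u hu)
  have hy := fun i => r.pd_pullback (fun u hu => r.right.smooth_yLam hl hu)
    (r.yLam_eq fun _ => 1) hu i
  have g : ∀ i j, lor (pd i (yLam f₁ (fun _ => 1)) u) (pd j (yLam f₁ (fun _ => 1)) u)
      = (jac τ 0 i u * jac τ 0 j u + jac τ 1 i u * jac τ 1 j u) * confE f₂ (fun _ => 1) (τ u) := by
    intro i j
    rw [hy, hy]
    have o := r.right.lor_pd_yLam_orth hl (r.maps u hu)
    have o' := o
    rw [lor_comm] at o'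
    simp only [lor_add_left, lor_add_right, lor_smul_left, lor_smul_right,
      r.right.lor_pd_yLam_self hl (r.maps u hu), o, o']
    ring
  have g00 := g 0 0
  have g11 := g 1 1
  have g01 := g 0 1
  rw [r.left.lor_pd_yLam_self hl hu] at g00 g11
  rw [r.left.lor_pd_yLam_orth hl hu] at g01
  refine ⟨?_, ?_, ?_⟩
  · rw [ratio, g00, mul_div_cancel_right₀ _ hE.ne']
  · rw [ratio, g11, mul_div_cancel_right₀ _ hE.ne']
  · exact (mul_eq_zero.mp g01.symm).resolve_right hE.ne'

/-- A left inverse of a square matrix is a right inverse, so JᵀJ = k gives JJᵀ = k. Traces over the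
first coordinate contract J in this second form. -/
theorem jac_row (r : IsReparam W U f₁ ν₁ f₂ ν₂ τ) (hu : u ∈ W) :
    jac τ 0 0 u * jac τ 0 0 u + jac τ 0 1 u * jac τ 0 1 u = ratio f₁ f₂ τ u ∧
    jac τ 1 0 u * jac τ 1 0 u + jac τ 1 1 u * jac τ 1 1 u = ratio f₁ f₂ τ u ∧
    jac τ 0 0 u * jac τ 1 0 u + jac τ 0 1 u * jac τ 1 1 u = 0 := by
  obtain ⟨h1, h2, h3⟩ := r.jac_col hu
  have hk := r.ratio_pos hu
  generalize jac τ 0 0 u = a at *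
  generalize jac τ 0 1 u = b at *
  generalize jac τ 1 0 u = c at *
  generalize jac τ 1 1 u = d at *
  generalize ratio f₁ f₂ τ u = k at *
  have e : (!![a, c; b, d] * !![a, b; c, d] : Matrix (Fin 2) (Fin 2) ℝ) = k • 1 := by
    ext i j
    fin_cases i <;> fin_cases j <;> simp [Matrix.mul_apply, Fin.sum_univ_two] <;> linarith
  have e1 : (k⁻¹ • !![a, c; b, d]) * (!![a, b; c, d] : Matrix (Fin 2) (Fin 2) ℝ) = 1 := by
    rw [Matrix.smul_mul, e, smul_smul, inv_mul_cancel₀ hk.ne', one_smul]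
  have e2 := mul_eq_one_comm.mp e1
  rw [Matrix.mul_smul] at e2
  have e3 : (!![a, b; c, d] * !![a, c; b, d] : Matrix (Fin 2) (Fin 2) ℝ) = k • 1 := by
    rw [← e2, smul_smul, mul_inv_cancel₀ hk.ne', one_smul]
  have f00 := congrFun (congrFun e3 0) 0
  have f11 := congrFun (congrFun e3 1) 1
  have f01 := congrFun (congrFun e3 0) 1
  simp [Matrix.mul_apply, Fin.sum_univ_two] at f00 f11 f01
  exact ⟨f00, f11, f01⟩

theorem smooth_jac (r : IsReparam W U f₁ ν₁ f₂ ν₂ τ) (hu : u ∈ W) (k i : Fin 2) :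
    ContDiffAt ℝ ∞ (jac τ k i) u :=
  contDiffAt_pd ((contDiffAt_coord k _).comp u (r.smooth u hu)) i

/-- The coordinate change is harmonic. -/
theorem jac_div (r : IsReparam W U f₁ ν₁ f₂ ν₂ τ) (hu : u ∈ W) (k : Fin 2) :
    pd 0 (jac τ k 0) u + pd 1 (jac τ k 1) u = 0 := by
  have s := r.smooth_jac hu
  have hc : ∀ k, ContDiffAt ℝ ∞ (fun b => τ b k) u := fun k =>
    (contDiffAt_coord k _).comp u (r.smooth u hu)
  have m : ∀ k i j, pd i (jac τ k j) u = pd j (jac τ k i) u := fun k i j => pd_comm (hc k) i j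
  have s2 : ∀ a b c d : Fin 2, ContDiffAt ℝ ∞
      (fun u => jac τ a b u * jac τ c d u) u := fun a b c d => (s a b).mul (s c d)
  -- As for ξ, differentiated conformality makes Δτ orthogonal to both columns of J, which is `C0`
  -- and `C1`. Multiplying by J and using JJᵀ = k isolates each component.
  have A : ∀ i, pd i (fun u => jac τ 0 0 u * jac τ 0 0 u + jac τ 1 0 u * jac τ 1 0 u) u
      = pd i (fun u => jac τ 0 1 u * jac τ 0 1 u + jac τ 1 1 u * jac τ 1 1 u) u := fun i =>
    pd_congr_of_isOpen r.left.isOpen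
      (fun b hb => (r.jac_col hb).1.trans (r.jac_col hb).2.1.symm) i hu
  have B : ∀ i, pd i (fun u => jac τ 0 0 u * jac τ 0 1 u + jac τ 1 0 u * jac τ 1 1 u) u = 0 :=
    fun i => pd_eq_zero r.left.isOpen (fun b hb => (r.jac_col hb).2.2) i hu
  have A0 := A 0
  have A1 := A 1
  have B0 := B 0
  have B1 := B 1
  simp only [pd_add (s2 _ _ _ _) (s2 _ _ _ _), pd_mul (s _ _) (s _ _)] at A0 A1 B0 B1
  simp only [m 0 1 0, m 1 1 0] at A1 B1
  obtain ⟨r1, r2, r3⟩ := r.jac_row hu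
  have hk := (r.ratio_pos hu).ne'
  have C0 : (pd 0 (jac τ 0 0) u + pd 1 (jac τ 0 1) u) * jac τ 0 0 u
      + (pd 0 (jac τ 1 0) u + pd 1 (jac τ 1 1) u) * jac τ 1 0 u = 0 := by linarith
  have C1 : (pd 0 (jac τ 0 0) u + pd 1 (jac τ 0 1) u) * jac τ 0 1 u
      + (pd 0 (jac τ 1 0) u + pd 1 (jac τ 1 1) u) * jac τ 1 1 u = 0 := by linarith
  have D0 : (pd 0 (jac τ 0 0) u + pd 1 (jac τ 0 1) u) * ratio f₁ f₂ τ u = 0 := by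
    linear_combination jac τ 0 0 u * C0 + jac τ 0 1 u * C1
      - (pd 0 (jac τ 0 0) u + pd 1 (jac τ 0 1) u) * r1
      - (pd 0 (jac τ 1 0) u + pd 1 (jac τ 1 1) u) * r3
  have D1 : (pd 0 (jac τ 1 0) u + pd 1 (jac τ 1 1) u) * ratio f₁ f₂ τ u = 0 := by
    linear_combination jac τ 1 0 u * C0 + jac τ 1 1 u * C1
      - (pd 0 (jac τ 1 0) u + pd 1 (jac τ 1 1) u) * r2
      - (pd 0 (jac τ 0 0) u + pd 1 (jac τ 0 1) u) * r3
  exact forall_fin_two' (p := fun k => pd 0 (jac τ k 0) u + pd 1 (jac τ k 1) u = 0)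
    ((mul_eq_zero.mp D0).resolve_right hk) ((mul_eq_zero.mp D1).resolve_right hk) k

theorem lor_pullback (r : IsReparam W U f₁ ν₁ f₂ ν₂ τ) {F₁ F₂ G₁ G₂ : Coord 2 → Mink}
    (hF : ∀ u ∈ U, ContDiffAt ℝ ∞ F₂ u) (hG : ∀ u ∈ U, ContDiffAt ℝ ∞ G₂ u)
    (eF : ∀ u ∈ W, F₁ u = F₂ (τ u)) (eG : ∀ u ∈ W, G₁ u = G₂ (τ u)) (hu : u ∈ W) (i j : Fin 2) :
    lor (pd i F₁ u) (pd j G₁ u)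
      = jac τ 0 i u * jac τ 0 j u * lor (pd 0 F₂ (τ u)) (pd 0 G₂ (τ u))
        + jac τ 0 i u * jac τ 1 j u * lor (pd 0 F₂ (τ u)) (pd 1 G₂ (τ u))
        + jac τ 1 i u * jac τ 0 j u * lor (pd 1 F₂ (τ u)) (pd 0 G₂ (τ u))
        + jac τ 1 i u * jac τ 1 j u * lor (pd 1 F₂ (τ u)) (pd 1 G₂ (τ u)) := by
  rw [r.pd_pullback hF eF hu, r.pd_pullback hG eG hu]
  simp only [lor_add_left, lor_add_right, lor_smul_left, lor_smul_right]
  ring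

/-- The pulled-back map satisfies the characterization of the Gauss map of f₁: the trace of ⟨ξ_i,
y_j⟩ is multiplied by k and so stays zero. -/
theorem gaussMap_eq (r : IsReparam W U f₁ ν₁ f₂ ν₂ τ) (u : Coord 2) (hu : u ∈ W) :
    gaussMap f₁ ν₁ u = gaussMap f₂ ν₂ (τ u) := by
  have hl := isConformalFactor_one
  have hs : ∀ u ∈ U, ContDiffAt ℝ ∞ (gaussMap f₂ ν₂) u := fun u hu => r.right.smooth_gaussMap hu
  refine (r.left.eq_gaussMap hl (η := fun u => gaussMap f₂ ν₂ (τ u))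
    (fun u hu => r.smooth_comp hs hu) (fun u hu => ?_) (fun u hu => ?_) hu).symm
  · have : (gaussMap f₂ ν₂ (τ u)).1 = meanCurv f₂ ν₂ (fun _ => 1) (τ u) := by simp [gaussMap]
    rw [this, r.eq u hu, r.eq_normal u hu, gaussMap, add_comm]
  · have e := fun i => r.lor_pullback (F₁ := fun u => gaussMap f₂ ν₂ (τ u)) hs
      (fun u hu => r.right.smooth_yLam hl hu) (fun _ _ => rfl) (r.yLam_eq fun _ => 1) hu i i
    obtain ⟨r1, r2, r3⟩ := r.jac_row hu
    have t := r.right.OmegaT_trace hl (r.maps u hu)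
    rw [OmegaT, OmegaT] at t
    rw [e 0, e 1]
    linear_combination lor (pd 0 (gaussMap f₂ ν₂) (τ u)) (pd 0 (yLam f₂ fun _ => 1) (τ u)) * r1
      + lor (pd 1 (gaussMap f₂ ν₂) (τ u)) (pd 1 (yLam f₂ fun _ => 1) (τ u)) * r2
      + (lor (pd 0 (gaussMap f₂ ν₂) (τ u)) (pd 1 (yLam f₂ fun _ => 1) (τ u))
        + lor (pd 1 (gaussMap f₂ ν₂) (τ u)) (pd 0 (yLam f₂ fun _ => 1) (τ u))) * r3
      - ratio f₁ f₂ τ u * t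

theorem yStar_eq (r : IsReparam W U f₁ ν₁ f₂ ν₂ τ) (hl : IsConformalFactor lam) (u : Coord 2)
    (hu : u ∈ W) : yStar f₁ ν₁ lam u = yStar f₂ ν₂ lam (τ u) := by
  obtain ⟨h1, h2, h3, h4⟩ := r.right.yStar_spec hl (r.maps u hu)
  refine (r.left.eq_yStar hl hu ⟨?_, h2, ?_, fun i => ?_⟩).symm
  · rw [r.yLam_eq lam u hu, h1]
  · rw [r.gaussMap_eq u hu, h3]
  · rw [r.pd_pullback (fun u hu => r.right.smooth_gaussMap hu) r.gaussMap_eq hu, lor_add_right,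
      lor_smul_right, lor_smul_right, h4, h4]
    ring

theorem OmegaT_pullback (r : IsReparam W U f₁ ν₁ f₂ ν₂ τ) (hl : IsConformalFactor lam)
    (hu : u ∈ W) (i j : Fin 2) : OmegaT f₁ ν₁ lam i j u
      = jac τ 0 i u * jac τ 0 j u * OmegaT f₂ ν₂ lam 0 0 (τ u)
        + jac τ 0 i u * jac τ 1 j u * OmegaT f₂ ν₂ lam 0 1 (τ u)
        + jac τ 1 i u * jac τ 0 j u * OmegaT f₂ ν₂ lam 1 0 (τ u)
        + jac τ 1 i u * jac τ 1 j u * OmegaT f₂ ν₂ lam 1 1 (τ u) := by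
  simp only [OmegaT]
  rw [r.lor_pullback (fun u hu => r.right.smooth_gaussMap hu)
    (fun u hu => r.right.smooth_yLam hl hu) r.gaussMap_eq (r.yLam_eq lam) hu]
  ring

theorem OmegaStar_pullback (r : IsReparam W U f₁ ν₁ f₂ ν₂ τ) (hl : IsConformalFactor lam)
    (hu : u ∈ W) (i j : Fin 2) : OmegaStar f₁ ν₁ lam i j u
      = jac τ 0 i u * jac τ 0 j u * OmegaStar f₂ ν₂ lam 0 0 (τ u)
        + jac τ 0 i u * jac τ 1 j u * OmegaStar f₂ ν₂ lam 0 1 (τ u)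
        + jac τ 1 i u * jac τ 0 j u * OmegaStar f₂ ν₂ lam 1 0 (τ u)
        + jac τ 1 i u * jac τ 1 j u * OmegaStar f₂ ν₂ lam 1 1 (τ u) := by
  simp only [OmegaStar]
  rw [r.lor_pullback (fun u hu => r.right.smooth_gaussMap hu)
    (fun u hu => r.right.smooth_yStar hl hu) r.gaussMap_eq (r.yStar_eq hl) hu]
  ring

theorem omegaForm_pullback (r : IsReparam W U f₁ ν₁ f₂ ν₂ τ) (hl : IsConformalFactor lam)
    (hu : u ∈ W) (i : Fin 2) : omegaForm f₁ ν₁ lam i u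
      = jac τ 0 i u * omegaForm f₂ ν₂ lam 0 (τ u) + jac τ 1 i u * omegaForm f₂ ν₂ lam 1 (τ u) := by
  rw [omegaForm, r.pd_pullback (fun u hu => r.right.smooth_yLam hl hu) (r.yLam_eq lam) hu,
    r.yStar_eq hl u hu, lor_add_left, lor_smul_left, lor_smul_left]
  rfl

theorem scriptH_pullback (r : IsReparam W U f₁ ν₁ f₂ ν₂ τ) (hl : IsConformalFactor lam)
    (u : Coord 2) (hu : u ∈ W) : scriptH f₁ ν₁ lam u = scriptH f₂ ν₂ lam (τ u) := by
  have hk := (r.ratio_pos hu).ne'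
  have hE := (r.right.confE_pos hl (r.maps u hu)).ne'
  obtain ⟨r1, r2, r3⟩ := r.jac_row hu
  rw [r.left.scriptH_eq hl hu, r.right.scriptH_eq hl (r.maps u hu), r.OmegaStar_pullback hl hu,
    r.OmegaStar_pullback hl hu, r.confE_eq lam hu]
  field_simp
  linear_combination -OmegaStar f₂ ν₂ lam 0 0 (τ u) * r1 - OmegaStar f₂ ν₂ lam 1 1 (τ u) * r2
    - (OmegaStar f₂ ν₂ lam 0 1 (τ u) + OmegaStar f₂ ν₂ lam 1 0 (τ u)) * r3

theorem traceOmega_pullback (r : IsReparam W U f₁ ν₁ f₂ ν₂ τ) (hl : IsConformalFactor lam)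
    (hu : u ∈ W) : traceOmega f₁ ν₁ lam u = ratio f₁ f₂ τ u * traceOmega f₂ ν₂ lam (τ u) := by
  have hk := (r.ratio_pos hu).ne'
  have hm := (r.right.moebiusFactor_pos (r.maps u hu)).ne'
  obtain ⟨r1, r2, r3⟩ := r.jac_row hu
  obtain ⟨c1, c2, c3⟩ := r.jac_col hu
  have hmm : moebiusFactor f₁ ν₁ u = ratio f₁ f₂ τ u * moebiusFactor f₂ ν₂ (τ u) := by
    have o := r.right.lor_pd_gaussMap_orth (r.maps u hu)
    have o' := o
    rw [lor_comm] at o'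
    rw [moebiusFactor, r.lor_pullback (fun u hu => r.right.smooth_gaussMap hu)
      (fun u hu => r.right.smooth_gaussMap hu) r.gaussMap_eq r.gaussMap_eq hu, o, o',
      r.right.lor_pd_gaussMap_one_one (r.maps u hu), moebiusFactor, ← c1]
    ring
  -- This is tr(JᵀOJ · JᵀSJ) = k² tr(OS) for J with rows (a, b) and (c, d) and JJᵀ = k. Division by
  -- m, which scales by k, leaves one factor k.
  have key : ∀ a b c d k o00 o01 o10 o11 s00 s01 s10 s11 : ℝ,
      a * a + b * b = k → c * c + d * d = k → a * c + b * d = 0 →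
      (a * a * o00 + a * c * o01 + c * a * o10 + c * c * o11)
          * (a * a * s00 + a * c * s01 + c * a * s10 + c * c * s11)
        + (a * b * o00 + a * d * o01 + c * b * o10 + c * d * o11)
          * (b * a * s00 + b * c * s01 + d * a * s10 + d * c * s11)
        + (b * a * o00 + b * c * o01 + d * a * o10 + d * c * o11)
          * (a * b * s00 + a * d * s01 + c * b * s10 + c * d * s11)
        + (b * b * o00 + b * d * o01 + d * b * o10 + d * d * o11)
          * (b * b * s00 + b * d * s01 + d * b * s10 + d * d * s11)
        = k * k * (o00 * s00 + o01 * s10 + o10 * s01 + o11 * s11) := by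
    intro a b c d k o00 o01 o10 o11 s00 s01 s10 s11 h1 h2 h3
    have e : (a * a * o00 + a * c * o01 + c * a * o10 + c * c * o11)
          * (a * a * s00 + a * c * s01 + c * a * s10 + c * c * s11)
        + (a * b * o00 + a * d * o01 + c * b * o10 + c * d * o11)
          * (b * a * s00 + b * c * s01 + d * a * s10 + d * c * s11)
        + (b * a * o00 + b * c * o01 + d * a * o10 + d * c * o11)
          * (a * b * s00 + a * d * s01 + c * b * s10 + c * d * s11)
        + (b * b * o00 + b * d * o01 + d * b * o10 + d * d * o11)
          * (b * b * s00 + b * d * s01 + d * b * s10 + d * d * s11)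
        = (a * a + b * b) * ((a * a + b * b) * (o00 * s00) + (a * c + b * d)
            * (o00 * s01 + o10 * s00 + o01 * s00 + o00 * s10) + (c * c + d * d)
            * (o01 * s10 + o10 * s01))
          + (a * c + b * d) * ((a * c + b * d) * (o00 * s11 + o11 * s00 + o01 * s01 + o10 * s10)
            + (c * c + d * d) * (o01 * s11 + o10 * s11 + o11 * s01 + o11 * s10))
          + (c * c + d * d) * (c * c + d * d) * (o11 * s11) := by ring
    rw [e, h1, h2, h3]
    ring
  simp only [traceOmega, r.OmegaT_pullback hl hu, r.OmegaStar_pullback hl hu, hmm]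
  rw [key _ _ _ _ _ _ _ _ _ _ _ _ _ r1 r2 r3]
  field_simp

/-- Derivatives of J enter only through Σ ∂_i J_ki, which is zero by harmonicity of τ. The remaining
terms contract to JJᵀ = k. -/
theorem weightedLaplace_pullback (r : IsReparam W U f₁ ν₁ f₂ ν₂ τ) (hl : IsConformalFactor lam)
    (hu : u ∈ W) : weightedLaplace f₁ ν₁ lam (scriptH f₁ ν₁ lam) u
      = ratio f₁ f₂ τ u * weightedLaplace f₂ ν₂ lam (scriptH f₂ ν₂ lam) (τ u) := by
  have hh : ∀ u ∈ U, ContDiffAt ℝ ∞ (scriptH f₂ ν₂ lam) u := fun u hu => r.right.smooth_scriptH hl hu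
  have hg := fun k u (hu : u ∈ U) => r.right.smooth_weightedGrad hl hu (hh u hu) k
  have g : ∀ i, ∀ u ∈ W, weightedGrad f₁ ν₁ lam (scriptH f₁ ν₁ lam) i u
      = jac τ 0 i u * weightedGrad f₂ ν₂ lam (scriptH f₂ ν₂ lam) 0 (τ u)
        + jac τ 1 i u * weightedGrad f₂ ν₂ lam (scriptH f₂ ν₂ lam) 1 (τ u) := by
    intro i u hu
    simp only [weightedGrad]
    rw [r.pd_pullback hh (r.scriptH_pullback hl) hu,
      r.omegaForm_pullback hl hu, r.scriptH_pullback hl u hu]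
    simp only [smul_eq_mul]
    ring
  have d : ∀ i, pd i (weightedGrad f₁ ν₁ lam (scriptH f₁ ν₁ lam) i) u
      = (jac τ 0 i u * (jac τ 0 i u * pd 0 (weightedGrad f₂ ν₂ lam (scriptH f₂ ν₂ lam) 0) (τ u)
          + jac τ 1 i u * pd 1 (weightedGrad f₂ ν₂ lam (scriptH f₂ ν₂ lam) 0) (τ u))
        + pd i (jac τ 0 i) u * weightedGrad f₂ ν₂ lam (scriptH f₂ ν₂ lam) 0 (τ u))
      + (jac τ 1 i u * (jac τ 0 i u * pd 0 (weightedGrad f₂ ν₂ lam (scriptH f₂ ν₂ lam) 1) (τ u)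
          + jac τ 1 i u * pd 1 (weightedGrad f₂ ν₂ lam (scriptH f₂ ν₂ lam) 1) (τ u))
        + pd i (jac τ 1 i) u * weightedGrad f₂ ν₂ lam (scriptH f₂ ν₂ lam) 1 (τ u)) := by
    intro i
    have s := r.smooth_jac hu
    have c0 := r.smooth_comp (hg 0) hu
    have c1 := r.smooth_comp (hg 1) hu
    have m0 : ContDiffAt ℝ ∞ (fun u => jac τ 0 i u
      * weightedGrad f₂ ν₂ lam (scriptH f₂ ν₂ lam) 0 (τ u)) u := (s 0 i).mul c0
    have m1 : ContDiffAt ℝ ∞ (fun u => jac τ 1 i u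
      * weightedGrad f₂ ν₂ lam (scriptH f₂ ν₂ lam) 1 (τ u)) u := (s 1 i).mul c1
    rw [pd_congr_of_isOpen r.left.isOpen (g i) i hu, pd_add m0 m1, pd_mul (s 0 i) c0,
      pd_mul (s 1 i) c1, r.pd_pullback (hg 0) (fun _ _ => rfl) hu,
      r.pd_pullback (hg 1) (fun _ _ => rfl) hu]
    rfl
  obtain ⟨r1, r2, r3⟩ := r.jac_row hu
  have j0 := r.jac_div hu 0
  have j1 := r.jac_div hu 1
  rw [weightedLaplace, weightedLaplace, d, d, omegaDot, omegaDot, g 0 u hu, g 1 u hu,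
    r.omegaForm_pullback hl hu, r.omegaForm_pullback hl hu]
  generalize weightedGrad f₂ ν₂ lam (scriptH f₂ ν₂ lam) 0 = X at *
  generalize weightedGrad f₂ ν₂ lam (scriptH f₂ ν₂ lam) 1 = Y at *
  linear_combination X (τ u) * j0 + Y (τ u) * j1
    + (pd 0 X (τ u) - 3 * omegaForm f₂ ν₂ lam 0 (τ u) * X (τ u)) * r1
    + (pd 1 Y (τ u) - 3 * omegaForm f₂ ν₂ lam 1 (τ u) * Y (τ u)) * r2
    + (pd 1 X (τ u) + pd 0 Y (τ u) - 3 * omegaForm f₂ ν₂ lam 1 (τ u) * X (τ u)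
      - 3 * omegaForm f₂ ν₂ lam 0 (τ u) * Y (τ u)) * r3

theorem invariantFive_eq (r : IsReparam W U f₁ ν₁ f₂ ν₂ τ) (hl : IsConformalFactor lam)
    (hu : u ∈ W) : invariantFive f₁ ν₁ lam u = invariantFive f₂ ν₂ lam (τ u) := by
  have hk := (r.ratio_pos hu).ne'
  have hE := (r.right.confE_pos hl (r.maps u hu)).ne'
  rw [r.left.invariantFive_eq hl hu, r.right.invariantFive_eq hl (r.maps u hu),
    r.weightedLaplace_pullback hl hu, r.traceOmega_pullback hl hu, r.scriptH_pullback hl u hu,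
    r.confE_eq lam hu]
  field_simp

end IsReparam

end AssocSurface

end

noncomputable section

namespace AssocSurface

/-! ### Conformal transformations -/

/-- `f'` with normal `ν'` is the image of `f` with normal `ν` under the conformal transformation
that is given by the Lorentz transformation `L`. -/
structure IsLorentzImage (U : Set (Coord 2)) (L : Mink →ₗ[ℝ] Mink) (f ν f' ν' : Coord 2 → E4) :
    Prop where
  patch : IsoPatch U f ν
  isometry : ∀ v w, lor (L v) (L w) = lor v w
  smooth : ∀ u ∈ U, ContDiffAt ℝ ∞ f' u
  smooth_normal : ∀ u ∈ U, ContDiffAt ℝ ∞ ν' u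
  pos : ∀ u ∈ U, 0 < (L (1, f u)).1
  point : ∀ u ∈ U, L (1, f u) = (L (1, f u)).1 • (1, f' u)
  normal : ∀ u ∈ U, ∃ b : ℝ, L (0, ν u) = (0, ν' u) + b • ((1, f' u) : Mink)

theorem contDiffAt_linear {d : ℕ} (L : Mink →ₗ[ℝ] Mink) {F : Coord d → Mink} {c : Coord d}
    (hF : ContDiffAt ℝ ∞ F c) : ContDiffAt ℝ ∞ (fun b => L (F b)) c :=
  (LinearMap.toContinuousLinearMap L).contDiff.contDiffAt.comp c hF

theorem pd_linear {d : ℕ} (L : Mink →ₗ[ℝ] Mink) {F : Coord d → Mink} {c : Coord d}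
    (hF : ContDiffAt ℝ ∞ F c) (i : Fin d) : pd i (fun b => L (F b)) c = L (pd i F c) :=
  pd_clm_apply (LinearMap.toContinuousLinearMap L) hF i

namespace IsLorentzImage

variable {U : Set (Coord 2)} {L : Mink →ₗ[ℝ] Mink} {f ν f' ν' : Coord 2 → E4}
  {lam mu : E4 → ℝ} {u : Coord 2}

theorem light_null (r : IsLorentzImage U L f ν f' ν') (hu : u ∈ U) :
    lor (1, f' u) (1, f' u) = 0 := by
  have e := lor_light (r.patch.unit u hu)
  have hp := (r.pos u hu).ne'
  rw [← r.isometry, r.point u hu, lor_smul_left, lor_smul_right] at e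
  simpa [hp] using e

theorem unit_image (r : IsLorentzImage U L f ν f' ν') (hu : u ∈ U) : ‖f' u‖ = 1 := by
  have e := r.light_null hu
  simp only [lor, real_inner_self_eq_norm_sq] at e
  have : ‖f' u‖ ^ 2 = 1 := by linarith
  nlinarith [norm_nonneg (f' u)]

theorem normal_light (r : IsLorentzImage U L f ν f' ν') (hu : u ∈ U) :
    lor (0, ν' u) (1, f' u) = 0 := by
  obtain ⟨b, hb⟩ := r.normal u hu
  have hp := (r.pos u hu).ne'
  have e : lor (L (0, ν u)) (L (1, f u)) = 0 := by
    rw [r.isometry, lor_spatial_light, r.patch.normal_point u hu]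
  rw [hb, r.point u hu, lor_smul_right, lor_add_left, lor_smul_left, r.light_null hu] at e
  simpa [hp] using e

theorem unit_normal_image (r : IsLorentzImage U L f ν f' ν') (hu : u ∈ U) : ‖ν' u‖ = 1 := by
  obtain ⟨b, hb⟩ := r.normal u hu
  have e : lor (L (0, ν u)) (L (0, ν u)) = 1 := by
    rw [r.isometry, lor_spatial, r.patch.inner_self_normal hu]
  rw [hb] at e
  simp only [lor_add_left, lor_add_right, lor_smul_left, lor_smul_right, r.light_null hu,
    r.normal_light hu, lor_comm (1, f' u) (0, ν' u), lor_spatial, real_inner_self_eq_norm_sq] at e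
  have : ‖ν' u‖ ^ 2 = 1 := by linarith
  nlinarith [norm_nonneg (ν' u)]

theorem smooth_light (r : IsLorentzImage U L f ν f' ν') (hu : u ∈ U) :
    ContDiffAt ℝ ∞ (fun b => ((1, f' b) : Mink)) u :=
  contDiffAt_const.prodMk (r.smooth u hu)

theorem smooth_spatial (r : IsLorentzImage U L f ν f' ν') (hu : u ∈ U) :
    ContDiffAt ℝ ∞ (fun b => ((0, ν' b) : Mink)) u :=
  contDiffAt_const.prodMk (r.smooth_normal u hu)

theorem light_pd (r : IsLorentzImage U L f ν f' ν') (hu : u ∈ U) (i : Fin 2) :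
    lor (1, f' u) (0, pd i f' u) = 0 := by
  have e := lor_pd_of_const r.patch.isOpen (fun _ hb => r.smooth_light hb)
    (fun _ hb => r.smooth_light hb) (fun b hb => r.light_null hb) hu i
  rw [pd_light (r.smooth u hu), lor_comm] at e
  linarith

theorem pd_point (r : IsLorentzImage U L f ν f' ν') (hu : u ∈ U) (i : Fin 2) :
    L (0, pd i f u) = (L (1, f u)).1 • (0, pd i f' u)
      + pd i (fun b => (L (1, f b)).1) u • (1, f' u) := by
  have s := r.patch.smooth_light hu
  rw [← pd_light (r.patch.smooth u hu), ← pd_linear L s,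
    pd_congr_of_isOpen r.patch.isOpen r.point i hu,
    pd_smul (contDiffAt_linear L s).fst (r.smooth_light hu), pd_light (r.smooth u hu)]

theorem inner_pd (r : IsLorentzImage U L f ν f' ν') (hu : u ∈ U) (i j : Fin 2) :
    inner ℝ (pd i f u) (pd j f u)
      = (L (1, f u)).1 ^ 2 * inner ℝ (pd i f' u) (pd j f' u) := by
  have l := fun i => r.light_pd hu i
  rw [← lor_spatial, ← r.isometry, r.pd_point hu, r.pd_point hu]
  simp only [lor_add_left, lor_add_right, lor_smul_left, lor_smul_right, r.light_null hu, l,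
    lor_comm (0, pd i f' u) (1, f' u), lor_spatial]
  ring

theorem normal_pd (r : IsLorentzImage U L f ν f' ν') (hu : u ∈ U) (i : Fin 2) :
    inner ℝ (ν' u) (pd i f' u) = 0 := by
  obtain ⟨b, hb⟩ := r.normal u hu
  have hp := (r.pos u hu).ne'
  have e : lor (L (0, ν u)) (L (0, pd i f u)) = 0 := by
    rw [r.isometry, lor_spatial, r.patch.normal_tangent u hu]
  rw [hb, r.pd_point hu] at e
  simp only [lor_add_left, lor_add_right, lor_smul_left, lor_smul_right, r.light_null hu,
    r.light_pd hu, r.normal_light hu, lor_spatial] at e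
  simpa [hp] using e

theorem gaussMap_form (r : IsLorentzImage U L f ν f' ν') (u : Coord 2) (hu : u ∈ U) :
    L (gaussMap f ν u) = (0, ν' u) + (L (gaussMap f ν u)).1 • ((1, f' u) : Mink) := by
  obtain ⟨b, hb⟩ := r.normal u hu
  have e : L (gaussMap f ν u) = (0, ν' u)
      + (meanCurv f ν (fun _ => 1) u * (L (1, f u)).1 + b) • ((1, f' u) : Mink) := by
    rw [gaussMap, map_add, map_smul, hb, add_smul, mul_smul, ← r.point u hu]
    abel
  have e1 : (L (gaussMap f ν u)).1 = meanCurv f ν (fun _ => 1) u * (L (1, f u)).1 + b := by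
    conv_lhs => rw [e]
    simp
  rw [e1]
  exact e

theorem smooth_gaussMap (r : IsLorentzImage U L f ν f' ν') (hu : u ∈ U) :
    ContDiffAt ℝ ∞ (fun b => L (gaussMap f ν b)) u :=
  contDiffAt_linear L (r.patch.smooth_gaussMap hu)

/-- This expresses Ω_1 of f through the fundamental forms of the image, so that an umbilic of f'
would make Ω_1 vanish. -/
theorem OmegaT_image (r : IsLorentzImage U L f ν f' ν') (hu : u ∈ U) (i j : Fin 2) :
    OmegaT f ν (fun _ => 1) i j u = -(L (1, f u)).1 *
      (inner ℝ (pd j f' u) (pd i ν' u)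
        + (L (gaussMap f ν u)).1 * inner ℝ (pd j f' u) (pd i f' u)) := by
  have hc := (r.smooth_gaussMap hu).fst
  have s : ContDiffAt ℝ ∞ (fun b => (L (gaussMap f ν b)).1 • ((1, f' b) : Mink)) u :=
    hc.smul (r.smooth_light hu)
  have d : L (pd i (gaussMap f ν) u) = (0, pd i ν' u)
      + ((L (gaussMap f ν u)).1 • (0, pd i f' u)
        + pd i (fun b => (L (gaussMap f ν b)).1) u • (1, f' u)) := by
    rw [← pd_linear L (r.patch.smooth_gaussMap hu),
      pd_congr_of_isOpen r.patch.isOpen r.gaussMap_form i hu, pd_add (r.smooth_spatial hu) s,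
      pd_smul hc (r.smooth_light hu), pd_light (r.smooth u hu),
      pd_prodMk contDiffAt_const (r.smooth_normal u hu), pd_const]
  have n : lor (0, pd i ν' u) (1, f' u) = 0 := by
    have e := lor_pd_of_const r.patch.isOpen (fun _ hb => r.smooth_spatial hb)
      (fun _ hb => r.smooth_light hb) (fun b hb => r.normal_light hb) hu i
    rw [pd_prodMk contDiffAt_const (r.smooth_normal u hu), pd_const, pd_light (r.smooth u hu),
      lor_spatial, r.normal_pd hu] at e
    rw [e, neg_zero]
  rw [OmegaT, r.patch.pd_yLam isConformalFactor_one hu, pd_const, zero_smul, add_zero, one_smul,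
    ← r.isometry, d, r.pd_point hu]
  simp only [lor_add_left, lor_add_right, lor_smul_left, lor_smul_right, r.light_null hu,
    r.light_pd hu, n, lor_comm (0, pd i f' u) (1, f' u), lor_spatial,
    real_inner_comm (pd j f' u)]
  ring

/-- The image is a surface in an isothermal coordinate again. -/
theorem isoPatch (r : IsLorentzImage U L f ν f' ν') : IsoPatch U f' ν' where
  isOpen := r.patch.isOpen
  smooth := r.smooth
  smooth_normal := r.smooth_normal
  unit := fun _ hu => r.unit_image hu
  unit_normal := fun _ hu => r.unit_normal_image hu
  normal_point := fun u hu => by rw [← lor_spatial_light]; exact r.normal_light hu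
  normal_tangent := fun _ hu i => r.normal_pd hu i
  orth := fun u hu => by
    have e := r.inner_pd hu 0 1
    rw [r.patch.orth u hu] at e
    exact (mul_eq_zero.mp e.symm).resolve_left (pow_ne_zero 2 (r.pos u hu).ne')
  conf := fun u hu => by
    have e := r.patch.conf u hu
    rw [r.inner_pd hu, r.inner_pd hu] at e
    exact mul_left_cancel₀ (pow_ne_zero 2 (r.pos u hu).ne') e
  pos := fun u hu => by
    have e := r.patch.pos u hu
    rw [r.inner_pd hu] at e
    exact pos_of_mul_pos_right e (sq_nonneg _)
  -- At an umbilic of the image, Ω_10 = 0 and Ω_00 = Ω_11; with zero trace this gives Em = 0,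
  -- against m > 0.
  not_umbilic := fun u hu => by
    rintro ⟨h1, h2⟩
    have hl := isConformalFactor_one
    have e0 := r.OmegaT_image hu 1 0
    have e1 := r.OmegaT_image hu 0 0
    have e2 := r.OmegaT_image hu 1 1
    have o := r.inner_pd hu 0 1
    have c := r.patch.conf u hu
    rw [r.patch.orth u hu] at o
    rw [r.inner_pd hu, r.inner_pd hu] at c
    have o' := (mul_eq_zero.mp o.symm).resolve_left (pow_ne_zero 2 (r.pos u hu).ne')
    have c' := mul_left_cancel₀ (pow_ne_zero 2 (r.pos u hu).ne') c
    rw [h1, o'] at e0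
    rw [h2, c', ← e2] at e1
    have t := r.patch.OmegaT_trace hl hu
    have m := r.patch.confE_mul_moebiusFactor hl hu
    have p := mul_pos (r.patch.confE_pos hl hu) (r.patch.moebiusFactor_pos hu)
    have z : OmegaT f ν (fun _ => 1) 0 0 u = 0 := by linarith
    rw [m, r.patch.OmegaT_symm hl hu 0 1, e0, z] at p
    norm_num at p

/-- The map Lξ has the required form (0, ν') + c(1, f'), and the trace condition persists because L
is an isometry that takes y_λ to y_μ of the image. -/
theorem gaussMap_eq (r : IsLorentzImage U L f ν f' ν') (hl : IsConformalFactor lam)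
    (hm : IsConformalFactor mu) (hy : ∀ u ∈ U, yLam f' mu u = L (yLam f lam u)) (u : Coord 2)
    (hu : u ∈ U) : gaussMap f' ν' u = L (gaussMap f ν u) := by
  refine (r.isoPatch.eq_gaussMap hm (fun u hu => r.smooth_gaussMap hu) r.gaussMap_form
    (fun u hu => ?_) hu).symm
  have t := r.patch.OmegaT_trace hl hu
  rw [OmegaT, OmegaT] at t
  have e : ∀ i, pd i (yLam f' mu) u = L (pd i (yLam f lam) u) := fun i => by
    rw [pd_congr_of_isOpen r.patch.isOpen hy i hu, pd_linear L (r.patch.smooth_yLam hl hu)]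
  rw [e, e, pd_linear L (r.patch.smooth_gaussMap hu), pd_linear L (r.patch.smooth_gaussMap hu),
    r.isometry, r.isometry]
  linarith

theorem invariantFive_eq (r : IsLorentzImage U L f ν f' ν') (hl : IsConformalFactor lam)
    (hm : IsConformalFactor mu) (hy : ∀ u ∈ U, yLam f' mu u = L (yLam f lam u))
    (hu : u ∈ U) : invariantFive f' ν' mu u = invariantFive f ν lam u := by
  have hU := r.patch.isOpen
  have p := r.isoPatch
  have dy : ∀ i, ∀ u ∈ U, pd i (yLam f' mu) u = L (pd i (yLam f lam) u) := fun i u hu => by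
    rw [pd_congr_of_isOpen hU hy i hu, pd_linear L (r.patch.smooth_yLam hl hu)]
  have dg : ∀ i, ∀ u ∈ U, pd i (gaussMap f' ν') u = L (pd i (gaussMap f ν) u) := fun i u hu => by
    rw [pd_congr_of_isOpen hU (r.gaussMap_eq hl hm hy) i hu,
      pd_linear L (r.patch.smooth_gaussMap hu)]
  have ys : ∀ u ∈ U, yStar f' ν' mu u = L (yStar f ν lam u) := by
    intro u hu
    obtain ⟨h1, h2, h3, h4⟩ := r.patch.yStar_spec hl hu
    refine (p.eq_yStar hm hu ⟨?_, ?_, ?_, fun i => ?_⟩).symm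
    · rw [hy u hu, r.isometry, h1]
    · rw [r.isometry, h2]
    · rw [r.gaussMap_eq hl hm hy u hu, r.isometry, h3]
    · rw [dg i u hu, r.isometry, h4]
  have dys : ∀ i, ∀ u ∈ U, pd i (yStar f' ν' mu) u = L (pd i (yStar f ν lam) u) := fun i u hu => by
    rw [pd_congr_of_isOpen hU ys i hu, pd_linear L (r.patch.smooth_yStar hl hu)]
  have w : ∀ i, ∀ u ∈ U, omegaForm f' ν' mu i u = omegaForm f ν lam i u := fun i u hu => by
    rw [omegaForm, dy i u hu, ys u hu, r.isometry, omegaForm]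
  have oT : ∀ i j, ∀ u ∈ U, OmegaT f' ν' mu i j u = OmegaT f ν lam i j u := fun i j u hu => by
    rw [OmegaT, dg i u hu, dy j u hu, r.isometry, OmegaT]
  have oS : ∀ i j, ∀ u ∈ U, OmegaStar f' ν' mu i j u = OmegaStar f ν lam i j u := fun i j u hu => by
    rw [OmegaStar, dg i u hu, dys j u hu, r.isometry, OmegaStar]
  have cE : ∀ u ∈ U, confE f' mu u = confE f lam u := fun u hu => by
    rw [← p.lor_pd_yLam_self hm hu 0, dy 0 u hu, r.isometry, r.patch.lor_pd_yLam_self hl hu]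
  have sH : ∀ u ∈ U, scriptH f' ν' mu u = scriptH f ν lam u := fun u hu => by
    rw [p.scriptH_eq hm hu, r.patch.scriptH_eq hl hu, oS _ _ u hu, oS _ _ u hu, cE u hu]
  have wg : ∀ i, ∀ u ∈ U, weightedGrad f' ν' mu (scriptH f' ν' mu) i u
      = weightedGrad f ν lam (scriptH f ν lam) i u := fun i u hu => by
    rw [weightedGrad, pd_congr_of_isOpen hU sH i hu, w i u hu, sH u hu, weightedGrad]
  have hm' : moebiusFactor f' ν' u = moebiusFactor f ν u := by
    rw [moebiusFactor, dg 0 u hu, r.isometry, moebiusFactor]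
  rw [p.invariantFive_eq hm hu, r.patch.invariantFive_eq hl hu, cE u hu, sH u hu, traceOmega,
    traceOmega, oT _ _ u hu, oT _ _ u hu, oT _ _ u hu, oT _ _ u hu, oS _ _ u hu, oS _ _ u hu,
    oS _ _ u hu, oS _ _ u hu, hm', weightedLaplace, weightedLaplace,
    pd_congr_of_isOpen hU (wg 0) 0 hu, pd_congr_of_isOpen hU (wg 1) 1 hu, omegaDot, omegaDot,
    w 0 u hu, w 1 u hu, wg 0 u hu, wg 1 u hu]

end IsLorentzImage

/-! ### The conformal transformation of a Lorentz transformation -/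

section ConformalMap

variable {L : Mink →ₗ[ℝ] Mink} {v : E4}

theorem contDiff_lightLinear (L : Mink →ₗ[ℝ] Mink) :
    ContDiff ℝ ∞ (fun v : E4 => L ((1, v) : Mink)) :=
  (LinearMap.toContinuousLinearMap L).contDiff.comp (contDiff_const.prodMk contDiff_id)

theorem contDiffAt_conformalMap (h0 : (L (1, v)).1 ≠ 0) :
    ContDiffAt ℝ ∞ (conformalMap L) v :=
  ((contDiff_lightLinear L).contDiffAt.fst.inv h0).smul (contDiff_lightLinear L).contDiffAt.snd

theorem linear_eq_conformalMap (h0 : (L (1, v)).1 ≠ 0) :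
    L (1, v) = (L (1, v)).1 • (1, conformalMap L v) := by
  refine Prod.ext (by simp) ?_
  simp [conformalMap, smul_smul, mul_inv_cancel₀ h0]

/-- This is the derivative of L(1, v) = t(v)(1, φ(v)) in direction w, where t(v) is the time
component and φ the conformal map. -/
theorem linear_eq_fderiv_conformalMap (h0 : (L (1, v)).1 ≠ 0) (w : E4) :
    L (0, w) = (L (1, v)).1 • (0, fderiv ℝ (conformalMap L) v w)
      + (L (0, w)).1 • ((1, conformalMap L v) : Mink) := by
  have hl : HasFDerivAt (fun v : E4 => L ((1, v) : Mink))
      ((LinearMap.toContinuousLinearMap L).comp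
        ((0 : E4 →L[ℝ] ℝ).prod (ContinuousLinearMap.id ℝ E4))) v :=
    (LinearMap.toContinuousLinearMap L).hasFDerivAt.comp v
      ((hasFDerivAt_const (1 : ℝ) v).prodMk (hasFDerivAt_id v))
  have hc : HasFDerivAt (conformalMap L) (fderiv ℝ (conformalMap L) v) v :=
    ((contDiffAt_conformalMap h0).differentiableAt (by simp)).hasFDerivAt
  have hs := hl.fst.smul hc
  have ev : (fun v : E4 => (L ((1, v) : Mink)).2)
      =ᶠ[nhds v] fun v => (L ((1, v) : Mink)).1 • conformalMap L v := by
    have hcont : ContinuousAt (fun v : E4 => (L ((1, v) : Mink)).1) v :=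
      (contDiff_lightLinear L).continuous.fst.continuousAt
    filter_upwards [hcont.eventually_ne h0] with b hb
    rw [conformalMap, smul_smul, mul_inv_cancel₀ hb, one_smul]
  have e := (hl.snd.congr_of_eventuallyEq ev.symm).unique hs
  have e' := congrArg (fun A : E4 →L[ℝ] E4 => A w) e
  refine Prod.ext (by simp) ?_
  simpa using e'

end ConformalMap

theorem IsoPatch.isLorentzImage {U : Set (Coord 2)} {L : Mink →ₗ[ℝ] Mink} {f ν : Coord 2 → E4}
    (h : IsoPatch U f ν) (hL : IsLorentz L) :
    IsLorentzImage U L f ν (fun u => conformalMap L (f u))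
      (fun u => ‖fderiv ℝ (conformalMap L) (f u) (ν u)‖⁻¹ • fderiv ℝ (conformalMap L) (f u) (ν u)) := by
  have hpos : ∀ u ∈ U, 0 < (L (1, f u)).1 := fun u hu => hL.2 _ (h.unit u hu)
  have hφ : ∀ u ∈ U, ContDiffAt ℝ ∞ (conformalMap L) (f u) := fun u hu =>
    contDiffAt_conformalMap (hpos u hu).ne'
  -- The unit vector L(0, ν) is t(0, dφ(ν)) plus a multiple of the null vector (1, φ(f)), to which
  -- (0, dφ(ν)) is orthogonal. Hence t|dφ(ν)| = 1.
  have hnorm : ∀ u ∈ U, ‖fderiv ℝ (conformalMap L) (f u) (ν u)‖ = ((L (1, f u)).1)⁻¹ := by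
    intro u hu
    have hp := hpos u hu
    have e1 := linear_eq_conformalMap (L := L) (v := f u) hp.ne'
    have e2 := linear_eq_fderiv_conformalMap (L := L) (v := f u) hp.ne' (ν u)
    have n0 : lor (1, conformalMap L (f u)) (1, conformalMap L (f u)) = 0 := by
      have := lor_light (h.unit u hu)
      rw [← hL.1, e1, lor_smul_left, lor_smul_right] at this
      simpa [hp.ne'] using this
    have n1 : lor (0, fderiv ℝ (conformalMap L) (f u) (ν u)) (1, conformalMap L (f u)) = 0 := by
      have : lor (L (0, ν u)) (L (1, f u)) = 0 := by
        rw [hL.1, lor_spatial_light, h.normal_point u hu]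
      rw [e2, e1, lor_smul_right, lor_add_left, lor_smul_left, lor_smul_left, n0] at this
      simpa [hp.ne'] using this
    have n2 : lor (L (0, ν u)) (L (0, ν u)) = 1 := by
      rw [hL.1, lor_spatial, h.inner_self_normal hu]
    rw [e2] at n2
    simp only [lor_add_left, lor_add_right, lor_smul_left, lor_smul_right, n0, n1,
      lor_comm (1, conformalMap L (f u)) (0, _), lor_spatial, real_inner_self_eq_norm_sq] at n2
    have n3 : ((L (1, f u)).1 * ‖fderiv ℝ (conformalMap L) (f u) (ν u)‖) ^ 2 = 1 := by
      linear_combination n2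
    have n4 : (L (1, f u)).1 * ‖fderiv ℝ (conformalMap L) (f u) (ν u)‖ = 1 :=
      (pow_eq_one_iff_of_nonneg (by positivity) two_ne_zero).mp n3
    exact eq_inv_of_mul_eq_one_right n4
  have hd : ∀ u ∈ U, ContDiffAt ℝ ∞ (fun u => fderiv ℝ (conformalMap L) (f u) (ν u)) u := by
    intro u hu
    have : ContDiffAt ℝ ∞ (fun u => fderiv ℝ (conformalMap L) (f u)) u :=
      ((hφ u hu).fderiv_right (m := ∞) (by simp)).comp u (h.smooth u hu)
    exact this.clm_apply (h.smooth_normal u hu)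
  refine ⟨h, hL.1, fun u hu => (hφ u hu).comp u (h.smooth u hu), fun u hu => ?_, hpos,
    fun u hu => linear_eq_conformalMap (hpos u hu).ne', fun u hu => ?_⟩
  · have h0 : ‖fderiv ℝ (conformalMap L) (f u) (ν u)‖ ≠ 0 := by
      rw [hnorm u hu]; exact inv_ne_zero (hpos u hu).ne'
    exact (((hd u hu).norm ℝ (norm_ne_zero_iff.mp h0)).inv h0).smul (hd u hu)
  · refine ⟨(L (0, ν u)).1, ?_⟩
    rw [hnorm u hu, inv_inv]
    conv_lhs => rw [linear_eq_fderiv_conformalMap (hpos u hu).ne' (ν u)]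
    simp

end AssocSurface

end

noncomputable section

namespace AssocSurface

/-! ### Immersed surfaces in isothermal coordinates -/

theorem pd_inner {d : ℕ} {F G : Coord d → E4} {c : Coord d}
    (hF : ContDiffAt ℝ ∞ F c) (hG : ContDiffAt ℝ ∞ G c) (i : Fin d) :
    pd i (fun b => inner ℝ (F b) (G b)) c
      = inner ℝ (F c) (pd i G c) + inner ℝ (pd i F c) (G c) := by
  simp only [pd]
  rw [fderiv_inner_apply ℝ (differentiableAt_of_smooth hF) (differentiableAt_of_smooth hG)]

/-- Differentiating ⟨N, F_i⟩ = 0 in direction j and using symmetry of the second derivatives of F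
shows that the second fundamental form is symmetric. -/
theorem inner_pd_comm {F : Coord 2 → E4} {U : Set (Coord 2)} (hU : IsOpen U)
    {N : Coord 2 → E4} (hF : ∀ u ∈ U, ContDiffAt ℝ ∞ F u) (hN : ∀ u ∈ U, ContDiffAt ℝ ∞ N u)
    (h : ∀ u ∈ U, ∀ i, inner ℝ (N u) (pd i F u) = 0) {u : Coord 2} (hu : u ∈ U) (i j : Fin 2) :
    inner ℝ (pd i F u) (pd j N u) = inner ℝ (pd j F u) (pd i N u) := by
  have key : ∀ i j, inner ℝ (N u) (pd j (pd i F) u) + inner ℝ (pd j N u) (pd i F u) = 0 := by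
    intro i j
    rw [← pd_inner (hN u hu) (contDiffAt_pd (hF u hu) i) j]
    exact pd_eq_zero hU (fun w hw => h w hw i) j hu
  have h1 := key i j
  have h2 := key j i
  rw [pd_comm (hF u hu) i j] at h2
  rw [real_inner_comm, real_inner_comm (pd i N u)]
  linarith

section Manifold

variable {M : Type*} [TopologicalSpace M] [ChartedSpace (Coord 2) M]
  {e : OpenPartialHomeomorph M (Coord 2)} {F x n : M → E4} {u : Coord 2}

theorem contDiffAt_inChart (he : e ∈ IsManifold.maximalAtlas (𝓡 2) ∞ M)
    (hF : ContMDiff (𝓡 2) 𝓘(ℝ, E4) ∞ F) (hu : u ∈ e.target) : ContDiffAt ℝ ∞ (inChart e F) u :=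
  contMDiffAt_iff_contDiffAt.mp
    ((hF _).comp u (contMDiffAt_symm_of_mem_maximalAtlas he hu))

theorem pd_inChart (he : e ∈ IsManifold.maximalAtlas (𝓡 2) ∞ M)
    (hF : ContMDiff (𝓡 2) 𝓘(ℝ, E4) ∞ F) (hu : u ∈ e.target) (i : Fin 2) :
    pd i (inChart e F) u = dmap F (e.symm u)
      (mfderiv (𝓡 2) (𝓡 2) e.symm u (EuclideanSpace.single i (1 : ℝ) : Coord 2)) := by
  have h := mfderiv_comp (I := 𝓡 2) (I' := 𝓡 2) (I'' := 𝓘(ℝ, E4)) (f := e.symm) (g := F) u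
    ((hF _).mdifferentiableAt (by simp))
    ((contMDiffAt_symm_of_mem_maximalAtlas he hu).mdifferentiableAt (by simp))
  have h2 : pd i (inChart e F) u = mfderiv (𝓡 2) 𝓘(ℝ, E4) (F ∘ e.symm) u
      (EuclideanSpace.single i (1 : ℝ) : Coord 2) := by
    rw [mfderiv_eq_fderiv]; rfl
  rw [h2, h]
  rfl

theorem bijective_mfderiv_symm (he : e ∈ IsManifold.maximalAtlas (𝓡 2) ∞ M)
    (hu : u ∈ e.target) : Function.Bijective (mfderiv (𝓡 2) (𝓡 2) e.symm u) := by
  have h : e.MDifferentiable (𝓡 2) (𝓡 2) :=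
    ⟨(contMDiffOn_of_mem_maximalAtlas he).mdifferentiableOn (by simp),
      (contMDiffOn_symm_of_mem_maximalAtlas he).mdifferentiableOn (by simp)⟩
  exact h.symm.mfderiv_bijective hu

theorem IsIsothermal.isoPatch (he : IsIsothermal x e) (hx : IsImmersedSurface x n)
    (humb : ∀ p, ¬ IsUmbilic x n p) : IsoPatch e.target (inChart e x) (inChart e n) := by
  have sx := fun u (hu : u ∈ e.target) => contDiffAt_inChart he.1 hx.smooth hu
  have sn := fun u (hu : u ∈ e.target) => contDiffAt_inChart he.1 hx.normal_smooth hu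
  have tangent : ∀ u ∈ e.target, ∀ i, inner ℝ (inChart e n u) (pd i (inChart e x) u) = 0 := by
    intro u hu i
    rw [pd_inChart he.1 hx.smooth hu]
    exact hx.normal_tangent _ _
  have pos : ∀ u ∈ e.target, 0 < inner ℝ (pd 0 (inChart e x) u) (pd 0 (inChart e x) u) := by
    intro u hu
    rw [real_inner_self_eq_norm_sq]
    refine pow_pos (norm_pos_iff.mpr fun h0 => ?_) 2
    rw [pd_inChart he.1 hx.smooth hu] at h0
    -- Both the differential of x and that of the inverse coordinate map are injective, so ∂_1 of
    -- the parametrization cannot vanish.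
    have h1 := hx.immersion (e.symm u) (h0.trans (map_zero (mfderiv (𝓡 2) 𝓘(ℝ, E4) x _)).symm)
    have h2 := (bijective_mfderiv_symm he.1 hu).1 (h1.trans (map_zero _).symm)
    exact one_ne_zero ((PiLp.single_eq_zero_iff _ _).mp h2)
  refine ⟨e.open_target, sx, sn, fun u _ => hx.unit _, fun u _ => hx.normal_unit _,
    fun u _ => hx.normal_point _, tangent, fun u hu => (he.2 u hu).1, fun u hu => (he.2 u hu).2,
    pos, ?_⟩
  rintro u hu ⟨h01, h00⟩
  have h10 : inner ℝ (pd 1 (inChart e x) u) (pd 0 (inChart e n) u) = 0 :=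
    (inner_pd_comm e.open_target sx sn tangent hu 1 0).trans h01
  have hp := (pos u hu).ne'
  have horth := (he.2 u hu).1
  have horth' := (real_inner_comm _ _).trans horth
  have hconf := (he.2 u hu).2
  have expand : ∀ {G : M → E4}, ContMDiff (𝓡 2) 𝓘(ℝ, E4) ∞ G → ∀ v : Coord 2,
      dmap G (e.symm u) (mfderiv (𝓡 2) (𝓡 2) e.symm u v)
        = v 0 • pd 0 (inChart e G) u + v 1 • pd 1 (inChart e G) u := by
    intro G hG v
    have h := mfderiv_comp (I := 𝓡 2) (I' := 𝓡 2) (I'' := 𝓘(ℝ, E4)) (f := e.symm) (g := G) u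
      ((hG _).mdifferentiableAt (by simp))
      ((contMDiffAt_symm_of_mem_maximalAtlas he.1 hu).mdifferentiableAt (by simp))
    have h2 := fderiv_coord (F := inChart e G) (c := u) v
    rw [Fin.sum_univ_two] at h2
    rw [← h2, ← mfderiv_eq_fderiv, show inChart e G = G ∘ e.symm from rfl, h]
    rfl
  -- If the second fundamental form is diagonal with equal entries in this coordinate, the
  -- umbilicity factor is the common entry −⟨x_1, n_1⟩ divided by ⟨x_1, x_1⟩. Every tangent vector
  -- is the image of a coordinate vector, so the coordinate check suffices.
  refine humb (e.symm u) ⟨-(inner ℝ (pd 0 (inChart e x) u) (pd 0 (inChart e n) u)) /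
    inner ℝ (pd 0 (inChart e x) u) (pd 0 (inChart e x) u), fun v w => ?_⟩
  obtain ⟨v, rfl⟩ := (bijective_mfderiv_symm he.1 hu).2 v
  obtain ⟨w, rfl⟩ := (bijective_mfderiv_symm he.1 hu).2 w
  rw [expand hx.smooth v, expand hx.smooth w, expand hx.normal_smooth w]
  simp only [inner_add_left, inner_add_right, real_inner_smul_left, real_inner_smul_right,
    h01, h10, horth, horth', ← h00, ← hconf]
  field_simp
  ring

theorem IsIsothermal.isReparam {e₁ e₂ : OpenPartialHomeomorph M (Coord 2)}
    (h₁ : IsIsothermal x e₁) (h₂ : IsIsothermal x e₂) (hx : IsImmersedSurface x n)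
    (humb : ∀ p, ¬ IsUmbilic x n p) :
    IsReparam (e₁.target ∩ e₁.symm ⁻¹' e₂.source) e₂.target (inChart e₁ x) (inChart e₁ n)
      (inChart e₂ x) (inChart e₂ n) (fun u => e₂ (e₁.symm u)) where
  left := (h₁.isoPatch hx humb).mono (e₁.isOpen_inter_preimage_symm e₂.open_source)
    Set.inter_subset_left
  right := h₂.isoPatch hx humb
  smooth := fun u hu => contMDiffAt_iff_contDiffAt.mp
    ((contMDiffAt_of_mem_maximalAtlas h₂.1 hu.2).comp u
      (contMDiffAt_symm_of_mem_maximalAtlas h₁.1 hu.1))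
  maps := fun _ hu => e₂.map_source hu.2
  eq := fun _ hu => congrArg x (e₂.left_inv hu.2).symm
  eq_normal := fun _ hu => congrArg n (e₂.left_inv hu.2).symm

theorem isConformalInvariant_invariantFive (hx : IsImmersedSurface x n)
    (humb : ∀ p, ¬ IsUmbilic x n p) : IsConformalInvariant 5 invariantFive x n where
  scalar := fun lam hl e₁ e₂ h₁ h₂ p hp₁ hp₂ => by
    have hp : e₁ p ∈ e₁.target ∩ e₁.symm ⁻¹' e₂.source :=
      ⟨e₁.map_source hp₁, by simpa [e₁.left_inv hp₁] using hp₂⟩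
    have := (h₁.isReparam h₂ hx humb).invariantFive_eq hl hp
    rwa [e₁.left_inv hp₁] at this
  natural := fun L hL lam mu hl hm hLm e he u hu =>
    ((he.isoPatch hx humb).isLorentzImage hL).invariantFive_eq hl hm
      (fun _ _ => (hLm _ (hx.unit _)).symm) hu
  scaling := fun lam mu hl hm e he u hu => (he.isoPatch hx humb).invariantFive_mul hl hm hu

end Manifold

end AssocSurface

end

theorem mainTheorem10 {M : Type*} [TopologicalSpace M]
    [ChartedSpace (AssocSurface.Coord 2) M] [IsManifold (𝓡 2) ∞ M]
    (x n : M → AssocSurface.E4) (hx : AssocSurface.IsImmersedSurface x n)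
    (humb : ∀ p, ¬ AssocSurface.IsUmbilic x n p) :
    (∀ lam, AssocSurface.IsConformalFactor lam →
      ∀ e, AssocSurface.IsIsothermal x e → ∀ u ∈ e.target, ∀ α : ℝ, 0 < α →
        (∃! v, AssocSurface.IsDualNull
          (AssocSurface.inChart e x) (AssocSurface.inChart e n) lam u v) ∧
        (AssocSurface.assocI (AssocSurface.inChart e x) (AssocSurface.inChart e n) lam
          !₂[α, 0, u 0, u 1]).det ≠ 0 ∧
        AssocSurface.assocLaplace (AssocSurface.inChart e x) (AssocSurface.inChart e n) lam
            (AssocSurface.assocLaplace (AssocSurface.inChart e x) (AssocSurface.inChart e n) lam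
              (AssocSurface.assocH (AssocSurface.inChart e x) (AssocSurface.inChart e n) lam))
            !₂[α, 0, u 0, u 1] =
          8 * (α ^ 5)⁻¹ * AssocSurface.invariantFive
            (AssocSurface.inChart e x) (AssocSurface.inChart e n) lam u) ∧
    AssocSurface.IsConformalInvariant 5 AssocSurface.invariantFive x n := by
  refine ⟨fun lam hl e he u hu α hα => ?_,
    AssocSurface.isConformalInvariant_invariantFive hx humb⟩
  have h := he.isoPatch hx humb
  have hb := AssocSurface.baseCoord_mk α 0 u
  have hc := h.mem_assocDom (c := !₂[α, 0, u 0, u 1]) hl hα rfl (hb.symm ▸ hu)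
  refine ⟨h.existsUnique_isDualNull hl hu, h.det_assocI_ne hl hc, ?_⟩
  have key := h.assocLaplace_assocLaplace_assocH hl hc rfl
  rw [hb] at key
  exact key
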